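/- Consider a two-sided matching market with a set $\mathcal M$ of $M$ men and a set $\mathcal W$ of $W$ women, and let $N=\min(M,W)\ge 2$. Every man $m$ gives a popularity $\mathcal D_m(w)>0$ to each woman $w$, and every woman $w$ gives a popularity $\mathcal D_w(m)>0$ to each man $m$ (so everybody finds every member of the opposite sex acceptable). Each person independently draws a complete preference list by sampling without replacement, from the favourite to the least favourite: at each step the next partner in the list is chosen among the remaining ones with probability proportional to its popularity. A matching is stable if there is no man $m$ and woman $w$ who each prefer the other to their current situation (any partner being preferred to being single). A stable husband of a woman is a man to whom she is matched in at least one stable matching. Let $$R_{\mathcal M}=\max_{m\in\mathcal M,\ w_0,w_1\in\mathcal W}\frac{\mathcal D_m(w_0)}{\mathcal D_m(w_1)},\qquad Q_{\mathcal W}=\max_{w_0,w_1\in\mathcal W,\ m_0,m_1\in\mathcal M}\frac{\mathcal D_{w_0}(m_0)}{\mathcal D_{w_0}(m_1)}\cdot\frac{\mathcal D_{w_1}(m_1)}{\mathcal D_{w_1}(m_0)}.$$ Then there is an absolute constant $C>0$ (independent of $M$, $W$ and all the popularities) such that, for every woman $w\in\mathcal W$, $$\mathbb E[\text{number of stable husbands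 of } w]\ \le\ C\cdot\frac{1+\ln Q_{\mathcal W}}{\ln\left(1+1/R_{\mathcal M}\right)}\cdot\ln^3 N.$$ -/

import Mathlib

/-! Two-sided matching markets with complete random popularity preferences. -/

namespace StableMarket

/-- A complete strict preference list over the finite set `α`: `σ k` is the partner in position `k`
(position `0` is the favourite), so that `σ.symm a` is the rank of `a`. -/
abbrev PrefList (α : Type*) [Fintype α] := Fin (Fintype.card α) ≃ α

/-- With the list `σ`, the partner `a` is strictly preferred to the current situation `o`,
where `none` means being single. Lists are complete, so every partner beats being single. -/
def PrefersTo {α : Type*} [Fintype α] (σ : PrefList α) (a : α) : Option α → Prop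
  | none => True
  | some b => σ.symm a < σ.symm b

/-- A matching: everybody is single (`none`) or matched with one person of the opposite sex. -/
structure Matching (Men Women : Type*) where
  wife : Men → Option Women
  husband : Women → Option Men
  wife_eq_some_iff : ∀ m w, wife m = some w ↔ husband w = some m

/-- A preference profile: the lists of all men and the lists of all women. -/
abbrev Profile (Men Women : Type*) [Fintype Men] [Fintype Women] :=
  (Men → PrefList Women) × (Women → PrefList Men)

section Market

variable {Men Women : Type*} [Fintype Men] [Fintype Women]

/-- The pair `(m, w)` blocks `μ`: each of them prefers the other to the situation in `μ`. -/
def Blocks (p : Profile Men Women) (μ : Matching Men Women) (m : Men) (w : Women) : Prop :=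
  PrefersTo (p.2 w) m (μ.husband w) ∧ PrefersTo (p.1 m) w (μ.wife m)

/-- A matching is stable when no man-woman pair blocks it. As the lists are complete, nobody
can be matched with an unacceptable partner. -/
def IsStable (p : Profile Men Women) (μ : Matching Men Women) : Prop :=
  ∀ m w, ¬ Blocks p μ m w

/-- The stable husbands of `w`: her husbands in the stable matchings. -/
def stableHusbands (p : Profile Men Women) (w : Women) : Set Men :=
  {m | ∃ μ : Matching Men Women, IsStable p μ ∧ μ.husband w = some m}

end Market

section Popularity

variable {α : Type*} [Fintype α]

/-- The probability that a person who gives popularity `D a` to each `a : α` has the list `σ`.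
The list is drawn from the favourite to the least favourite, without replacement: given
the choices made at the positions before `k`, the partner `σ k` is drawn with probability
`D (σ k)` over the total popularity of the partners that remain, which are the `σ j`, `k ≤ j`. -/
noncomputable def popularityProb (D : α → ℝ) (σ : PrefList α) : ℝ :=
  ∏ k, D (σ k) / ∑ j ∈ Finset.Ici k, D (σ j)

end Popularity

section RandomMarket

variable {Men Women : Type*} [Fintype Men] [Fintype Women]

/-- The probability of a profile, when man `m` has popularities `popM m` over the women, woman `w`
has popularities `popW w` over the men, and all lists are drawn independently. -/
noncomputable def profileProb (popM : Men → Women → ℝ) (popW : Women → Men → ℝ)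
    (p : Profile Men Women) : ℝ :=
  (∏ m, popularityProb (popM m) (p.1 m)) * ∏ w, popularityProb (popW w) (p.2 w)

/-- The expected number of stable husbands of `w`. -/
noncomputable def expectedStableHusbands [DecidableEq Men] [DecidableEq Women]
    (popM : Men → Women → ℝ) (popW : Women → Men → ℝ) (w : Women) : ℝ :=
  ∑ p : Profile Men Women, profileProb popM popW p * ((stableHusbands p w).ncard : ℝ)

/-- `R`: the maximal ratio, over the men `m` and the women `w₀`, `w₁`, between the popularities
that `m` gives to `w₀` and to `w₁`. -/
noncomputable def ratioR (popM : Men → Women → ℝ) : ℝ :=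
  ⨆ x : Men × Women × Women, popM x.1 x.2.1 / popM x.1 x.2.2

/-- `Q`: the maximum, over the women `w₀`, `w₁` and the men `m₀`, `m₁`, of
`(D_{w₀}(m₀) / D_{w₀}(m₁)) * (D_{w₁}(m₁) / D_{w₁}(m₀))`. -/
noncomputable def ratioQ (popW : Women → Men → ℝ) : ℝ :=
  ⨆ x : (Women × Women) × (Men × Men),
    popW x.1.1 x.2.1 / popW x.1.1 x.2.2 * (popW x.1.2 x.2.2 / popW x.1.2 x.2.1)

end RandomMarket

section Normalization

theorem sum_perm_prod_eq_one (n : ℕ) (D : Fin n → ℝ) (hD : ∀ a, 0 < D a) :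
    ∑ σ : Equiv.Perm (Fin n), ∏ k, D (σ k) / ∑ j ∈ Finset.Ici k, D (σ j) = 1 := by
  induction n with
  | zero => simp
  | succ n ih =>
    rw [← Equiv.Perm.decomposeFin.symm.sum_comp, Fintype.sum_prod_type]
    have h : ∀ (p : Fin (n + 1)) (e : Equiv.Perm (Fin n)),
        ∏ k, D (Equiv.Perm.decomposeFin.symm (p, e) k) /
          ∑ j ∈ Finset.Ici k, D (Equiv.Perm.decomposeFin.symm (p, e) j) =
        D p / (∑ a, D a) * ∏ k, D (Equiv.swap 0 p (e k).succ) /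
          ∑ j ∈ Finset.Ici k, D (Equiv.swap 0 p (e j).succ) := by
      intro p e
      rw [Fin.prod_univ_succ]
      congr 1
      · rw [Equiv.Perm.decomposeFin_symm_apply_zero]
        congr 1
        have : Finset.Ici (0 : Fin (n + 1)) = Finset.univ := by ext x; simp
        rw [this]
        exact Equiv.sum_comp (Equiv.Perm.decomposeFin.symm (p, e)) D
      · refine Finset.prod_congr rfl fun k _ => ?_
        rw [Equiv.Perm.decomposeFin_symm_apply_succ]
        congr 1
        rw [← Fin.map_succEmb_Ici, Finset.sum_map]
        refine Finset.sum_congr rfl fun j _ => ?_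
        simp [Equiv.Perm.decomposeFin_symm_apply_succ]
    simp_rw [h, ← Finset.mul_sum]
    have h' : ∀ p : Fin (n + 1), ∑ e : Equiv.Perm (Fin n),
        ∏ k, D (Equiv.swap 0 p (e k).succ) /
          ∑ j ∈ Finset.Ici k, D (Equiv.swap 0 p (e j).succ) = 1 := fun p =>
      ih (fun x => D (Equiv.swap 0 p x.succ)) fun _ => hD _
    simp_rw [h', mul_one, ← Finset.sum_div]
    exact div_self (Finset.sum_pos (fun a _ => hD a) Finset.univ_nonempty).ne'

/-- For positive popularities, `popularityProb` is a probability distribution. -/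
theorem sum_popularityProb {α : Type*} [Fintype α] [DecidableEq α] (D : α → ℝ)
    (hD : ∀ a, 0 < D a) : ∑ σ : PrefList α, popularityProb D σ = 1 := by
  let e := Fintype.equivFin α
  rw [← sum_perm_prod_eq_one _ (fun x => D (e.symm x)) fun _ => hD _]
  refine Fintype.sum_equiv (Equiv.equivCongr (Equiv.refl _) e) _ _ fun σ => ?_
  simp [popularityProb]

theorem popularityProb_nonneg {α : Type*} [Fintype α] (D : α → ℝ)
    (hD : ∀ a, 0 < D a) (σ : PrefList α) : 0 ≤ popularityProb D σ :=
  Finset.prod_nonneg fun _ _ => div_nonneg (hD _).le (Finset.sum_nonneg fun _ _ => (hD _).le)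

/-- For positive popularities, `profileProb` is a probability distribution. -/
theorem sum_profileProb {Men Women : Type*} [Fintype Men] [Fintype Women] [DecidableEq Men]
    [DecidableEq Women] (popM : Men → Women → ℝ) (popW : Women → Men → ℝ)
    (hM : ∀ m w, 0 < popM m w) (hW : ∀ w m, 0 < popW w m) :
    ∑ p : Profile Men Women, profileProb popM popW p = 1 := by
  rw [Fintype.sum_prod_type]
  simp only [profileProb]
  rw [← Finset.sum_mul_sum, ← Fintype.prod_sum, ← Fintype.prod_sum]
  simp [sum_popularityProb _ (hM _), sum_popularityProb _ (hW _)]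

end Normalization

end StableMarket

/-! ### Random lists drawn without replacement: law of a prefix, and who comes first -/

namespace StableMarket

/-! Run men-proposing deferred acceptance in the market `∅`, where `w` rejects everybody, and in the
markets `{m}`, where she accepts `m` alone. None of these runs reads the list of `w`. A stable
husband `m` proposes to `w` in the market `∅` (`IsStable.proposed`), and she prefers him to all his
rivals, the other men who propose to her in the market `{m}` (`IsStable.prefers`). If the list of
`w` is drawn last, a proposer `m` passes this test with probability at most his share `D m / (D m +
D(rivals))`, where `D = popW w`. So the expectation is at most the mean of `shareSum`
(`expectedStableHusbands_le`).

Of two proposers, at least one is a rival of the other (`Proposed.total`). A tournament inequality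
(`sum_div_le_log`) then bounds a sum of shares by a constant times the logarithm of the total
popularity over the smallest rival mass. What remains is to show that a man who proposes to `w` only
because she drops `m` is rarely far more popular than `m` and his rivals together.

Such men appear along the rejection chain that starts when `w` drops `m`. By deferred decisions each
step reveals a fresh entry of a list (`startState_eq_iff`, `menPrefixMass_update`). For `Z = 8 N ^ 4
Q`, with high probability no woman leaves a sufficiently popular man for one who is `Z` times less
popular (`Respects`), so a displacement raises the popularity of the proposer by a factor at most
`Z`. There is a level `α` such that the women left over by the men above `α` are at least as many as
the men between `α` and `α * Z ^ (s + 2)` (`windowBase_spec`). When a man above `α * Z` draws, the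
women who stop the climb are then at least as many as those who continue it, so, given that one of
the two happens, the climb continues with probability at most `q = R / (1 + R)`. Hence a run of `s`
climbs has probability of order `q ^ s` per step of the chain (`sum_reaches_le`). Taking `s` of
order `ln N / ln (1 + 1 / R)` and about `ln N` candidate levels, the popularity ratio is at most `Z
^ ((s + 2) * I)`, and its logarithm is the product of `s`, `ln N` and `ln N + ln Q`, up to
constants.

If `W ≥ 2 M`, single women are so numerous that the chain itself is short: all but fewer than `s`
proposers are `m` or his rivals, and `shareSum ≤ s + 1` (`shareSum_le_of_few`). -/

open scoped Classical in
/-- The probability that a list drawn with popularities `D` starts with `l`. -/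
noncomputable def prefixMass {α : Type*} [Fintype α] (D : α → ℝ) (l : List α) : ℝ :=
  ∑ σ : PrefList α, if l <+: List.ofFn σ then popularityProb D σ else 0

open scoped Classical in
/-- The total popularity of the partners that do not occur in `l`. -/
noncomputable def remaining {α : Type*} [Fintype α] (D : α → ℝ) (l : List α) : ℝ :=
  ∑ a ∈ Finset.univ.filter (fun a => a ∉ l), D a

section Prefix

variable {α : Type*} [Fintype α]

theorem append_prefix_ofFn {σ : PrefList α} {l : List α} {a : α} :
    l ++ [a] <+: List.ofFn σ ↔
      l <+: List.ofFn σ ∧ ∃ h : l.length < Fintype.card α, σ ⟨l.length, h⟩ = a := by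
  constructor
  · intro h
    refine ⟨(List.prefix_append _ _).trans h, ?_⟩
    have hl := h.length_le
    simp only [List.length_append, List.length_singleton, List.length_ofFn] at hl
    refine ⟨by omega, ?_⟩
    have := h.getElem (i := l.length) (by simp)
    simpa using this.symm
  · rintro ⟨h, hl, rfl⟩
    rw [List.prefix_iff_eq_take] at h ⊢
    rw [List.length_append, List.length_singleton, List.take_add_one, ← h]
    simp [hl]

theorem nodup_of_prefix {σ : PrefList α} {l : List α} (h : l <+: List.ofFn σ) : l.Nodup :=
  (List.nodup_ofFn.2 σ.injective).sublist h.sublist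

theorem mem_of_prefix_iff {σ : PrefList α} {l : List α} (h : l <+: List.ofFn σ) (a : α) :
    a ∈ l ↔ (σ.symm a : ℕ) < l.length := by
  constructor
  · intro ha
    obtain ⟨i, hi, rfl⟩ := List.getElem_of_mem ha
    have hl := h.length_le
    rw [List.length_ofFn] at hl
    have := h.getElem (i := i) hi
    rw [this]
    simpa using hi
  · intro ha
    have := h.getElem (i := (σ.symm a : ℕ)) ha
    simp only [List.getElem_ofFn, Fin.eta, Equiv.apply_symm_apply] at this
    rw [← this]
    exact List.getElem_mem _

open scoped Classical in
theorem sum_prefix_eq_sum_append (f : PrefList α → ℝ) (l : List α)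
    (hl : l.length < Fintype.card α) :
    (∑ σ : PrefList α, if l <+: List.ofFn σ then f σ else 0) =
      ∑ a, ∑ σ : PrefList α, if l ++ [a] <+: List.ofFn σ then f σ else 0 := by
  rw [Finset.sum_comm]
  refine Finset.sum_congr rfl fun σ _ => ?_
  simp only [append_prefix_ofFn]
  by_cases h : l <+: List.ofFn σ
  · rw [if_pos h, Finset.sum_eq_single (σ ⟨l.length, hl⟩)]
    · simp [h, hl]
    · intro b _ hb
      rw [if_neg]
      rintro ⟨_, _, h⟩
      exact hb h.symm
    · simp
  · simp [h]

theorem prefixMass_eq_sum_append (D : α → ℝ) (l : List α) (hl : l.length < Fintype.card α) :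
    prefixMass D l = ∑ a, prefixMass D (l ++ [a]) :=
  sum_prefix_eq_sum_append _ l hl

theorem prefixMass_nonneg (D : α → ℝ) (hD : ∀ a, 0 < D a) (l : List α) : 0 ≤ prefixMass D l := by
  refine Finset.sum_nonneg fun σ _ => ?_
  split_ifs
  · exact popularityProb_nonneg D hD σ
  · exact le_rfl

theorem prefixMass_eq_zero_of_not_nodup (D : α → ℝ) {l : List α} (hl : ¬ l.Nodup) :
    prefixMass D l = 0 := by
  refine Finset.sum_eq_zero fun σ _ => if_neg fun h => hl (nodup_of_prefix h)

theorem prefixMass_append_of_mem (D : α → ℝ) {l : List α} {a : α} (ha : a ∈ l) :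
    prefixMass D (l ++ [a]) = 0 := by
  refine prefixMass_eq_zero_of_not_nodup D fun h => ?_
  rw [List.nodup_append] at h
  exact h.2.2 a ha a (by simp) rfl

/-- The explicit product for `prefixMass`. -/
noncomputable def prefixProd (D : α → ℝ) (l : List α) : ℝ :=
  ∏ k : Fin l.length, D (l.get k) / remaining D (l.take k)

theorem prefixProd_append (D : α → ℝ) (l : List α) (a : α) :
    prefixProd D (l ++ [a]) = prefixProd D l * (D a / remaining D l) := by
  unfold prefixProd
  have hlen : (l ++ [a]).length = l.length + 1 := by simp
  rw [← Fin.prod_congr' _ hlen.symm, Fin.prod_univ_castSucc]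
  congr 1
  · refine Finset.prod_congr rfl fun k _ => ?_
    simp [List.take_append_of_le_length k.2.le]
  · simp

theorem remaining_pos (D : α → ℝ) (hD : ∀ a, 0 < D a) {l : List α}
    (hl : l.length < Fintype.card α) : 0 < remaining D l := by
  classical
  refine Finset.sum_pos (fun a _ => hD a) ?_
  by_contra h
  rw [Finset.not_nonempty_iff_eq_empty, Finset.filter_eq_empty_iff] at h
  simp only [Finset.mem_univ, not_not, true_implies] at h
  have h1 : l.toFinset = Finset.univ := by ext a; simp [h]
  have h2 := l.toFinset_card_le
  rw [h1, Finset.card_univ] at h2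
  omega

/-- Induction on the number of missing entries. A full list is a single outcome. For a shorter one,
the products over all possible next entries add up to the product for `l`, as the factors `D a /
remaining D l` sum to `1`. -/
theorem prefixMass_eq_prefixProd (D : α → ℝ) (hD : ∀ a, 0 < D a) :
    ∀ (n : ℕ) (l : List α), l.Nodup → l.length + n = Fintype.card α →
      prefixMass D l = prefixProd D l := by
  classical
  intro n
  induction n with
  | zero =>
    intro l hl hn
    rw [Nat.add_zero] at hn
    -- A list without repetitions that exhausts `α` is a bijection, so it is the prefix of exactly
    -- one outcome.
    let e : Fin (Fintype.card α) ≃ α := Equiv.ofBijective (fun k => l.get (Fin.cast hn.symm k)) (by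
      rw [Fintype.bijective_iff_injective_and_card]
      refine ⟨fun i j hij => ?_, by simp⟩
      have := (List.nodup_iff_injective_get.1 hl) hij
      simpa using this)
    have he : List.ofFn e = l := by
      apply List.ext_getElem
      · simp [hn]
      · intro i h1 h2
        simp [e]
    have huniq : ∀ σ : PrefList α, l <+: List.ofFn σ ↔ σ = e := by
      intro σ
      constructor
      · intro h
        have h3 := h.eq_of_length (by simp [hn])
        rw [← he] at h3
        exact (Equiv.coe_fn_injective (List.ofFn_injective h3)).symm
      · rintro rfl
        rw [he]
    unfold prefixMass
    simp only [huniq, Finset.sum_ite_eq', Finset.mem_univ, if_true]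
    unfold popularityProb prefixProd
    rw [← Fin.prod_congr' _ hn]
    refine Finset.prod_congr rfl fun k _ => ?_
    have h4 : e (Fin.cast hn k) = l.get k := by simp [e]
    rw [h4]
    congr 1
    unfold remaining
    have hpre : l.take k <+: List.ofFn e := by rw [he]; exact List.take_prefix _ _
    refine Finset.sum_bij' (fun j _ => e j) (fun a _ => e.symm a) ?_ ?_ ?_ ?_ ?_
    · intro j hj
      simp only [Finset.mem_filter, Finset.mem_univ, true_and]
      rw [mem_of_prefix_iff hpre]
      simp only [Finset.mem_Ici, Fin.le_def, Fin.val_cast] at hj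
      simp [hj]
    · intro a ha
      simp only [Finset.mem_filter, Finset.mem_univ, true_and] at ha
      rw [mem_of_prefix_iff hpre] at ha
      simp only [List.length_take, not_lt] at ha
      rw [Finset.mem_Ici, Fin.le_def, Fin.val_cast]
      have := k.2
      omega
    · simp
    · simp
    · simp
  | succ n ih =>
    intro l hl hn
    have hlt : l.length < Fintype.card α := by omega
    rw [prefixMass_eq_sum_append D l hlt]
    have hpos := remaining_pos D hD hlt
    have : ∀ a, prefixMass D (l ++ [a]) =
        if a ∉ l then prefixProd D l / remaining D l * D a else 0 := by
      intro a
      by_cases ha : a ∈ l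
      · rw [prefixMass_append_of_mem D ha, if_neg (by simpa using ha)]
      · rw [if_pos ha, ih _ (by
          rw [List.nodup_append]
          refine ⟨hl, by simp, ?_⟩
          intro x hx b hb
          rw [List.mem_singleton] at hb
          rintro rfl
          exact ha (hb ▸ hx)) (by simp; omega), prefixProd_append]
        ring
    simp_rw [this]
    rw [← Finset.sum_filter, ← Finset.mul_sum]
    change prefixProd D l / remaining D l * remaining D l = _
    field_simp

/-- The rule of deferred decisions: once `l` is revealed, the next entry is drawn from the rest in
proportion to `D`. -/
theorem prefixMass_append (D : α → ℝ) (hD : ∀ a, 0 < D a) {l : List α} {a : α} (ha : a ∉ l) :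
    prefixMass D (l ++ [a]) * remaining D l = D a * prefixMass D l := by
  classical
  by_cases hl : l.Nodup
  · have hl' : (l ++ [a]).Nodup := by
      rw [List.nodup_append]
      refine ⟨hl, by simp, ?_⟩
      intro x hx b hb
      rw [List.mem_singleton] at hb
      rintro rfl
      exact ha (hb ▸ hx)
    have h1 : (l ++ [a]).length ≤ Fintype.card α := hl'.length_le_card
    have h2 : l.length < Fintype.card α := by simp at h1; omega
    rw [prefixMass_eq_prefixProd D hD _ _ hl (Nat.add_sub_cancel' h2.le),
      prefixMass_eq_prefixProd D hD _ _ hl' (Nat.add_sub_cancel' h1), prefixProd_append]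
    have := remaining_pos D hD h2
    field_simp
  · rw [prefixMass_eq_zero_of_not_nodup D hl, prefixMass_eq_zero_of_not_nodup D, zero_mul, mul_zero]
    intro h
    exact hl (List.nodup_append.1 h).1

open scoped Classical in
/-- Along the draw of a list that has not met `insert m F` so far, the probability that `m` is the
first member of this set is its share of the popularity. -/
theorem sum_first_prefix_le (D : α → ℝ) (hD : ∀ a, 0 < D a) (F : Finset α) (m : α) (hm : m ∉ F) :
    ∀ (n : ℕ) (l : List α), l.length + n = Fintype.card α → m ∉ l → (∀ a ∈ F, a ∉ l) →
      (∑ σ : PrefList α, if l <+: List.ofFn σ then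
        (if ∀ a ∈ F, σ.symm m < σ.symm a then popularityProb D σ else 0) else 0) ≤
      D m / (D m + ∑ a ∈ F, D a) * prefixMass D l := by
  intro n
  induction n with
  | zero =>
    intro l hn hml hF
    have : ∀ σ : PrefList α, ¬ l <+: List.ofFn σ := by
      intro σ h
      apply hml
      rw [mem_of_prefix_iff h]
      have := (σ.symm m).2
      omega
    simp [this, prefixMass]
  | succ n ih =>
    intro l hn hml hF
    have hlt : l.length < Fintype.card α := by omega
    have hpos := remaining_pos D hD hlt
    have hFn : 0 ≤ ∑ a ∈ F, D a := Finset.sum_nonneg fun a _ => (hD a).le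
    have hT : 0 < D m + ∑ a ∈ F, D a := by have := hD m; linarith
    set T := D m + ∑ a ∈ F, D a with hTdef
    rw [sum_prefix_eq_sum_append _ l hlt]
    have hmass : ∀ a, a ∉ l → prefixMass D (l ++ [a]) = D a * (prefixMass D l / remaining D l) := by
      intro a ha
      have := prefixMass_append D hD ha
      field_simp
      linarith
    set ρ := prefixMass D l / remaining D l with hρ
    have hρ0 : 0 ≤ ρ := div_nonneg (prefixMass_nonneg D hD l) hpos.le
    -- Drawing `m` wins, drawing a member of `F` loses, and any other draw leaves the race as it
    -- was, so that the induction hypothesis applies.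
    have hstep : ∀ a, (∑ σ : PrefList α, if l ++ [a] <+: List.ofFn σ then
        (if ∀ a ∈ F, σ.symm m < σ.symm a then popularityProb D σ else 0) else 0) ≤
        if a ∉ l then ((if a = m then D m * ρ else 0) +
          D m / T * ρ * (D a - (if a ∈ insert m F then D a else 0))) else 0 := by
      intro a
      by_cases ha : a ∈ l
      · rw [if_neg (by simpa using ha)]
        refine le_of_eq (Finset.sum_eq_zero fun σ _ => if_neg fun h => ?_)
        have := nodup_of_prefix h
        rw [List.nodup_append] at this
        exact this.2.2 a ha a (by simp) rfl
      rw [if_pos ha]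
      by_cases ham : a = m
      · rw [if_pos ham, if_pos (by simp [ham]), sub_self, mul_zero, add_zero, ham,
          ← hmass m hml]
        refine Finset.sum_le_sum fun σ _ => ?_
        have := popularityProb_nonneg D hD σ
        split_ifs <;> first | exact le_rfl | exact this
      · rw [if_neg ham, zero_add]
        by_cases haF : a ∈ F
        · rw [if_pos (by simp [haF]), sub_self, mul_zero]
          refine le_of_eq (Finset.sum_eq_zero fun σ _ => ?_)
          split_ifs with h1 h2
          · exfalso
            have h3 := h2 a haF
            have h4 : (σ.symm a : ℕ) < (l ++ [a]).length :=
              (mem_of_prefix_iff h1 a).1 (by simp)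
            have h5 : ¬ (σ.symm m : ℕ) < (l ++ [a]).length := by
              rw [← mem_of_prefix_iff h1 m]
              simp [hml, Ne.symm ham]
            rw [Fin.lt_def] at h3
            omega
          · rfl
          · rfl
        · rw [if_neg (by simp [ham, haF]), sub_zero]
          have := ih (l ++ [a]) (by simp; omega) (by simp [hml, Ne.symm ham]) (by
            intro b hb
            have : b ≠ a := fun h => haF (h ▸ hb)
            simp [hF b hb, this])
          rw [hmass a ha] at this
          linarith
    refine (Finset.sum_le_sum fun a _ => hstep a).trans (le_of_eq ?_)
    rw [← Finset.sum_filter, Finset.sum_add_distrib, ← Finset.mul_sum, Finset.sum_sub_distrib,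
      Finset.sum_ite_eq', if_pos (by simpa using hml), ← Finset.sum_filter, Finset.filter_filter]
    have hfil : (Finset.univ.filter fun a => a ∉ l ∧ a ∈ insert m F) = insert m F := by
      ext a
      simp only [Finset.mem_filter, Finset.mem_univ, true_and, and_iff_right_iff_imp]
      intro h
      rcases Finset.mem_insert.1 h with rfl | h
      · exact hml
      · exact hF a h
    rw [hfil, Finset.sum_insert hm, ← hTdef]
    change _ + _ * (remaining D l - T) = _
    have : prefixMass D l = ρ * remaining D l := by rw [hρ]; field_simp
    rw [this]
    field_simp
    ring

open scoped Classical in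
/-- The probability that `m` comes before all members of `F`. -/
theorem sum_first_le (D : α → ℝ) (hD : ∀ a, 0 < D a) (F : Finset α) (m : α) (hm : m ∉ F) :
    (∑ σ : PrefList α, if ∀ a ∈ F, σ.symm m < σ.symm a then popularityProb D σ else 0) ≤
      D m / (D m + ∑ a ∈ F, D a) := by
  have h := sum_first_prefix_le D hD F m hm (Fintype.card α) [] (by simp) (by simp) (by simp)
  have h1 : prefixMass D [] = 1 := by
    simp only [prefixMass, List.nil_prefix, if_true]
    convert sum_popularityProb D hD
  rw [h1, mul_one] at h
  simpa only [List.nil_prefix, if_true] using h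

end Prefix

end StableMarket

namespace StableMarket

/-! ### Deferred acceptance when `w` accepts nobody or one man, and its link with stable matchings
-/

section Deferred

variable {Men Women : Type*} [Fintype Men] [Fintype Women]

/-- The rejections of men-proposing deferred acceptance, in the market where `w` accepts
only the men of `acc`. -/
inductive Rejected (p : Profile Men Women) (w : Women) (acc : Set Men) : Men → Women → Prop
  | unacceptable {m : Men} :
      (∀ b, (p.1 m).symm b < (p.1 m).symm w → Rejected p w acc m b) → m ∉ acc →
        Rejected p w acc m w
  | beaten {m m' : Men} {a : Women} : a ≠ w →
      (∀ b, (p.1 m).symm b < (p.1 m).symm a → Rejected p w acc m b) →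
      (∀ b, (p.1 m').symm b < (p.1 m').symm a → Rejected p w acc m' b) →
      (p.2 a).symm m' < (p.2 a).symm m → Rejected p w acc m a

/-- In the market where `w` accepts only the men of `acc`, the man `m` proposes to `a`. -/
def Proposed (p : Profile Men Women) (w : Women) (acc : Set Men) (m : Men) (a : Women) : Prop :=
  ∀ b, (p.1 m).symm b < (p.1 m).symm a → Rejected p w acc m b

/-- In the market where `w` accepts only the men of `acc`, the woman `a` ends up with `m`. -/
def Holds (p : Profile Men Women) (w : Women) (acc : Set Men) (m : Men) (a : Women) : Prop :=
  Proposed p w acc m a ∧ ¬ Rejected p w acc m a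

/-- The men rejected by everybody, in the market where `w` accepts only the men of `acc`. -/
def Unmatched (p : Profile Men Women) (w : Women) (acc : Set Men) (m : Men) : Prop :=
  ∀ b, Rejected p w acc m b

variable {p : Profile Men Women} {w : Women} {acc : Set Men}

/-- Least fixed point principle: a relation closed under both rules contains all rejections.
Comparisons between markets, with stable matchings and with rejection chains all go through it. -/
theorem Rejected.imp {X : Men → Women → Prop}
    (h1 : ∀ m, m ∉ acc → (∀ b, (p.1 m).symm b < (p.1 m).symm w → X m b) → X m w)
    (h2 : ∀ m m' a, a ≠ w → (∀ b, (p.1 m).symm b < (p.1 m).symm a → X m b) →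
      (∀ b, (p.1 m').symm b < (p.1 m').symm a → X m' b) →
      (p.2 a).symm m' < (p.2 a).symm m → X m a)
    {m : Men} {a : Women} (h : Rejected p w acc m a) : X m a := by
  induction h with
  | unacceptable _ hm ih => exact h1 _ hm ih
  | beaten ha _ _ hlt ih ih' => exact h2 _ _ _ ha ih ih' hlt

theorem Rejected.proposed {m : Men} {a : Women} (h : Rejected p w acc m a) :
    Proposed p w acc m a := by
  cases h with
  | unacceptable h _ => exact h
  | beaten _ h _ _ => exact h

theorem Rejected.mono {acc' : Set Men} (hacc : acc ⊆ acc') {m : Men} {a : Women}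
    (h : Rejected p w acc' m a) : Rejected p w acc m a :=
  h.imp (fun _ hm h => .unacceptable h fun h' => hm (hacc h'))
    fun _ _ _ ha h h' hlt => .beaten ha h h' hlt

/-- No rule consults the list of `w`, which is why it can be drawn after the run. -/
theorem Rejected.congr {p' : Profile Men Women} (h1 : p.1 = p'.1)
    (h2 : ∀ a, a ≠ w → p.2 a = p'.2 a) {m : Men} {a : Women}
    (h : Rejected p w acc m a) : Rejected p' w acc m a := by
  refine h.imp (fun _ hm h => .unacceptable (by rwa [← h1]) hm)
    fun _ _ _ ha h h' hlt => .beaten ha (by rwa [← h1]) (by rwa [← h1]) (by rwa [← h2 _ ha])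

theorem rejected_congr {p' : Profile Men Women} (h1 : p.1 = p'.1)
    (h2 : ∀ a, a ≠ w → p.2 a = p'.2 a) (m : Men) (a : Women) :
    Rejected p w acc m a ↔ Rejected p' w acc m a :=
  ⟨.congr h1 h2, .congr h1.symm fun a ha => (h2 a ha).symm⟩

theorem proposed_congr {p' : Profile Men Women} (h1 : p.1 = p'.1)
    (h2 : ∀ a, a ≠ w → p.2 a = p'.2 a) (m : Men) (a : Women) :
    Proposed p w acc m a ↔ Proposed p' w acc m a := by
  simp only [Proposed, rejected_congr h1 h2, h1]

theorem exists_holds_of_not_rejected {m : Men} {b : Women} (h : ¬ Rejected p w acc m b) :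
    ∃ a, (p.1 m).symm a ≤ (p.1 m).symm b ∧ Holds p w acc m a := by
  classical
  obtain ⟨a, ha, hmin⟩ := Finset.exists_min_image
    (Finset.univ.filter fun b => ¬ Rejected p w acc m b) (fun b => (p.1 m).symm b)
    ⟨b, by simpa using h⟩
  simp only [Finset.mem_filter, Finset.mem_univ, true_and] at ha hmin
  refine ⟨a, hmin b h, fun c hc => ?_, ha⟩
  by_contra hr
  exact absurd (hmin c hr) (not_le.2 hc)

theorem exists_holds_of_proposed {m : Men} {a : Women} (ha : a ≠ w)
    (h : Proposed p w acc m a) :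
    ∃ m', (p.2 a).symm m' ≤ (p.2 a).symm m ∧ Holds p w acc m' a := by
  classical
  obtain ⟨m', hm', hmin⟩ := Finset.exists_min_image
    (Finset.univ.filter fun m => Proposed p w acc m a) (fun m => (p.2 a).symm m)
    ⟨m, by simpa using h⟩
  simp only [Finset.mem_filter, Finset.mem_univ, true_and] at hm' hmin
  refine ⟨m', hmin m h, hm', fun hr => ?_⟩
  cases hr with
  | unacceptable => exact ha rfl
  | beaten _ _ h' hlt => exact absurd (hmin _ h') (not_le.2 hlt)

theorem Holds.mem_acc {m : Men} (h : Holds p w acc m w) : m ∈ acc := by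
  by_contra hm
  exact h.2 (.unacceptable h.1 hm)

theorem Holds.man_unique (hacc : acc.Subsingleton) {m m' : Men} {a : Women}
    (h : Holds p w acc m a) (h' : Holds p w acc m' a) : m = m' := by
  by_cases ha : a = w
  · subst ha
    exact hacc h.mem_acc h'.mem_acc
  · rcases lt_trichotomy ((p.2 a).symm m) ((p.2 a).symm m') with hlt | heq | hlt
    · exact absurd (.beaten ha h'.1 h.1 hlt) h'.2
    · exact (p.2 a).symm.injective heq
    · exact absurd (.beaten ha h.1 h'.1 hlt) h.2

theorem Holds.woman_unique {m : Men} {a b : Women}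
    (h : Holds p w acc m a) (h' : Holds p w acc m b) : a = b := by
  rcases lt_trichotomy ((p.1 m).symm a) ((p.1 m).symm b) with hlt | heq | hlt
  · exact absurd (h'.1 a hlt) h.2
  · exact (p.1 m).symm.injective heq
  · exact absurd (h.1 b hlt) h'.2

theorem Holds.of_proposed {m : Men} (h : Proposed p w acc m w) (hm : m ∈ acc) :
    Holds p w acc m w := by
  refine ⟨h, fun hr => ?_⟩
  cases hr with
  | unacceptable _ h' => exact h' hm
  | beaten h' => exact h' rfl

theorem not_unmatched_iff {m : Men} :
    ¬ Unmatched p w acc m ↔ ∃ a, Holds p w acc m a := by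
  constructor
  · intro h
    unfold Unmatched at h
    push Not at h
    obtain ⟨b, hb⟩ := h
    obtain ⟨a, _, ha⟩ := exists_holds_of_not_rejected hb
    exact ⟨a, ha⟩
  · rintro ⟨a, ha⟩ h
    exact ha.2 (h a)

open scoped Classical in
theorem card_not_unmatched_le (p : Profile Men Women) (w : Women) (hacc : acc.Subsingleton) :
    (Finset.univ.filter fun m => ¬ Unmatched p w acc m).card ≤
      min (Fintype.card Men) (Fintype.card Women) := by
  refine le_min (Finset.card_le_univ _) ?_
  have hex : ∀ m ∈ Finset.univ.filter fun m => ¬ Unmatched p w acc m, ∃ a, Holds p w acc m a := by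
    intro m hm
    exact not_unmatched_iff.1 (Finset.mem_filter.1 hm).2
  have _ : Nonempty Women := ⟨w⟩
  choose! f hf using hex
  rw [← Finset.card_univ]
  exact Finset.card_le_card_of_injOn f (fun _ _ => Finset.mem_coe.2 (Finset.mem_univ _))
    fun a ha b hb hab => Holds.man_unique hacc (hf a ha) (hab ▸ hf b hb)

/-- A man who proposes to `w` when she accepts nobody also does so when she accepts him alone. -/
theorem Proposed.self {m : Men} (h : Proposed p w ∅ m w) : Proposed p w {m} m w := by
  by_contra hn
  -- If `m` never reached `w`, her readiness to accept him would play no role, and all rejections of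
  -- the market `∅` would recur.
  have key : ∀ c a, Rejected p w ∅ c a → Rejected p w {m} c a := by
    intro c a hr
    refine hr.imp (X := fun c a => Rejected p w {m} c a) ?_
      fun _ _ _ ha h h' hlt => .beaten ha h h' hlt
    intro c _ hc
    refine .unacceptable hc fun hcm => hn ?_
    rw [Set.mem_singleton_iff] at hcm
    exact hcm ▸ hc
  exact hn fun b hb => key _ _ (h b hb)

/-- If `m'` proposes to `w` when she accepts nobody, then one of `m`, `m'` proposes to her when
she accepts only the other. -/
theorem Proposed.total {m m' : Men} (h' : Proposed p w ∅ m' w) :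
    Proposed p w {m} m' w ∨ Proposed p w {m'} m w := by
  by_contra! hn
  -- Under `hn`, a man who reaches `w` in both markets is neither `m` nor `m'`. So she rejects him
  -- in both, and all rejections of the market `∅` recur in both.
  have key : ∀ c a, Rejected p w ∅ c a → Rejected p w {m} c a ∧ Rejected p w {m'} c a := by
    intro c a hr
    refine hr.imp (X := fun c a => Rejected p w {m} c a ∧ Rejected p w {m'} c a) ?_
      fun _ _ _ ha h h' hlt => ⟨.beaten ha (fun b hb => (h b hb).1) (fun b hb => (h' b hb).1) hlt,
        .beaten ha (fun b hb => (h b hb).2) (fun b hb => (h' b hb).2) hlt⟩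
    intro c _ hc
    refine ⟨.unacceptable (fun b hb => (hc b hb).1) fun hcm => hn.2 ?_,
      .unacceptable (fun b hb => (hc b hb).2) fun hcm => hn.1 ?_⟩
    · rw [Set.mem_singleton_iff] at hcm
      exact fun b hb => hcm ▸ (hc b (hcm ▸ hb)).2
    · rw [Set.mem_singleton_iff] at hcm
      exact fun b hb => hcm ▸ (hc b (hcm ▸ hb)).1
  exact hn.1 fun b hb => (key _ _ (h' b hb)).1

/-- If `m` proposes to `w` and remains single when she accepts nobody, the other men who remain
single propose to `w` also when she accepts only `m`. -/
theorem Unmatched.proposed {m u : Men} (hm : Proposed p w ∅ m w) (hmU : Unmatched p w ∅ m)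
    (huU : Unmatched p w ∅ u) (hum : u ≠ m) : Proposed p w {m} u w := by
  classical
  by_contra hn
  have hu : ¬ Unmatched p w {m} u := fun h => hn fun b _ => h b
  have hm' : ¬ Unmatched p w {m} m :=
    not_unmatched_iff.2 ⟨w, Holds.of_proposed hm.self rfl⟩
  -- Since everybody rejected `m`, each woman other than `w` was asked and holds a man, who stays
  -- matched in the market `{m}`. Together with `m` and `u` this makes `W + 1` matched men, one too
  -- many.
  have hex : ∀ a : {a // a ≠ w}, ∃ c, Holds p w ∅ c a.1 := fun a =>
    let ⟨c, _, hc⟩ := exists_holds_of_proposed a.2 (hmU a.1).proposed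
    ⟨c, hc⟩
  choose f hf using hex
  have hinj : Function.Injective f := fun a b hab =>
    Subtype.ext ((hf a).woman_unique (hab ▸ hf b))
  have hsub : insert u (insert m (Finset.univ.image f)) ⊆
      Finset.univ.filter fun c => ¬ Unmatched p w {m} c := by
    intro c hc
    rw [Finset.mem_filter]
    refine ⟨Finset.mem_univ _, ?_⟩
    simp only [Finset.mem_insert, Finset.mem_image, Finset.mem_univ, true_and] at hc
    rcases hc with rfl | rfl | ⟨a, rfl⟩
    · exact hu
    · exact hm'
    · exact fun h => (hf a).2 ((h a.1).mono (Set.empty_subset _))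
  have hnot : ∀ c, Unmatched p w ∅ c → c ∉ Finset.univ.image f := by
    intro c hc h
    simp only [Finset.mem_image, Finset.mem_univ, true_and] at h
    obtain ⟨a, rfl⟩ := h
    exact (hf a).2 (hc a.1)
  have hcard := (Finset.card_le_card hsub).trans
    ((card_not_unmatched_le p w (Set.subsingleton_singleton (a := m))).trans (min_le_right _ _))
  rw [Finset.card_insert_of_notMem (by simp [hum, hnot u huU]),
    Finset.card_insert_of_notMem (hnot m hmU), Finset.card_image_of_injective _ hinj,
    Finset.card_univ, Fintype.card_subtype_compl, Fintype.card_subtype_eq] at hcard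
  have : 0 < Fintype.card Women := Fintype.card_pos_iff.2 ⟨w⟩
  omega

/-- The classical induction: where `a` rejects her stable husband for `m'`, all women `m'` prefers
to `a` have already rejected him and none is his wife, so `m'` and `a` block `μ`. -/
theorem IsStable.not_wife_of_rejected {μ : Matching Men Women} (hμ : IsStable p μ)
    (hacc : ∀ m, m ∉ acc → μ.wife m ≠ some w) {m : Men} {a : Women}
    (h : Rejected p w acc m a) : μ.wife m ≠ some a := by
  refine h.imp (X := fun m a => μ.wife m ≠ some a) (fun m hm _ => hacc m hm) ?_
  intro m m' a _ _ h' hlt hma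
  refine hμ m' a ⟨?_, ?_⟩
  · rw [(μ.wife_eq_some_iff m a).1 hma]
    exact hlt
  · cases hw : μ.wife m' with
    | none => trivial
    | some b =>
      change (p.1 m').symm a < (p.1 m').symm b
      rcases lt_trichotomy ((p.1 m').symm a) ((p.1 m').symm b) with h1 | h1 | h1
      · exact h1
      · have : a = b := (p.1 m').symm.injective h1
        subst this
        have h2 := (μ.wife_eq_some_iff m' a).1 hw
        rw [(μ.wife_eq_some_iff m a).1 hma] at h2
        cases h2
        exact absurd hlt (lt_irrefl _)
      · exact absurd hw (h' b h1)

/-- A woman prefers a stable husband to all the other men who propose to her when she accepts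
only him. -/
theorem IsStable.prefers {μ : Matching Men Women} (hμ : IsStable p μ) {h m : Men}
    (hh : μ.husband w = some h) (hm : Proposed p w {h} m w) (hmh : m ≠ h) :
    (p.2 w).symm h < (p.2 w).symm m := by
  have hacc : ∀ c, c ∉ ({h} : Set Men) → μ.wife c ≠ some w := by
    intro c hc hw
    rw [(μ.wife_eq_some_iff c w), hh] at hw
    cases hw
    exact hc rfl
  by_contra hlt
  have hlt' : (p.2 w).symm m < (p.2 w).symm h :=
    lt_of_le_of_ne (not_lt.1 hlt) fun h' => hmh ((p.2 w).symm.injective h')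
  -- Otherwise `m` and `w` block `μ`: the women he prefers to `w` have all rejected him in the
  -- market `{h}`, so none is his wife.
  refine hμ m w ⟨by rw [hh]; exact hlt', ?_⟩
  cases hw : μ.wife m with
  | none => trivial
  | some b =>
    change (p.1 m).symm w < (p.1 m).symm b
    rcases lt_trichotomy ((p.1 m).symm w) ((p.1 m).symm b) with h1 | h1 | h1
    · exact h1
    · have : w = b := (p.1 m).symm.injective h1
      subst this
      exact absurd hw (hacc m hmh)
    · exact absurd hw (hμ.not_wife_of_rejected hacc (hm b h1))

/-- A stable husband of `w` proposes to her when she accepts nobody. -/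
theorem IsStable.proposed {μ : Matching Men Women} (hμ : IsStable p μ) {h : Men}
    (hh : μ.husband w = some h) : Proposed p w ∅ h w := by
  classical
  -- The men better off in the market `∅` than in `μ`. Sending such a man to the husband in `μ` of
  -- the woman who holds him in the market `∅` maps `S` injectively into itself, hence onto. If `h`
  -- did not propose to `w`, he would lie in `S`; but he could only be reached through `w`, who
  -- holds nobody.
  let S : Set Men := {s | ∃ y, Holds p w ∅ s y ∧ PrefersTo (p.1 s) y (μ.wife s)}
  have hS : ∀ s a, μ.wife s = some a → ¬ Proposed p w ∅ s a → s ∈ S := by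
    intro s a hs hn
    unfold Proposed at hn
    push Not at hn
    obtain ⟨b, hb, hr⟩ := hn
    obtain ⟨y, hy, hH⟩ := exists_holds_of_not_rejected hr
    refine ⟨y, hH, ?_⟩
    rw [hs]
    exact hy.trans_lt hb
  have hex : ∀ s : S, ∃ t : S, ∃ y, Holds p w ∅ s.1 y ∧ μ.husband y = some t.1 := by
    rintro ⟨s, y, hH, hpref⟩
    have hyw : y ≠ w := by
      rintro rfl
      exact hH.mem_acc
    cases hs' : μ.husband y with
    | none => exact absurd ⟨by rw [hs']; trivial, hpref⟩ (hμ s y)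
    | some t =>
      have h1 : ¬ (p.2 y).symm s < (p.2 y).symm t := fun hlt =>
        hμ s y ⟨by rw [hs']; exact hlt, hpref⟩
      have hwt := (μ.wife_eq_some_iff t y).2 hs'
      have hne : t ≠ s := by
        rintro rfl
        rw [hwt] at hpref
        exact absurd hpref (lt_irrefl _)
      have h2 : (p.2 y).symm t < (p.2 y).symm s :=
        lt_of_le_of_ne (not_lt.1 h1) fun h' => hne ((p.2 y).symm.injective h')
      exact ⟨⟨t, hS t y hwt fun hp => hH.2 (.beaten hyw hH.1 hp h2)⟩, y, hH, hs'⟩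
  choose g y hy hg using hex
  have hinj : Function.Injective g := by
    intro s t hst
    have h1 := (μ.wife_eq_some_iff _ _).2 (hg s)
    rw [hst, (μ.wife_eq_some_iff _ _).2 (hg t)] at h1
    have h2 : y t = y s := Option.some_injective _ h1
    exact Subtype.ext (Holds.man_unique Set.subsingleton_empty (hy s) (h2 ▸ hy t))
  have hsurj := Finite.injective_iff_surjective.1 hinj
  by_contra hn
  have hwh := (μ.wife_eq_some_iff h w).2 hh
  obtain ⟨s, hs⟩ := hsurj ⟨h, hS h w hwh hn⟩
  have h1 := (μ.wife_eq_some_iff _ _).2 (hg s)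
  rw [hs, hwh] at h1
  have h2 : w = y s := Option.some_injective _ h1
  have h3 := hy s
  rw [← h2] at h3
  exact h3.mem_acc

end Deferred

end StableMarket

namespace StableMarket

/-! ### Rejection chains with deferred decisions, and the bound on their counter -/

section Chain

variable {Men Women : Type*} [Fintype Men] [Fintype Women]

/-- The probability of the lists of the men. -/
noncomputable def menProb (popM : Men → Women → ℝ) (x : Men → PrefList Women) : ℝ :=
  ∏ m, popularityProb (popM m) (x m)

/-- The lists of the men start with `l`. -/
def Extends (l : Men → List Women) (x : Men → PrefList Women) : Prop :=
  ∀ m, l m <+: List.ofFn (x m)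

section
open scoped Classical in
/-- The probability that the lists of the men start with `l`. -/
noncomputable def menPrefixMass (popM : Men → Women → ℝ) (l : Men → List Women) : ℝ :=
  ∑ x : Men → PrefList Women, if Extends l x then menProb popM x else 0
end

theorem menProb_nonneg {popM : Men → Women → ℝ} (hM : ∀ m a, 0 < popM m a)
    (x : Men → PrefList Women) : 0 ≤ menProb popM x :=
  Finset.prod_nonneg fun m _ => popularityProb_nonneg _ (hM m) _

theorem menPrefixMass_nonneg {popM : Men → Women → ℝ} (hM : ∀ m a, 0 < popM m a)
    (l : Men → List Women) : 0 ≤ menPrefixMass popM l := by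
  refine Finset.sum_nonneg fun x _ => ?_
  split_ifs
  · exact menProb_nonneg hM x
  · exact le_rfl

open scoped Classical in
theorem menPrefixMass_eq_prod (popM : Men → Women → ℝ) (l : Men → List Women) :
    menPrefixMass popM l = ∏ m, prefixMass (popM m) (l m) := by
  unfold prefixMass
  rw [Fintype.prod_sum]
  unfold menPrefixMass
  refine Finset.sum_congr (by congr) fun x _ => ?_
  unfold Extends menProb
  by_cases h : ∀ m, l m <+: List.ofFn (x m)
  · rw [if_pos h]
    exact Finset.prod_congr rfl fun m _ => (if_pos (h m)).symm
  · rw [if_neg h]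
    push Not at h
    obtain ⟨m, hm⟩ := h
    exact (Finset.prod_eq_zero (Finset.mem_univ m) (if_neg hm)).symm

omit [Fintype Men] in
open scoped Classical in
theorem extends_update_iff (l : Men → List Women) (x : Men → PrefList Women) (c : Men)
    (a : Women) : Extends (Function.update l c (l c ++ [a])) x ↔
      Extends l x ∧ ∃ h : (l c).length < Fintype.card Women, x c ⟨_, h⟩ = a := by
  unfold Extends
  constructor
  · intro h
    have hc := h c
    rw [Function.update_self, append_prefix_ofFn] at hc
    refine ⟨fun m => ?_, hc.2⟩
    by_cases hm : m = c
    · exact hm ▸ hc.1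
    · have := h m
      rwa [Function.update_of_ne hm] at this
  · rintro ⟨h, h'⟩ m
    by_cases hm : m = c
    · subst hm
      rw [Function.update_self, append_prefix_ofFn]
      exact ⟨h m, h'⟩
    · rw [Function.update_of_ne hm]
      exact h m

open scoped Classical in
theorem sum_extends_eq_sum_update (f : (Men → PrefList Women) → ℝ) (l : Men → List Women)
    (c : Men) (hl : (l c).length < Fintype.card Women) :
    (∑ x : Men → PrefList Women, if Extends l x then f x else 0) =
      ∑ a, ∑ x : Men → PrefList Women,
        if Extends (Function.update l c (l c ++ [a])) x then f x else 0 := by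
  rw [Finset.sum_comm]
  refine Finset.sum_congr rfl fun x _ => ?_
  simp only [extends_update_iff]
  by_cases h : Extends l x
  · rw [if_pos h, Finset.sum_eq_single (x c ⟨_, hl⟩)]
    · simp [h, hl]
    · intro b _ hb
      rw [if_neg]
      rintro ⟨_, _, h⟩
      exact hb h.symm
    · simp
  · simp [h]

open scoped Classical in
theorem menPrefixMass_update {popM : Men → Women → ℝ} (hM : ∀ m a, 0 < popM m a)
    (l : Men → List Women) (c : Men) {a : Women} (ha : a ∉ l c) :
    menPrefixMass popM (Function.update l c (l c ++ [a])) * remaining (popM c) (l c) =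
      popM c a * menPrefixMass popM l := by
  rw [menPrefixMass_eq_prod, menPrefixMass_eq_prod,
    ← Finset.mul_prod_erase _ _ (Finset.mem_univ c),
    ← Finset.mul_prod_erase (f := fun m => prefixMass (popM m) (l m)) _ (Finset.mem_univ c)]
  have : ∀ m ∈ Finset.univ.erase c, prefixMass (popM m) (Function.update l c (l c ++ [a]) m) =
      prefixMass (popM m) (l m) := by
    intro m hm
    rw [Function.update_of_ne (Finset.ne_of_mem_erase hm)]
  rw [Finset.prod_congr rfl this, Function.update_self]
  have := prefixMass_append (popM c) (hM c) ha
  linear_combination (∏ m ∈ Finset.univ.erase c, prefixMass (popM m) (l m)) * this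

/-- A state of a rejection chain: the revealed parts of the lists of the men, the current husbands,
the man who proposes next, and a counter. -/
structure ChainState (Men Women : Type*) where
  seen : Men → List Women
  hus : Women → Option Men
  cur : Men
  count : ℕ

open scoped Classical in
/-- The current man reveals `a` as his next choice, while `w` rejects everybody. The chain ends
(`none`) if `a` is single. The counter increases when an active man proposes to `w` or replaces a
man who is not low; the other replacements set it to `0`. -/
noncomputable def ChainState.step (y : Women → PrefList Men) (w : Women) (low act : Men → Prop)
    (st : ChainState Men Women) (a : Women) : Option (ChainState Men Women) :=
  if a = w then
    some ⟨Function.update st.seen st.cur (st.seen st.cur ++ [a]), st.hus, st.cur,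
      if act st.cur then st.count + 1 else st.count⟩
  else
    match st.hus a with
    | none => none
    | some c =>
      if (y a).symm st.cur < (y a).symm c then
        some ⟨Function.update st.seen st.cur (st.seen st.cur ++ [a]),
          Function.update st.hus a (some st.cur), c,
          if act st.cur ∧ ¬ low c then st.count + 1 else 0⟩
      else
        some ⟨Function.update st.seen st.cur (st.seen st.cur ++ [a]), st.hus, st.cur, st.count⟩

/-- Within `n` steps, the counter of the chain reaches `s`. -/
def Reaches (y : Women → PrefList Men) (w : Women) (low act : Men → Prop) (s : ℕ)
    (x : Men → PrefList Women) : ℕ → ChainState Men Women → Prop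
  | 0, st => s ≤ st.count
  | n + 1, st => s ≤ st.count ∨ ∃ h : (st.seen st.cur).length < Fintype.card Women,
      ∃ st', st.step y w low act (x st.cur ⟨_, h⟩) = some st' ∧
        Reaches y w low act s x n st'

/-- Within `n` steps of the chain, the man `m` proposes to `w`. -/
def Hits (y : Women → PrefList Men) (w : Women) (low act : Men → Prop)
    (x : Men → PrefList Women) : ℕ → ChainState Men Women → Men → Prop
  | 0, _, _ => False
  | n + 1, st, m => ∃ h : (st.seen st.cur).length < Fintype.card Women,
      (x st.cur ⟨_, h⟩ = w ∧ m = st.cur) ∨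
      ∃ st', st.step y w low act (x st.cur ⟨_, h⟩) = some st' ∧
        Hits y w low act x n st' m

/-- The invariants of the rejection chains; `U` is the set of the exhausted men. -/
structure ChainState.Inv (y : Women → PrefList Men) (w : Women) (U : Set Men)
    (st : ChainState Men Women) : Prop where
  hus_w : st.hus w = none
  last : ∀ a c, st.hus a = some c → (st.seen c).getLast? = some a
  held : ∀ c, c ≠ st.cur → c ∉ U → ∃ a, st.hus a = some c
  full : ∀ c ∈ U, (st.seen c).length = Fintype.card Women
  cur_notMem : st.cur ∉ U
  cur_free : ∀ a, st.hus a ≠ some st.cur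
  hus_notMem : ∀ a c, st.hus a = some c → c ∉ U
  best : ∀ a c, a ∈ st.seen c → a ≠ w → ∃ c', st.hus a = some c' ∧ (y a).symm c' ≤ (y a).symm c

variable {y : Women → PrefList Men} {w : Women} {low act : Men → Prop} {U : Set Men}

theorem ChainState.Inv.hus_inj {st : ChainState Men Women} (h : st.Inv y w U) {a b : Women}
    {c : Men} (ha : st.hus a = some c) (hb : st.hus b = some c) : a = b := by
  have h1 := h.last a c ha
  rw [h.last b c hb] at h1
  exact (Option.some_injective _ h1).symm

/-- The case in which the man stays free: only his revealed list grows. -/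
theorem ChainState.Inv.see {st : ChainState Men Women} (h : st.Inv y w U) {a : Women}
    (ha : a ≠ w → ∃ c', st.hus a = some c' ∧ (y a).symm c' ≤ (y a).symm st.cur) (k : ℕ)
    [DecidableEq Men] :
    ChainState.Inv y w U ⟨Function.update st.seen st.cur (st.seen st.cur ++ [a]), st.hus, st.cur,
      k⟩ where
  hus_w := h.hus_w
  last b c hb := by
    have : c ≠ st.cur := fun hc => h.cur_free b (hc ▸ hb)
    simpa only [Function.update_of_ne this] using h.last b c hb
  held := h.held
  full c hc := by
    have : c ≠ st.cur := fun h' => h.cur_notMem (h' ▸ hc)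
    simpa only [Function.update_of_ne this] using h.full c hc
  cur_notMem := h.cur_notMem
  cur_free := h.cur_free
  hus_notMem := h.hus_notMem
  best b c hb hbw := by
    by_cases hc : c = st.cur
    · subst hc
      simp only [Function.update_self, List.mem_append, List.mem_singleton] at hb
      rcases hb with hb | rfl
      · exact h.best b _ hb hbw
      · exact ha hbw
    · simp only [Function.update_of_ne hc] at hb
      exact h.best b c hb hbw

/-- The case in which he is accepted: the former husband becomes the next proposer. -/
theorem ChainState.Inv.replace {st : ChainState Men Women} (h : st.Inv y w U) {a : Women}
    {c : Men} (ha : st.hus a = some c) (hlt : (y a).symm st.cur < (y a).symm c) (k : ℕ)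
    [DecidableEq Men] [DecidableEq Women] :
    ChainState.Inv y w U ⟨Function.update st.seen st.cur (st.seen st.cur ++ [a]),
      Function.update st.hus a (some st.cur), c, k⟩ where
  hus_w := by
    have : w ≠ a := by
      rintro rfl
      rw [h.hus_w] at ha
      exact absurd ha (by simp)
    simpa only [Function.update_of_ne this] using h.hus_w
  last b d hb := by
    by_cases hba : b = a
    · subst hba
      simp only [Function.update_self, Option.some.injEq] at hb
      subst hb
      simp
    · simp only [Function.update_of_ne hba] at hb
      have : d ≠ st.cur := fun hc => h.cur_free b (hc ▸ hb)
      simpa only [Function.update_of_ne this] using h.last b d hb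
  held d hd hdU := by
    by_cases hdc : d = st.cur
    · exact ⟨a, by simp [hdc]⟩
    · obtain ⟨b, hb⟩ := h.held d hdc hdU
      have : b ≠ a := by
        rintro rfl
        rw [ha] at hb
        exact hd (Option.some_injective _ hb).symm
      exact ⟨b, by simpa only [Function.update_of_ne this] using hb⟩
  full d hd := by
    have : d ≠ st.cur := fun h' => h.cur_notMem (h' ▸ hd)
    simpa only [Function.update_of_ne this] using h.full d hd
  cur_notMem := h.hus_notMem a c ha
  cur_free b hb := by
    by_cases hba : b = a
    · subst hba
      simp only [Function.update_self, Option.some.injEq] at hb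
      exact h.cur_free b (hb ▸ ha)
    · simp only [Function.update_of_ne hba] at hb
      exact hba (h.hus_inj hb ha)
  hus_notMem b d hb := by
    by_cases hba : b = a
    · subst hba
      simp only [Function.update_self, Option.some.injEq] at hb
      exact hb ▸ h.cur_notMem
    · simp only [Function.update_of_ne hba] at hb
      exact h.hus_notMem b d hb
  best b d hb hbw := by
    by_cases hba : b = a
    · subst hba
      refine ⟨st.cur, by simp, ?_⟩
      by_cases hdc : d = st.cur
      · rw [hdc]
      · simp only [Function.update_of_ne hdc] at hb
        obtain ⟨c', hc', hle⟩ := h.best b d hb hbw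
        rw [ha] at hc'
        cases hc'
        exact hlt.le.trans hle
    · have hb' : b ∈ st.seen d := by
        by_cases hdc : d = st.cur
        · subst hdc
          simpa [hba] using hb
        · simpa only [Function.update_of_ne hdc] using hb
      simpa only [Function.update_of_ne hba] using h.best b d hb' hbw

omit [Fintype Women] in
open scoped Classical in
theorem ChainState.step_eq_some {st st' : ChainState Men Women} {a : Women}
    (hst : st.step y w low act a = some st') :
    (a = w ∧ st' = ⟨Function.update st.seen st.cur (st.seen st.cur ++ [a]), st.hus, st.cur,
      if act st.cur then st.count + 1 else st.count⟩) ∨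
    (a ≠ w ∧ ∃ c, st.hus a = some c ∧ (y a).symm st.cur < (y a).symm c ∧
      st' = ⟨Function.update st.seen st.cur (st.seen st.cur ++ [a]),
          Function.update st.hus a (some st.cur), c,
          if act st.cur ∧ ¬ low c then st.count + 1 else 0⟩) ∨
    (a ≠ w ∧ ∃ c, st.hus a = some c ∧ ¬ (y a).symm st.cur < (y a).symm c ∧
      st' = ⟨Function.update st.seen st.cur (st.seen st.cur ++ [a]), st.hus, st.cur,
        st.count⟩) := by
  unfold ChainState.step at hst
  by_cases haw : a = w
  · rw [if_pos haw] at hst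
    exact .inl ⟨haw, (Option.some_injective _ hst).symm⟩
  · rw [if_neg haw] at hst
    cases hc : st.hus a with
    | none => rw [hc] at hst; cases hst
    | some c =>
      rw [hc] at hst
      by_cases hlt : (y a).symm st.cur < (y a).symm c
      · simp only [if_pos hlt] at hst
        exact .inr (.inl ⟨haw, c, rfl, hlt, (Option.some_injective _ hst).symm⟩)
      · simp only [if_neg hlt] at hst
        exact .inr (.inr ⟨haw, c, rfl, hlt, (Option.some_injective _ hst).symm⟩)

omit [Fintype Women] in
theorem ChainState.hus_eq_none_of_step {st : ChainState Men Women} {a : Women}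
    (hst : st.step y w low act a = none) : a ≠ w ∧ st.hus a = none := by
  unfold ChainState.step at hst
  by_cases haw : a = w
  · rw [if_pos haw] at hst
    cases hst
  · rw [if_neg haw] at hst
    refine ⟨haw, ?_⟩
    cases hc : st.hus a with
    | none => rfl
    | some c =>
      rw [hc] at hst
      by_cases hlt : (y a).symm st.cur < (y a).symm c
      · simp only [if_pos hlt] at hst
        cases hst
      · simp only [if_neg hlt] at hst
        cases hst

theorem ChainState.Inv.step {st st' : ChainState Men Women} (h : st.Inv y w U) {a : Women}
    (hst : st.step y w low act a = some st') : st'.Inv y w U := by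
  classical
  rcases ChainState.step_eq_some hst with ⟨haw, rfl⟩ | ⟨_, c, hc, hlt, rfl⟩ | ⟨_, c, hc, hlt, rfl⟩
  · convert h.see (fun h => absurd haw h) _
  · convert h.replace hc hlt _
  · convert h.see (fun _ => ⟨c, hc, not_lt.1 hlt⟩) _

omit [Fintype Women] in
open scoped Classical in
theorem ChainState.step_seen {st st' : ChainState Men Women} {a : Women}
    (hst : st.step y w low act a = some st') :
    st'.seen = Function.update st.seen st.cur (st.seen st.cur ++ [a]) := by
  rcases ChainState.step_eq_some hst with ⟨_, rfl⟩ | ⟨_, _, _, _, rfl⟩ | ⟨_, _, _, _, rfl⟩ <;> rfl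

/-- The women for whom the counter increases if the current man is active. -/
def ChainState.Advances (y : Women → PrefList Men) (w : Women) (low : Men → Prop)
    (st : ChainState Men Women) (a : Women) : Prop :=
  a = w ∨ ∃ c, st.hus a = some c ∧ (y a).symm st.cur < (y a).symm c ∧ ¬ low c

/-- The women for whom the chain ends or the counter returns to `0`, if the current man is
active. -/
def ChainState.Resets (y : Women → PrefList Men) (w : Women) (low : Men → Prop)
    (st : ChainState Men Women) (a : Women) : Prop :=
  a ≠ w ∧ (st.hus a = none ∨ ∃ c, st.hus a = some c ∧ (y a).symm st.cur < (y a).symm c ∧ low c)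

/-- By `best`, a woman asked before holds someone at least as good. So all resetting women are still
available to the draw, and they may be counted among all women. -/
theorem ChainState.Inv.not_mem_of_resets {st : ChainState Men Women} (h : st.Inv y w U)
    {a : Women} (ha : st.Resets y w low a) : a ∉ st.seen st.cur := by
  intro hm
  obtain ⟨c', hc', hle⟩ := h.best a _ hm ha.1
  rcases ha.2 with h' | ⟨c, hc, hlt, _⟩
  · rw [h'] at hc'
    cases hc'
  · rw [hc] at hc'
    cases hc'
    exact absurd hlt (not_lt.2 hle)

/-- The place where `R` enters: for `q = R / (1 + R)` the hypothesis says that no weight exceeds `R`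
times another, so a set that is not larger has at most `R` times the weight. -/
theorem sum_le_mul_sum_of_card_le {α : Type*} {D : α → ℝ} {q : ℝ} (hq0 : 0 ≤ q) (hq1 : q ≤ 1)
    (hD : ∀ a, 0 < D a) (hD2 : ∀ a b, D a ≤ q * (D a + D b)) {s t : Finset α}
    (hst : s.card ≤ t.card) : ∑ a ∈ s, D a ≤ q * (∑ a ∈ s, D a + ∑ a ∈ t, D a) := by
  rcases s.eq_empty_or_nonempty with rfl | hs
  · simp only [Finset.sum_empty, zero_add]
    exact mul_nonneg hq0 (Finset.sum_nonneg fun a _ => (hD a).le)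
  obtain ⟨m, _, hm⟩ := Finset.exists_max_image s (fun a => D a - q * D a) hs
  have hm0 : 0 ≤ D m - q * D m := by nlinarith [hD m]
  have h1 : ∑ a ∈ s, (D a - q * D a) ≤ s.card • (D m - q * D m) := Finset.sum_le_card_nsmul _ _ _ hm
  have h2 : t.card • (D m - q * D m) ≤ ∑ b ∈ t, q * D b :=
    Finset.card_nsmul_le_sum _ _ _ fun b _ => by linarith [hD2 m b]
  have h3 : s.card • (D m - q * D m) ≤ t.card • (D m - q * D m) :=
    nsmul_le_nsmul_left hm0 hst
  rw [Finset.sum_sub_distrib, ← Finset.mul_sum] at h1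
  rw [← Finset.mul_sum] at h2
  linarith

open scoped Classical in
/-- The counter of a rejection chain is unlikely to become large. -/
theorem sum_reaches_le {popM : Men → Women → ℝ} (hM : ∀ m a, 0 < popM m a) {q δ : ℝ}
    (hq0 : 0 ≤ q) (hq1 : q ≤ 1) (hq : ∀ m a b, popM m a ≤ q * (popM m a + popM m b))
    {s : ℕ} (hδ0 : 0 ≤ δ) (hδ : (∀ c, act c ∧ ¬ low c) ∨ q ^ s ≤ δ)
    {J : ChainState Men Women → Prop}
    (hJ : ∀ st a st', st.Inv y w U → J st → st.count < s →
      st.step y w low act a = some st' → J st')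
    (hrace : ∀ st, st.Inv y w U → J st → st.count < s → act st.cur →
      (Finset.univ.filter fun a => st.Advances y w low a).card ≤
        (Finset.univ.filter fun a => st.Resets y w low a).card) :
    ∀ (n : ℕ) (st : ChainState Men Women), st.Inv y w U → J st →
      (∑ x : Men → PrefList Women, if Extends st.seen x then
        (if Reaches y w low act s x n st then menProb popM x else 0) else 0) ≤
      (q ^ (s - st.count) + n * δ) * menPrefixMass popM st.seen := by
  have htriv : ∀ (n : ℕ) (st : ChainState Men Women), s ≤ st.count →
      (∑ x : Men → PrefList Women, if Extends st.seen x then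
        (if Reaches y w low act s x n st then menProb popM x else 0) else 0) ≤
      (q ^ (s - st.count) + n * δ) * menPrefixMass popM st.seen := by
    intro n st hs
    rw [Nat.sub_eq_zero_of_le hs, pow_zero]
    have h1 : (∑ x : Men → PrefList Women, if Extends st.seen x then
        (if Reaches y w low act s x n st then menProb popM x else 0) else 0) ≤
        menPrefixMass popM st.seen := by
      refine Finset.sum_le_sum fun x _ => ?_
      have := menProb_nonneg hM x
      split_ifs <;> first | exact le_rfl | exact this
    have h2 : 0 ≤ n * δ * menPrefixMass popM st.seen :=
      mul_nonneg (mul_nonneg n.cast_nonneg hδ0) (menPrefixMass_nonneg hM _)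
    linarith
  intro n
  induction n with
  | zero =>
    intro st hst hJst
    by_cases hs : s ≤ st.count
    · exact htriv 0 st hs
    · simp only [Reaches, hs, if_false, ite_self, Finset.sum_const_zero]
      exact mul_nonneg (by positivity) (menPrefixMass_nonneg hM _)
  | succ n ih =>
    intro st hst hJst
    by_cases hs : s ≤ st.count
    · exact htriv _ st hs
    push Not at hs
    by_cases hl : (st.seen st.cur).length < Fintype.card Women
    swap
    · simp only [Reaches, not_le.2 hs, hl, false_or, IsEmpty.exists_iff, if_false, ite_self,
        Finset.sum_const_zero]
      exact mul_nonneg (by positivity) (menPrefixMass_nonneg hM _)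
    rw [sum_extends_eq_sum_update _ _ st.cur hl]
    have hpos := remaining_pos (popM st.cur) (hM st.cur) hl
    set D := popM st.cur with hD
    set ρ := menPrefixMass popM st.seen / remaining D (st.seen st.cur) with hρ
    have hρ0 : 0 ≤ ρ := div_nonneg (menPrefixMass_nonneg hM _) hpos.le
    have hmass : ∀ a, a ∉ st.seen st.cur → menPrefixMass popM
        (Function.update st.seen st.cur (st.seen st.cur ++ [a])) = D a * ρ := by
      intro a ha
      have := menPrefixMass_update hM st.seen st.cur ha
      rw [hρ]
      field_simp
      linarith
    -- The bound after drawing `a`, for the potential `q ^ (s - count)`. Advancing multiplies it by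
    -- `1 / q`. A return to `0` leaves `q ^ s`, which is paid by the allowance `δ` of this step; if
    -- the counter never returns to `0`, the allowance may vanish.
    set e : Women → ℝ := fun a => (n + 1) * δ +
      if act st.cur then
        if st.Advances y w low a then q ^ (s - (st.count + 1)) else
          if st.Resets y w low a then 0 else q ^ (s - st.count)
      else q ^ (s - st.count) with he
    have he0 : ∀ a, 0 ≤ e a := by
      intro a
      simp only [he]
      split_ifs <;> positivity
    have hstep : ∀ a, (∑ x : Men → PrefList Women,
        if Extends (Function.update st.seen st.cur (st.seen st.cur ++ [a])) x then
          (if Reaches y w low act s x (n + 1) st then menProb popM x else 0) else 0) ≤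
        if a ∉ st.seen st.cur then e a * (D a * ρ) else 0 := by
      intro a
      by_cases ha : a ∈ st.seen st.cur
      · rw [if_neg (by simpa using ha)]
        refine le_of_eq (Finset.sum_eq_zero fun x _ => if_neg fun h => ?_)
        have := nodup_of_prefix (h st.cur)
        rw [Function.update_self, List.nodup_append] at this
        exact this.2.2 a ha a (by simp) rfl
      rw [if_pos ha, ← hmass a ha]
      have hR : ∀ x, Extends (Function.update st.seen st.cur (st.seen st.cur ++ [a])) x →
          (Reaches y w low act s x (n + 1) st ↔
            ∃ st', st.step y w low act a = some st' ∧ Reaches y w low act s x n st') := by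
        intro x hx
        obtain ⟨_, h, hxa⟩ := (extends_update_iff _ _ _ _).1 hx
        simp only [Reaches, not_le.2 hs, false_or, hxa, exists_prop, hl, true_and]
      cases hstp : st.step y w low act a with
      | none =>
        refine (le_of_eq (Finset.sum_eq_zero fun x _ => ?_)).trans
          (mul_nonneg (he0 a) (menPrefixMass_nonneg hM _))
        split_ifs with h1 h2
        · rw [hR x h1, hstp] at h2
          obtain ⟨_, h3, _⟩ := h2
          cases h3
        · rfl
        · rfl
      | some st' =>
        have hseen := ChainState.step_seen hstp
        have h1 := ih st' (hst.step hstp) (hJ st a st' hst hJst hs hstp)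
        rw [hseen] at h1
        refine le_trans (le_of_eq (Finset.sum_congr rfl fun x _ => ?_)) (h1.trans
          (mul_le_mul_of_nonneg_right ?_ (menPrefixMass_nonneg hM _)))
        · by_cases hx : Extends (Function.update st.seen st.cur (st.seen st.cur ++ [a])) x
          · rw [if_pos hx, if_pos hx]
            have : Reaches y w low act s x (n + 1) st ↔ Reaches y w low act s x n st' := by
              rw [hR x hx, hstp]
              simp
            simp only [this]
          · rw [if_neg hx, if_neg hx]
        · simp only [he]
          have hqs : 0 ≤ q ^ (s - st.count) := by positivity
          rcases ChainState.step_eq_some hstp with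
            ⟨haw, rfl⟩ | ⟨haw, c, hc, hlt, rfl⟩ | ⟨haw, c, hc, hlt, rfl⟩
          · by_cases hact : act st.cur
            · have hadv : st.Advances y w low a := .inl haw
              simp only [if_pos hact, if_pos hadv]
              linarith
            · simp only [if_neg hact]
              linarith
          · have hact0 : ¬ (act st.cur ∧ ¬ low c) → q ^ s ≤ δ := fun h => by
              rcases hδ with h' | h'
              · exact absurd ⟨(h' _).1, (h' _).2⟩ h
              · exact h'
            by_cases hact : act st.cur
            · by_cases hlow : low c
              · have := hact0 fun h => h.2 hlow
                have h2 : ¬ (act st.cur ∧ ¬ low c) := fun h => h.2 hlow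
                have hadv : ¬ st.Advances y w low a := by
                  rintro (h | ⟨d, hd, _, hdl⟩)
                  · exact haw h
                  · rw [hc] at hd
                    cases hd
                    exact hdl hlow
                have hres : st.Resets y w low a := ⟨haw, .inr ⟨c, hc, hlt, hlow⟩⟩
                simp only [if_neg h2, if_pos hact, if_neg hadv, if_pos hres, Nat.sub_zero]
                linarith
              · have hadv : st.Advances y w low a := .inr ⟨c, hc, hlt, hlow⟩
                simp only [if_pos (And.intro hact hlow), if_pos hact, if_pos hadv]
                linarith
            · have := hact0 fun h => hact h.1
              have h2 : ¬ (act st.cur ∧ ¬ low c) := fun h => hact h.1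
              simp only [if_neg h2, if_neg hact, Nat.sub_zero]
              linarith
          · have hadv : ¬ st.Advances y w low a := by
              rintro (h | ⟨d, hd, h, _⟩)
              · exact haw h
              · rw [hc] at hd
                cases hd
                exact hlt h
            have hres : ¬ st.Resets y w low a := by
              rintro ⟨_, h | ⟨d, hd, h, _⟩⟩
              · rw [hc] at h
                cases h
              · rw [hc] at hd
                cases hd
                exact hlt h
            simp only [if_neg hadv, if_neg hres, ite_self]
            linarith
    refine (Finset.sum_le_sum fun a _ => hstep a).trans ?_
    rw [← Finset.sum_filter]
    have hm : menPrefixMass popM st.seen = ρ * remaining D (st.seen st.cur) := by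
      rw [hρ]
      field_simp
    rw [hm]
    have key : ∑ a ∈ Finset.univ.filter (fun a => a ∉ st.seen st.cur), e a * D a ≤
        (q ^ (s - st.count) + ((n + 1 : ℕ) : ℝ) * δ) * remaining D (st.seen st.cur) := by
      unfold remaining
      push_cast
      by_cases hact : act st.cur
      · set T := Finset.univ.filter (fun a => a ∉ st.seen st.cur) with hT
        set A := T.filter fun a => st.Advances y w low a with hA
        set B := T.filter fun a => st.Resets y w low a with hB
        have hdisj : ∀ a, st.Advances y w low a → ¬ st.Resets y w low a := by
          rintro a (rfl | ⟨c, hc, _, hlow⟩) ⟨h1, h2⟩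
          · exact h1 rfl
          · rcases h2 with h2 | ⟨d, hd, _, hdl⟩
            · rw [hc] at h2
              cases h2
            · rw [hc] at hd
              cases hd
              exact hlow hdl
        have hBcard : B = Finset.univ.filter fun a => st.Resets y w low a := by
          ext a
          simp only [hB, hT, Finset.mem_filter, Finset.mem_univ, true_and, and_iff_right_iff_imp]
          exact fun h => hst.not_mem_of_resets h
        have hcard : A.card ≤ B.card := by
          rw [hBcard]
          refine le_trans (Finset.card_le_card ?_) (hrace st hst hJst hs hact)
          exact Finset.filter_subset_filter _ (Finset.subset_univ _)
        -- The balance of the step: the growth of the potential on `A` is offset by its loss on `B`.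
        have hAB := sum_le_mul_sum_of_card_le hq0 hq1 (hM st.cur) (hq st.cur) hcard
        have hpw : q ^ (s - st.count) = q ^ (s - (st.count + 1)) * q := by
          rw [← pow_succ]
          congr 1
          omega
        have hsum : ∀ a ∈ T, e a * D a = ((n + 1) * δ + q ^ (s - st.count)) * D a +
            ((if st.Advances y w low a then
              (q ^ (s - (st.count + 1)) - q ^ (s - st.count)) * D a else 0) -
            (if st.Resets y w low a then q ^ (s - st.count) * D a else 0)) := by
          intro a _
          simp only [he, if_pos hact]
          by_cases h1 : st.Advances y w low a
          · simp only [if_pos h1, if_neg (hdisj a h1)]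
            ring
          · by_cases h2 : st.Resets y w low a
            · simp only [if_neg h1, if_pos h2]
              ring
            · simp only [if_neg h1, if_neg h2]
              ring
        rw [Finset.sum_congr rfl hsum, Finset.sum_add_distrib, Finset.sum_sub_distrib,
          ← Finset.sum_filter, ← Finset.sum_filter, ← Finset.mul_sum, ← Finset.mul_sum,
          ← Finset.mul_sum, ← hA, ← hB]
        have h0 : 0 ≤ q ^ (s - (st.count + 1)) := by positivity
        have := mul_le_mul_of_nonneg_left hAB h0
        rw [hpw]
        nlinarith
      · simp only [he, if_neg hact]
        rw [← Finset.mul_sum]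
        apply le_of_eq
        ring
    calc _ = ρ * ∑ a ∈ Finset.univ.filter (fun a => a ∉ st.seen st.cur), e a * D a := by
          rw [Finset.mul_sum]
          exact Finset.sum_congr rfl fun a _ => by ring
      _ ≤ ρ * ((q ^ (s - st.count) + ((n + 1 : ℕ) : ℝ) * δ) * remaining D (st.seen st.cur)) :=
          mul_le_mul_of_nonneg_left key hρ0
      _ = _ := by ring

end Chain

end StableMarket

namespace StableMarket

/-! ### The chain finds all proposers of the market where `w` accepts nobody -/

section ChainFacts

variable {Men Women : Type*} [Fintype Men] [Fintype Women]
variable {y : Women → PrefList Men} {w : Women} {low act : Men → Prop} {U : Set Men}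

theorem symm_eq_of_prefix {α : Type*} [Fintype α] {σ τ : PrefList α} {l : List α}
    (hσ : l <+: List.ofFn σ) (hτ : l <+: List.ofFn τ) {a : α} (ha : a ∈ l) :
    σ.symm a = τ.symm a := by
  have h1 := (mem_of_prefix_iff hσ a).1 ha
  have h2 := hσ.getElem h1
  rw [hτ.getElem h1] at h2
  simp only [List.getElem_ofFn, Fin.eta, Equiv.apply_symm_apply] at h2
  rw [Equiv.eq_symm_apply]
  exact h2

theorem filter_prefix_of_pairwise {α : Type*} (P : α → Prop) [DecidablePred P] (L : List α)
    (h : L.Pairwise fun a b => P b → P a) : L.filter P <+: L := by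
  induction L with
  | nil => simp
  | cons a L ih =>
    rw [List.pairwise_cons] at h
    by_cases ha : P a
    · rw [List.filter_cons_of_pos (by simpa using ha), List.prefix_cons_inj]
      exact ih h.2
    · rw [List.filter_eq_nil_iff.2]
      · exact List.nil_prefix
      · intro b hb
        simp only [decide_eq_true_eq]
        rcases List.mem_cons.1 hb with rfl | hb
        · exact ha
        · exact fun hPb => ha (h.1 b hb hPb)

/-- Where a rejection chain has ended, all proposals of the market without `w` are revealed. -/
theorem mem_seen_of_terminal {x : Men → PrefList Women} {seen : Men → List Women}
    {hus : Women → Option Men} (hx : Extends seen x) (hw : hus w = none)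
    (hlast : ∀ a c, hus a = some c → (seen c).getLast? = some a)
    (hbest : ∀ a c, a ∈ seen c → a ≠ w →
      ∃ c', hus a = some c' ∧ (y a).symm c' ≤ (y a).symm c)
    (hall : ∀ c, (∃ a, hus a = some c) ∨ (seen c).length = Fintype.card Women) {c : Men}
    (hc : Proposed (x, y) w ∅ c w) : w ∈ seen c := by
  -- A man whose list is not fully revealed is held by the last woman he revealed. If all women
  -- before `a` have been revealed and do not hold him, he must have gone on to `a`.
  have K : ∀ c a, (∀ b, (x c).symm b < (x c).symm a → b ∈ seen c ∧ hus b ≠ some c) →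
      a ∈ seen c := by
    intro c a h
    by_contra ha
    rw [mem_of_prefix_iff (hx c), not_lt] at ha
    rcases hall c with ⟨b, hb⟩ | hfull
    · have hmem : b ∈ seen c := List.mem_of_getLast? (hlast b c hb)
      refine (h b ?_).2 hb
      rw [mem_of_prefix_iff (hx c)] at hmem
      rw [Fin.lt_def]
      omega
    · have := ((x c).symm a).2
      omega
  refine K c w fun b hb => ?_
  refine (hc b hb).imp (X := fun c a => a ∈ seen c ∧ hus a ≠ some c) ?_ ?_
  · intro m _ h
    exact ⟨K m w h, by rw [hw]; simp⟩
  · intro m m' a ha h h' hlt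
    refine ⟨K m a h, fun hm => ?_⟩
    obtain ⟨c', hc', hle⟩ := hbest a m' (K m' a h') ha
    rw [hm] at hc'
    cases hc'
    exact absurd hlt (not_lt.2 hle)

open scoped Classical in
/-- All men who propose to `w` in the market where she accepts nobody do so along the chain. -/
theorem hits_of_proposed {x : Men → PrefList Women} :
    ∀ (n : ℕ) (st : ChainState Men Women), st.Inv y w U → Extends st.seen x →
      ∑ c ∈ Finset.univ.filter (fun c => c ∉ U), (Fintype.card Women - (st.seen c).length) ≤ n →
      ∀ m, Proposed (x, y) w ∅ m w → w ∈ st.seen m ∨ Hits y w low act x n st m := by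
  have hterm : ∀ st : ChainState Men Women, st.Inv y w U → Extends st.seen x →
      ¬ (st.seen st.cur).length < Fintype.card Women →
      ∀ m, Proposed (x, y) w ∅ m w → w ∈ st.seen m := by
    intro st hst hx hl m hm
    refine mem_seen_of_terminal hx hst.hus_w hst.last hst.best (fun c => ?_) hm
    by_cases hcU : c ∈ U
    · exact .inr (hst.full c hcU)
    · by_cases hc : c = st.cur
      · right
        have := (hx c).length_le
        rw [List.length_ofFn] at this
        rw [hc] at this ⊢
        omega
      · exact .inl (hst.held c hc hcU)
  intro n
  induction n with
  | zero =>
    intro st hst hx hn m hm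
    refine .inl (hterm st hst hx (fun hl => ?_) m hm)
    have := Finset.sum_eq_zero_iff.1 (Nat.le_zero.1 hn) st.cur (by simpa using hst.cur_notMem)
    omega
  | succ n ih =>
    intro st hst hx hn m hm
    by_cases hl : (st.seen st.cur).length < Fintype.card Women
    swap
    · exact .inl (hterm st hst hx hl m hm)
    set a := x st.cur ⟨_, hl⟩ with ha
    have hx' : Extends (Function.update st.seen st.cur (st.seen st.cur ++ [a])) x :=
      (extends_update_iff _ _ _ _).2 ⟨hx, hl, rfl⟩
    have hmem : w ∈ Function.update st.seen st.cur (st.seen st.cur ++ [a]) m →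
        w ∈ st.seen m ∨ (a = w ∧ m = st.cur) := by
      intro h
      by_cases hmc : m = st.cur
      · subst hmc
        rw [Function.update_self, List.mem_append, List.mem_singleton] at h
        exact h.imp_right fun h => ⟨h.symm, rfl⟩
      · rw [Function.update_of_ne hmc] at h
        exact .inl h
    cases hstp : st.step y w low act a with
    | none =>
      obtain ⟨haw, hnone⟩ := ChainState.hus_eq_none_of_step hstp
      -- The chain stops because `a` is single. Letting her take the current man produces a final
      -- configuration, to which `mem_seen_of_terminal` applies.
      have : w ∈ Function.update st.seen st.cur (st.seen st.cur ++ [a]) m := by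
        refine mem_seen_of_terminal (hus := Function.update st.hus a (some st.cur)) hx' ?_ ?_ ?_ ?_
          hm
        · rw [Function.update_of_ne (Ne.symm haw)]
          exact hst.hus_w
        · intro b d hb
          by_cases hba : b = a
          · rw [hba] at hb ⊢
            simp only [Function.update_self, Option.some.injEq] at hb
            subst hb
            simp
          · simp only [Function.update_of_ne hba] at hb
            have : d ≠ st.cur := fun hc => hst.cur_free b (hc ▸ hb)
            rw [Function.update_of_ne this]
            exact hst.last b d hb
        · intro b d hb hbw
          by_cases hba : b = a
          · rw [hba] at hb ⊢
            refine ⟨st.cur, by simp, ?_⟩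
            by_cases hdc : d = st.cur
            · rw [hdc]
            · rw [Function.update_of_ne hdc] at hb
              obtain ⟨c', hc', _⟩ := hst.best a d hb haw
              rw [hnone] at hc'
              cases hc'
          · have hb' : b ∈ st.seen d := by
              by_cases hdc : d = st.cur
              · subst hdc
                simpa [hba] using hb
              · rwa [Function.update_of_ne hdc] at hb
            rw [Function.update_of_ne hba]
            exact hst.best b d hb' hbw
        · intro c
          by_cases hcU : c ∈ U
          · right
            have : c ≠ st.cur := fun h => hst.cur_notMem (h ▸ hcU)
            rw [Function.update_of_ne this]
            exact hst.full c hcU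
          · left
            by_cases hc : c = st.cur
            · exact ⟨a, by simp [hc]⟩
            · obtain ⟨b, hb⟩ := hst.held c hc hcU
              refine ⟨b, ?_⟩
              rw [Function.update_of_ne]
              · exact hb
              · intro h
                rw [h, hnone] at hb
                cases hb
      rcases hmem this with h | h
      · exact .inl h
      · exact absurd h.1 haw
    | some st' =>
      have hseen := ChainState.step_seen hstp
      -- `n` bounds the number of entries that men outside `U` can still reveal, and each step uses
      -- one.
      have hdec : ∑ c ∈ Finset.univ.filter (fun c => c ∉ U),
          (Fintype.card Women - (st'.seen c).length) <
          ∑ c ∈ Finset.univ.filter (fun c => c ∉ U),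
          (Fintype.card Women - (st.seen c).length) := by
        refine Finset.sum_lt_sum (fun c _ => ?_)
          ⟨st.cur, by simpa using hst.cur_notMem, ?_⟩
        · by_cases hc : c = st.cur
          · rw [hseen, hc, Function.update_self, List.length_append]
            omega
          · rw [hseen, Function.update_of_ne hc]
        · rw [hseen, Function.update_self, List.length_append, List.length_singleton]
          omega
      rcases ih st' (hst.step hstp) (hseen ▸ hx') (by omega) m hm with h | h
      · rw [hseen] at h
        rcases hmem h with h | h
        · exact .inl h
        · exact .inr ⟨hl, .inl h⟩
      · exact .inr ⟨hl, .inr ⟨st', hstp, h⟩⟩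

/-- The men who propose to `w` along a chain with small counter are met in good states. -/
theorem exists_state_of_hits {x : Men → PrefList Women} {s : ℕ} {J : ChainState Men Women → Prop}
    (hJ : ∀ st a st', st.Inv y w U → J st → st.count < s →
      st.step y w low act a = some st' → J st') {m : Men} :
    ∀ (n : ℕ) (st : ChainState Men Women), st.Inv y w U → J st →
      ¬ Reaches y w low act s x n st → Hits y w low act x n st m →
      ∃ st' : ChainState Men Women, J st' ∧ st'.count < s ∧ st'.cur = m := by
  intro n
  induction n with
  | zero => exact fun st _ _ _ h => h.elim
  | succ n ih =>
    intro st hst hJst hR hH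
    simp only [Reaches, not_or, not_le, not_exists, not_and] at hR
    obtain ⟨hl, ⟨_, rfl⟩ | ⟨st', hstp, hH'⟩⟩ := hH
    · exact ⟨st, hJst, hR.1, rfl⟩
    · exact ih st' (hst.step hstp) (hJ st _ st' hst hJst hR.1 hstp) (hR.2 hl st' hstp) hH'

/-- If the counter counts all proposals to `w`, it bounds the number of men who make one. -/
theorem ncard_hits_lt {x : Men → PrefList Women} {s : ℕ} (hact : ∀ c, act c) (hlow : ∀ c, ¬ low c) :
    ∀ (n : ℕ) (st : ChainState Men Women), ¬ Reaches y w low act s x n st →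
      {m | Hits y w low act x n st m}.ncard + st.count < s := by
  intro n
  induction n with
  | zero =>
    intro st hR
    simp only [Reaches, not_le] at hR
    simpa [Hits] using hR
  | succ n ih =>
    intro st hR
    simp only [Reaches, not_or, not_le, not_exists, not_and] at hR
    by_cases hl : (st.seen st.cur).length < Fintype.card Women
    swap
    · simpa [Hits, hl] using hR.1
    cases hstp : st.step y w low act (x st.cur ⟨_, hl⟩) with
    | none =>
      have : ∀ m, ¬ Hits y w low act x (n + 1) st m := by
        rintro m ⟨_, ⟨h, _⟩ | ⟨st', h, _⟩⟩
        · exact (ChainState.hus_eq_none_of_step hstp).1 h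
        · rw [hstp] at h
          cases h
      simpa [this] using hR.1
    | some st' =>
      have h1 := ih st' (hR.2 hl st' hstp)
      by_cases haw : x st.cur ⟨_, hl⟩ = w
      · have hsub : {m | Hits y w low act x (n + 1) st m} ⊆
            insert st.cur {m | Hits y w low act x n st' m} := by
          rintro m ⟨_, ⟨_, h⟩ | ⟨st'', h, h'⟩⟩
          · exact .inl h
          · rw [hstp] at h
            cases h
            exact .inr h'
        have hcount : st'.count = st.count + 1 := by
          rcases ChainState.step_eq_some hstp with ⟨_, rfl⟩ | ⟨h, _⟩ | ⟨h, _⟩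
          · simp [hact]
          · exact absurd haw h
          · exact absurd haw h
        have h2 := Set.ncard_le_ncard hsub
        have h3 := Set.ncard_insert_le st.cur {m | Hits y w low act x n st' m}
        omega
      · have hsub : {m | Hits y w low act x (n + 1) st m} ⊆ {m | Hits y w low act x n st' m} := by
          rintro m ⟨_, ⟨h, _⟩ | ⟨st'', h, h'⟩⟩
          · exact absurd h haw
          · rw [hstp] at h
            cases h
            exact h'
        have hcount : st.count ≤ st'.count := by
          rcases ChainState.step_eq_some hstp with ⟨_, rfl⟩ | ⟨_, _, _, _, rfl⟩ | ⟨_, _, _, _, rfl⟩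
          · simp [hact]
          · simp [hact, hlow]
          · exact le_rfl
        have h2 := Set.ncard_le_ncard hsub
        omega

end ChainFacts

/-! ### The start of the chain, and conditioning on it -/

section Start

variable {Men Women : Type*} [Fintype Men] [Fintype Women]

open scoped Classical in
/-- The end of deferred acceptance in the market where `w` accepts only `m`, from where
`w` starts to reject `m`, too. -/
noncomputable def startState (y : Women → PrefList Men) (w : Women) (m : Men)
    (x : Men → PrefList Women) : ChainState Men Women where
  seen c := (List.ofFn (x c)).filter fun a => Proposed (x, y) w {m} c a
  hus a := if h : a ≠ w ∧ ∃ c, Holds (x, y) w {m} c a then some h.2.choose else none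
  cur := m
  count := 0

variable {y : Women → PrefList Men} {w : Women} {m : Men} {x : Men → PrefList Women}

theorem mem_startState_seen {c : Men} {a : Women} :
    a ∈ (startState y w m x).seen c ↔ Proposed (x, y) w {m} c a := by
  simp only [startState, List.mem_filter, decide_eq_true_eq, and_iff_right_iff_imp]
  intro _
  rw [List.mem_ofFn]
  exact ⟨(x c).symm a, by simp⟩

theorem startState_hus {c : Men} {a : Women} :
    (startState y w m x).hus a = some c ↔ a ≠ w ∧ Holds (x, y) w {m} c a := by
  unfold startState
  constructor
  · intro h
    simp only at h
    split_ifs at h with h'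
    rw [Option.some_inj] at h
    exact ⟨h'.1, h ▸ h'.2.choose_spec⟩
  · rintro ⟨h1, h2⟩
    have h' : a ≠ w ∧ ∃ c, Holds (x, y) w {m} c a := ⟨h1, c, h2⟩
    simp only
    rw [dif_pos h', Option.some_inj]
    exact h'.2.choose_spec.man_unique Set.subsingleton_singleton h2

theorem extends_startState : Extends (startState y w m x).seen x := by
  classical
  intro c
  refine filter_prefix_of_pairwise _ _ ?_
  rw [List.pairwise_ofFn]
  intro i j hij h b hb
  refine h b (hb.trans ?_)
  simpa using hij

theorem startState_inv (hm : Proposed (x, y) w {m} m w) :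
    (startState y w m x).Inv y w {c | Unmatched (x, y) w {m} c} where
  hus_w := by
    rw [Option.eq_none_iff_forall_ne_some]
    intro c h
    exact (startState_hus.1 h).1 rfl
  last a c h := by
    obtain ⟨_, hH⟩ := startState_hus.1 h
    have hpre := extends_startState (y := y) (w := w) (m := m) (x := x) c
    set l := (startState y w m x).seen c with hl
    have ha : a ∈ l := mem_startState_seen.2 hH.1
    have h1 := (mem_of_prefix_iff hpre a).1 ha
    -- The woman who holds `c` is the last one he revealed: having proposed further, he would have
    -- been rejected by her.
    have h2 : l.length = ((x c).symm a : ℕ) + 1 := by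
      by_contra hne
      have h3 : ((x c).symm a : ℕ) + 1 < l.length := by omega
      have h4 := hpre.length_le
      rw [List.length_ofFn] at h4
      have h5 : x c ⟨((x c).symm a : ℕ) + 1, by omega⟩ ∈ l := by
        rw [mem_of_prefix_iff hpre]
        simpa using h3
      refine hH.2 (mem_startState_seen.1 h5 a ?_)
      rw [Equiv.symm_apply_apply, Fin.lt_def]
      simp
    rw [List.getLast?_eq_getElem?, h2, Nat.add_sub_cancel, List.getElem?_eq_getElem h1,
      hpre.getElem h1]
    simp
  held c hc hU := by
    obtain ⟨a, ha⟩ := not_unmatched_iff.1 hU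
    refine ⟨a, startState_hus.2 ⟨?_, ha⟩⟩
    rintro rfl
    exact hc ha.mem_acc
  full c hc := by
    have hpre := extends_startState (y := y) (w := w) (m := m) (x := x) c
    have h1 := hpre.length_le
    rw [List.length_ofFn] at h1
    refine le_antisymm h1 ?_
    by_contra h2
    push Not at h2
    have h3 : x c ⟨_, h2⟩ ∈ (startState y w m x).seen c :=
      mem_startState_seen.2 fun b _ => hc b
    rw [mem_of_prefix_iff hpre] at h3
    simp at h3
  cur_notMem h := (Holds.of_proposed hm rfl).2 (h w)
  cur_free a h := by
    obtain ⟨h1, h2⟩ := startState_hus.1 h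
    exact h1 (h2.woman_unique (Holds.of_proposed hm rfl))
  hus_notMem a c h hU := (startState_hus.1 h).2.2 (hU a)
  best a c ha haw := by
    obtain ⟨c', hle, hc'⟩ := exists_holds_of_proposed haw (mem_startState_seen.1 ha)
    exact ⟨c', startState_hus.2 ⟨haw, hc'⟩, hle⟩

/-- The run reads nothing beyond the revealed prefixes, so lists that extend them give the same
rejections. Both directions are fixed point arguments. -/
theorem rejected_iff_of_extends {x' : Men → PrefList Women}
    (h : Extends (startState y w m x).seen x') (c : Men) (a : Women) :
    Rejected (x', y) w {m} c a ↔ Rejected (x, y) w {m} c a := by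
  have K : ∀ c a, (∀ b, (x' c).symm b < (x' c).symm a → Rejected (x, y) w {m} c b) →
      Proposed (x, y) w {m} c a := by
    intro c a hb
    by_cases hU : Unmatched (x, y) w {m} c
    · exact fun b _ => hU b
    · rw [← mem_startState_seen, mem_of_prefix_iff (h c)]
      by_contra hlt
      obtain ⟨b, hH⟩ := not_unmatched_iff.1 hU
      have h1 := mem_startState_seen.2 hH.1
      rw [mem_of_prefix_iff (h c)] at h1
      refine hH.2 (hb b ?_)
      rw [Fin.lt_def]
      omega
  have h1 : ∀ c a, Rejected (x', y) w {m} c a → Rejected (x, y) w {m} c a := by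
    intro c a hr
    refine hr.imp (X := fun c a => Rejected (x, y) w {m} c a) ?_ ?_
    · exact fun c hc hb => .unacceptable (K c w hb) hc
    · exact fun c c' a ha hb hb' hlt => .beaten ha (K c a hb) (K c' a hb') hlt
  refine ⟨h1 c a, fun hr => ?_⟩
  have K' : ∀ c a, (∀ b, (x c).symm b < (x c).symm a → Rejected (x', y) w {m} c b) →
      Proposed (x', y) w {m} c a := by
    intro c a hb b hba
    have hP : Proposed (x, y) w {m} c a := fun b hba => h1 c b (hb b hba)
    have hmem := mem_startState_seen.2 hP
    have hmemb : b ∈ (startState y w m x).seen c := by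
      rw [mem_of_prefix_iff (h c)] at hmem ⊢
      exact lt_trans (Fin.lt_def.1 hba) hmem
    refine hb b ?_
    rw [symm_eq_of_prefix (extends_startState c) (h c) hmem,
      symm_eq_of_prefix (extends_startState c) (h c) hmemb]
    exact hba
  refine hr.imp (X := fun c a => Rejected (x', y) w {m} c a) ?_ ?_
  · exact fun c hc hb => .unacceptable (K' c w hb) hc
  · exact fun c c' a ha hb hb' hlt => .beaten ha (K' c a hb) (K' c' a hb') hlt

theorem proposed_iff_of_extends {x' : Men → PrefList Women}
    (h : Extends (startState y w m x).seen x') (c : Men) (a : Women) :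
    Proposed (x', y) w {m} c a ↔ Proposed (x, y) w {m} c a := by
  have hr := rejected_iff_of_extends h
  constructor
  · intro hP
    by_cases hU : Unmatched (x, y) w {m} c
    · exact fun b _ => hU b
    · rw [← mem_startState_seen, mem_of_prefix_iff (h c)]
      by_contra hlt
      obtain ⟨b, hH⟩ := not_unmatched_iff.1 hU
      have h1 := mem_startState_seen.2 hH.1
      rw [mem_of_prefix_iff (h c)] at h1
      refine hH.2 ((hr c b).1 (hP b ?_))
      rw [Fin.lt_def]
      change _ < ((x' c).symm a : ℕ)
      change ((x' c).symm b : ℕ) < _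
      omega
  · intro hP b hba
    have hmem := mem_startState_seen.2 hP
    change (x' c).symm b < (x' c).symm a at hba
    have hmemb : b ∈ (startState y w m x).seen c := by
      rw [mem_of_prefix_iff (h c)] at hmem ⊢
      exact lt_trans (Fin.lt_def.1 hba) hmem
    refine (hr c b).2 (hP b ?_)
    change (x c).symm b < (x c).symm a
    rw [symm_eq_of_prefix (extends_startState c) (h c) hmem,
      symm_eq_of_prefix (extends_startState c) (h c) hmemb]
    exact hba

/-- This makes deferred decisions exact: fixing the outcome of the run conditions the lists on their
revealed prefixes and on nothing else. -/
theorem startState_eq_iff {x' : Men → PrefList Women} :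
    startState y w m x' = startState y w m x ↔ Extends (startState y w m x).seen x' := by
  classical
  constructor
  · intro h
    rw [← h]
    exact extends_startState
  · intro h
    have hP := proposed_iff_of_extends h
    have hR := rejected_iff_of_extends h
    have hH : ∀ c a, Holds (x', y) w {m} c a ↔ Holds (x, y) w {m} c a := fun c a => by
      unfold Holds
      rw [hP, hR]
    have hseen : (startState y w m x').seen = (startState y w m x).seen := by
      funext c
      obtain ⟨r, hr⟩ := h c
      have h1 : (startState y w m x').seen c =
          (List.ofFn (x' c)).filter fun a => Proposed (x, y) w {m} c a := by
        simp only [startState, hP]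
      have hnd : (List.ofFn (x' c)).Nodup := List.nodup_ofFn.2 (x' c).injective
      rw [h1, ← hr, List.filter_append]
      rw [← hr, List.nodup_append] at hnd
      rw [List.filter_eq_self.2, List.filter_eq_nil_iff.2, List.append_nil]
      · intro a ha
        simp only [decide_eq_true_eq]
        intro h2
        exact hnd.2.2 a (mem_startState_seen.2 h2) a ha rfl
      · intro a ha
        simpa using mem_startState_seen.1 ha
    have hhus : (startState y w m x').hus = (startState y w m x).hus := by
      funext a
      simp only [startState, hH]
    have key : ∀ s t : ChainState Men Women, s.seen = t.seen → s.hus = t.hus → s.cur = t.cur →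
        s.count = t.count → s = t := by
      rintro ⟨_, _, _, _⟩ ⟨_, _, _, _⟩ rfl rfl rfl rfl
      rfl
    exact key _ _ hseen hhus rfl rfl

open scoped Classical in
-- Condition on the start state. Each fibre is an event `Extends`, on which `sum_reaches_le` gives a
-- bound proportional to the probability of the fibre. Hence `low`, `act` and `J` may depend on the
-- start state.
theorem sum_startState_reaches_le {popM : Men → Women → ℝ} (hM : ∀ m a, 0 < popM m a) {q δ : ℝ}
    (hq0 : 0 ≤ q) (hq1 : q ≤ 1) (hq : ∀ m a b, popM m a ≤ q * (popM m a + popM m b))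
    {s : ℕ} (hδ0 : 0 ≤ δ) {low act : ChainState Men Women → Men → Prop}
    (hδ : (∀ st c, act st c ∧ ¬ low st c) ∨ q ^ s ≤ δ)
    (J : ChainState Men Women → ChainState Men Women → Prop)
    (hJ0 : ∀ x, Proposed (x, y) w {m} m w → J (startState y w m x) (startState y w m x))
    (hJ : ∀ x, Proposed (x, y) w {m} m w → ∀ st a st',
      st.Inv y w {c | Unmatched (x, y) w {m} c} → J (startState y w m x) st → st.count < s →
      st.step y w (low (startState y w m x)) (act (startState y w m x)) a = some st' →
      J (startState y w m x) st')
    (hrace : ∀ x, Proposed (x, y) w {m} m w → ∀ st : ChainState Men Women,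
      st.Inv y w {c | Unmatched (x, y) w {m} c} →
      J (startState y w m x) st → st.count < s → act (startState y w m x) st.cur →
      (Finset.univ.filter fun a => st.Advances y w (low (startState y w m x)) a).card ≤
        (Finset.univ.filter fun a => st.Resets y w (low (startState y w m x)) a).card) (n : ℕ) :
    (∑ x : Men → PrefList Women, if Proposed (x, y) w {m} m w ∧
        Reaches y w (low (startState y w m x)) (act (startState y w m x)) s x n
          (startState y w m x) then menProb popM x else 0) ≤ q ^ s + n * δ := by
  set T := Finset.univ.image (startState y w m) with hT
  have hmaps : ∀ x ∈ (Finset.univ : Finset (Men → PrefList Women)), startState y w m x ∈ T :=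
    fun x hx => Finset.mem_image_of_mem _ hx
  rw [← Finset.sum_fiberwise_of_maps_to hmaps]
  have hone : ∑ x : Men → PrefList Women, menProb popM x = 1 := by
    unfold menProb
    rw [← Fintype.prod_sum]
    refine Finset.prod_eq_one fun m _ => ?_
    convert sum_popularityProb (popM m) (hM m)
  have hbound : 0 ≤ q ^ s + n * δ := by positivity
  have hfib : ∀ st ∈ T, (∑ x ∈ Finset.univ.filter (fun x => startState y w m x = st),
      if Proposed (x, y) w {m} m w ∧
        Reaches y w (low (startState y w m x)) (act (startState y w m x)) s x n
          (startState y w m x) then menProb popM x else 0) ≤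
      (q ^ s + n * δ) *
        ∑ x ∈ Finset.univ.filter (fun x => startState y w m x = st), menProb popM x := by
    intro st hst
    by_cases hex : ∃ x0, startState y w m x0 = st ∧ Proposed (x0, y) w {m} m w
    · obtain ⟨x0, rfl, hP⟩ := hex
      have h1 := sum_reaches_le hM hq0 hq1 hq hδ0
        (hδ.imp (fun h => h (startState y w m x0)) id) (hJ x0 hP) (hrace x0 hP) n
        (startState y w m x0) (startState_inv hP) (hJ0 x0 hP)
      simp only [startState_eq_iff]
      rw [Finset.sum_filter, Finset.sum_filter]
      refine le_trans (Finset.sum_le_sum fun x _ => ?_) h1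
      by_cases hx : Extends (startState y w m x0).seen x
      · rw [if_pos hx, if_pos hx, startState_eq_iff.2 hx]
        have := menProb_nonneg hM x
        split_ifs with h2 h3 h3
        · exact le_rfl
        · exact absurd h2.2 h3
        · exact this
        · exact le_rfl
      · rw [if_neg hx, if_neg hx]
    · refine (le_of_eq (Finset.sum_eq_zero fun x hx => if_neg fun h => hex ?_)).trans
        (mul_nonneg hbound (Finset.sum_nonneg fun x _ => menProb_nonneg hM x))
      exact ⟨x, (Finset.mem_filter.1 hx).2, h.1⟩
  refine (Finset.sum_le_sum hfib).trans (le_of_eq ?_)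
  rw [← Finset.mul_sum, Finset.sum_fiberwise_of_maps_to hmaps, hone, mul_one]

end Start

end StableMarket

namespace StableMarket

/-! ### The two chain estimates: many women, and the climb in popularity -/

section Cases

variable {Men Women : Type*} [Fintype Men] [Fintype Women]
variable {y : Women → PrefList Men} {w : Women} {m : Men}

omit [Fintype Men] in
open scoped Classical in
theorem exists_finset_hus_mem {st : ChainState Men Women}
    (hinj : ∀ a b c, st.hus a = some c → st.hus b = some c → a = b) (T : Finset Men) :
    ∃ H : Finset Women, H.card ≤ T.card ∧ ∀ a, a ∈ H ↔ ∃ c ∈ T, st.hus a = some c := by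
  refine ⟨Finset.univ.filter fun a => ∃ c ∈ T, st.hus a = some c, ?_, by simp⟩
  rw [← Finset.card_image_of_injective T (Option.some_injective Men)]
  refine Finset.card_le_card_of_injOn st.hus (fun a ha => ?_) fun a ha b _ hab => ?_
  · obtain ⟨c, hc, hac⟩ := (Finset.mem_filter.1 ha).2
    rw [hac]
    exact Finset.mem_coe.2 (Finset.mem_image_of_mem _ hc)
  · obtain ⟨c, _, hac⟩ := (Finset.mem_filter.1 ha).2
    exact hinj a b c hac (hab ▸ hac)

theorem sum_remaining_startState_le (x : Men → PrefList Women) :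
    open scoped Classical in
    ∑ c ∈ Finset.univ.filter (fun c => c ∉ {c | Unmatched (x, y) w {m} c}),
      (Fintype.card Women - ((startState y w m x).seen c).length) ≤
      min (Fintype.card Men) (Fintype.card Women) * Fintype.card Women := by
  classical
  refine (Finset.sum_le_card_nsmul _ _ (Fintype.card Women) fun c _ => Nat.sub_le _ _).trans ?_
  rw [smul_eq_mul]
  exact Nat.mul_le_mul_right _
    (card_not_unmatched_le (x, y) w (Set.subsingleton_singleton (a := m)))

/-- If there are many more women than men, few men propose to `w` after `m` does. -/
theorem sum_many_proposals_le {popM : Men → Women → ℝ} (hM : ∀ m a, 0 < popM m a) {q : ℝ}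
    (hq0 : 0 ≤ q) (hq1 : q ≤ 1) (hq : ∀ m a b, popM m a ≤ q * (popM m a + popM m b))
    (hMW : 2 * Fintype.card Men ≤ Fintype.card Women) (s : ℕ) :
    open scoped Classical in
    (∑ x : Men → PrefList Women, if Proposed (x, y) w ∅ m w ∧
        s ≤ {m' | Proposed (x, y) w ∅ m' w ∧ ¬ Proposed (x, y) w {m} m' w}.ncard
      then menProb popM x else 0) ≤ q ^ s := by
  classical
  set n := min (Fintype.card Men) (Fintype.card Women) * Fintype.card Women with hn
  -- Every man is active and nobody is low, so the counter never returns to `0` and `δ = 0` is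
  -- allowed.
  have h := sum_startState_reaches_le (y := y) (w := w) (m := m) hM hq0 hq1 hq (s := s) le_rfl
    (low := fun _ _ => False) (act := fun _ _ => True) (.inl fun _ _ => ⟨trivial, id⟩)
    (fun _ _ => True) (fun _ _ => trivial) (fun _ _ _ _ _ _ _ _ _ => trivial) (by
      intro x _ st hst _ _ _
      have hinj : ∀ a b c, st.hus a = some c → st.hus b = some c → a = b :=
        fun a b c => hst.hus_inj
      -- Only `w` and the women held by one of the other `M - 1` men can advance the counter. The
      -- remaining women, at least `W - M ≥ M` of them, are single and end the chain.
      obtain ⟨H, h1, hH⟩ := exists_finset_hus_mem hinj (Finset.univ.erase st.cur)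
      rw [Finset.card_erase_of_mem (Finset.mem_univ _), Finset.card_univ] at h1
      have h0 : 0 < Fintype.card Men := Fintype.card_pos_iff.2 ⟨m⟩
      have h2 := Finset.card_insert_le w H
      have h3 : (Finset.univ.filter fun a => st.Advances y w (fun _ => False) a).card ≤
          (insert w H).card := by
        refine Finset.card_le_card fun a ha => ?_
        simp only [Finset.mem_filter, Finset.mem_univ, true_and] at ha
        rcases ha with rfl | ⟨c, hc, _, _⟩
        · exact Finset.mem_insert_self _ _
        · refine Finset.mem_insert_of_mem ((hH a).2 ⟨c, ?_, hc⟩)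
          exact Finset.mem_erase.2 ⟨fun h => hst.cur_free a (h ▸ hc), Finset.mem_univ _⟩
      have h4 : (insert w H)ᶜ.card ≤
          (Finset.univ.filter fun a => st.Resets y w (fun _ => False) a).card := by
        refine Finset.card_le_card fun a ha => ?_
        rw [Finset.mem_compl, Finset.mem_insert, not_or] at ha
        refine Finset.mem_filter.2 ⟨Finset.mem_univ _, ha.1, .inl ?_⟩
        rw [Option.eq_none_iff_forall_ne_some]
        intro c hc
        refine ha.2 ((hH a).2 ⟨c, ?_, hc⟩)
        exact Finset.mem_erase.2 ⟨fun h => hst.cur_free a (h ▸ hc), Finset.mem_univ _⟩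
      rw [Finset.card_compl] at h4
      omega) n
  rw [mul_zero, add_zero] at h
  refine le_trans (Finset.sum_le_sum fun x _ => ?_) h
  have hx0 := menProb_nonneg hM x
  split_ifs with h1 h2 h2
  · exact le_rfl
  · exfalso
    refine h2 ⟨h1.1.self, ?_⟩
    by_contra hR
    have h3 := ncard_hits_lt (fun _ => trivial) (fun _ => id) n _ hR
    refine absurd (h1.2.trans ((Set.ncard_le_ncard ?_).trans (Nat.le_add_right _ _)))
      (not_le.2 h3)
    rintro m' ⟨hm', hm'n⟩
    refine (hits_of_proposed n _ (startState_inv h1.1.self) extends_startState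
      (sum_remaining_startState_le x) m' hm').resolve_left fun h => ?_
    exact hm'n (mem_startState_seen.1 h)
  · exact hx0
  · exact le_rfl

section
open scoped Classical in
/-- The man `c` is much more popular than all but `N` men, together. -/
def Separated (D : Men → ℝ) (Z : ℝ) (N : ℕ) (c : Men) : Prop :=
  (Finset.univ.filter fun b => ¬ Z * D b ≤ D c).card ≤ N ∧
    Z * ∑ b ∈ Finset.univ.filter (fun b => Z * D b ≤ D c), D b ≤ (N + 1) * D c

/-- All women prefer the separated men to all men who are much less popular. -/
def Respects (D : Men → ℝ) (Z : ℝ) (N : ℕ) (y : Women → PrefList Men) : Prop :=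
  ∀ a c c', Separated D Z N c → Z * D c' ≤ D c → (y a).symm c < (y a).symm c'

open scoped Classical in
/-- The number of men of popularity larger than `t`. -/
noncomputable def cardAbove (D : Men → ℝ) (t : ℝ) : ℕ :=
  (Finset.univ.filter fun c => t < D c).card

open scoped Classical in
/-- A multiple `θ * Z ^ (r * i)`, with `i < I`, such that at least half of the women who are left by
the men above it are also left by the men above `Z ^ r` times this number. -/
noncomputable def windowBase (D : Men → ℝ) (Z : ℝ) (r I W : ℕ) (θ : ℝ) : ℝ :=
  if h : ∃ i < I, 2 * cardAbove D (θ * Z ^ (r * i)) ≤ W + cardAbove D (θ * Z ^ (r * (i + 1)))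
  then θ * Z ^ (r * h.choose) else θ

open scoped Classical in
/-- The popularity of the current man and of the men without a wife. -/
noncomputable def ChainState.freeMass (D : Men → ℝ) (st : ChainState Men Women) : ℝ :=
  D st.cur + ∑ c ∈ Finset.univ.filter (fun c => c ≠ st.cur ∧ ∀ a, st.hus a ≠ some c), D c
end

/-- If every `i < I` failed, the number `W - cardAbove` of women left over would more than double
from each level to the next. Starting from at least `1`, it would reach `2 ^ I > W`. -/
theorem windowBase_spec {D : Men → ℝ} {Z θ : ℝ} {r I W : ℕ} (h0 : cardAbove D θ < W)
    (hI : W < 2 ^ I) :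
    ∃ i < I, windowBase D Z r I W θ = θ * Z ^ (r * i) ∧
      2 * cardAbove D (θ * Z ^ (r * i)) ≤ W + cardAbove D (θ * Z ^ (r * (i + 1))) := by
  have h : ∃ i < I,
      2 * cardAbove D (θ * Z ^ (r * i)) ≤ W + cardAbove D (θ * Z ^ (r * (i + 1))) := by
    by_contra! hn
    have key : ∀ i ≤ I, cardAbove D (θ * Z ^ (r * i)) + 2 ^ i ≤ W := by
      intro i
      induction i with
      | zero => simpa using h0
      | succ i ih =>
        intro hi
        have h1 := ih (by omega)
        have h2 := hn i (by omega)
        rw [pow_succ]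
        omega
    have := key I le_rfl
    omega
  refine ⟨h.choose, h.choose_spec.1, ?_, h.choose_spec.2⟩
  unfold windowBase
  rw [dif_pos h]

theorem startState_freeMass {x : Men → PrefList Women} (D : Men → ℝ)
    (hm : Proposed (x, y) w {m} m w) :
    open scoped Classical in
    (startState y w m x).freeMass D =
      D m + ∑ c ∈ Finset.univ.filter (fun c => Unmatched (x, y) w {m} c), D c := by
  classical
  have hinv := startState_inv hm
  unfold ChainState.freeMass
  congr 1
  refine Finset.sum_congr (Finset.filter_congr fun c _ => ?_) fun _ _ => rfl
  constructor
  · rintro ⟨h1, h2⟩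
    by_contra hU
    obtain ⟨a, ha⟩ := hinv.held c h1 hU
    exact h2 a ha
  · intro hU
    exact ⟨fun h => hinv.cur_notMem (h ▸ hU), fun a ha => hinv.hus_notMem a c ha hU⟩

/-- All but at most `N` men are unmatched, and `α` bounds their total. So each of them is below `D c
/ Z`; in the weighted sum they contribute at most `Z * α < D c`, and the others at most `N * D c`.
-/
theorem separated_of_lt {x : Men → PrefList Women} {D : Men → ℝ} (hD : ∀ c, 0 < D c) {Z α : ℝ}
    (hZ : 1 ≤ Z) (hα : open scoped Classical in
      ∑ c ∈ Finset.univ.filter (fun c => Unmatched (x, y) w {m} c), D c ≤ α) {c : Men}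
    (hc : α * Z < D c) :
    Separated D Z (min (Fintype.card Men) (Fintype.card Women)) c := by
  classical
  have hZ0 : 0 < Z := by linarith
  have hN := card_not_unmatched_le (x, y) w (Set.subsingleton_singleton (a := m))
  set N := min (Fintype.card Men) (Fintype.card Women)
  set U := Finset.univ.filter fun c => Unmatched (x, y) w {m} c with hU
  have hu : ∀ u ∈ U, Z * D u ≤ D c := by
    intro u hu
    have : D u ≤ α := (Finset.single_le_sum (fun c _ => (hD c).le) hu).trans hα
    nlinarith
  constructor
  · refine (Finset.card_le_card fun b hb => ?_).trans hN
    rw [Finset.mem_filter] at hb ⊢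
    refine ⟨Finset.mem_univ _, fun h => hb.2 (hu b ?_)⟩
    rw [hU, Finset.mem_filter]
    exact ⟨Finset.mem_univ _, h⟩
  · set L := Finset.univ.filter fun b => Z * D b ≤ D c with hL
    have h1 : ∑ b ∈ L, Z * D b ≤ ∑ b ∈ U, Z * D b + ∑ b ∈ L.filter (fun b => b ∉ U), Z * D b := by
      rw [← Finset.sum_filter_add_sum_filter_not L (fun b => b ∈ U)]
      refine add_le_add (Finset.sum_le_sum_of_subset_of_nonneg (fun b hb => ?_) fun b _ _ => ?_)
        le_rfl
      · exact (Finset.mem_filter.1 hb).2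
      · exact (mul_pos hZ0 (hD b)).le
    have h2 : ∑ b ∈ L.filter (fun b => b ∉ U), Z * D b ≤ N * D c := by
      refine (Finset.sum_le_card_nsmul _ _ (D c) fun b hb => ?_).trans ?_
      · exact (Finset.mem_filter.1 (Finset.mem_filter.1 hb).1).2
      · rw [nsmul_eq_mul]
        refine mul_le_mul_of_nonneg_right ?_ (hD c).le
        refine Nat.cast_le.2 ((Finset.card_le_card fun b hb => ?_).trans hN)
        rw [Finset.mem_filter] at hb ⊢
        refine ⟨Finset.mem_univ _, fun h => hb.2 ?_⟩
        rw [hU, Finset.mem_filter]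
        exact ⟨Finset.mem_univ _, h⟩
    rw [← Finset.mul_sum, ← Finset.mul_sum, ← Finset.mul_sum] at h1
    rw [← Finset.mul_sum] at h2
    have h3 := mul_le_mul_of_nonneg_left hα hZ0.le
    linarith

open scoped Classical in
-- Let `A` and `B` be the men above `α` and above `α * Z ^ (s + 2)`. An advancing woman is `w` or is
-- held by a man of `A \ B`, as nobody leaves a man of `B` for the current one. A woman other than
-- `w` who is single or held by a man outside `A` accepts him and resets. The current man is free
-- and lies in `A \ B`, which makes up for `w`: there are at most `|A| - |B|` advances and at least
-- `W - |A|` resets.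
theorem card_advances_le_card_resets {x : Men → PrefList Women} {D : Men → ℝ} {Z α : ℝ}
    (hZ : 1 ≤ Z) (hα0 : 0 < α)
    (hsep : ∀ c, α * Z < D c → Separated D Z (min (Fintype.card Men) (Fintype.card Women)) c)
    (hy : Respects D Z (min (Fintype.card Men) (Fintype.card Women)) y) {s : ℕ}
    (hcard : 2 * cardAbove D α ≤ Fintype.card Women + cardAbove D (α * Z ^ (s + 2)))
    {st : ChainState Men Women} (hst : st.Inv y w {c | Unmatched (x, y) w {m} c})
    (hJ : D st.cur ≤ α * Z ^ (st.count + 2)) (hs : st.count < s) (hact : α * Z < D st.cur) :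
    (Finset.univ.filter fun a => st.Advances y w (fun c => D c ≤ α) a).card ≤
      (Finset.univ.filter fun a => st.Resets y w (fun c => D c ≤ α) a).card := by
  have hZ0 : 0 < Z := by linarith
  have hinj : ∀ a b c, st.hus a = some c → st.hus b = some c → a = b :=
    fun a b c => hst.hus_inj
  have hαZ : α ≤ α * Z := le_mul_of_one_le_right hα0.le hZ
  set A := Finset.univ.filter fun c => α < D c with hA
  set B := Finset.univ.filter fun c => α * Z ^ (s + 2) < D c with hB
  have hBA : B ⊆ A := by
    intro c hc
    rw [Finset.mem_filter] at hc ⊢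
    refine ⟨Finset.mem_univ _, lt_of_le_of_lt ?_ hc.2⟩
    exact le_mul_of_one_le_right hα0.le (one_le_pow₀ hZ)
  have hcurle : Z * D st.cur ≤ α * Z ^ (s + 2) := by
    have h1 : α * Z ^ (st.count + 3) ≤ α * Z ^ (s + 2) :=
      mul_le_mul_of_nonneg_left (pow_le_pow_right₀ hZ (by omega)) hα0.le
    calc Z * D st.cur ≤ Z * (α * Z ^ (st.count + 2)) := mul_le_mul_of_nonneg_left hJ hZ0.le
      _ = α * Z ^ (st.count + 3) := by ring
      _ ≤ _ := h1
  have hcurA : st.cur ∈ A := Finset.mem_filter.2 ⟨Finset.mem_univ _, hαZ.trans_lt hact⟩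
  have hcurB : st.cur ∉ B := by
    intro h
    have h1 := (Finset.mem_filter.1 h).2
    have h2 : 0 < D st.cur := (mul_pos hα0 hZ0).trans hact
    nlinarith
  have hAcard : A.card = cardAbove D α := rfl
  have hBcard : B.card = cardAbove D (α * Z ^ (s + 2)) := rfl
  obtain ⟨H1, h1, hH1⟩ := exists_finset_hus_mem hinj ((A \ B).erase st.cur)
  rw [Finset.card_erase_of_mem (Finset.mem_sdiff.2 ⟨hcurA, hcurB⟩),
    Finset.card_sdiff_of_subset hBA] at h1
  obtain ⟨H2, h2, hH2⟩ := exists_finset_hus_mem hinj (A.erase st.cur)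
  rw [Finset.card_erase_of_mem hcurA] at h2
  have hpos : 0 < (A \ B).card := Finset.card_pos.2 ⟨st.cur, Finset.mem_sdiff.2 ⟨hcurA, hcurB⟩⟩
  rw [Finset.card_sdiff_of_subset hBA] at hpos
  have h3 : (Finset.univ.filter fun a => st.Advances y w (fun c => D c ≤ α) a).card ≤
      (insert w H1).card := by
    refine Finset.card_le_card fun a ha => ?_
    simp only [Finset.mem_filter, Finset.mem_univ, true_and] at ha
    rcases ha with rfl | ⟨c, hc, hlt, hlow⟩
    · exact Finset.mem_insert_self _ _
    · refine Finset.mem_insert_of_mem ((hH1 a).2 ⟨c, ?_, hc⟩)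
      refine Finset.mem_erase.2 ⟨fun h => hst.cur_free a (h ▸ hc), Finset.mem_sdiff.2
        ⟨Finset.mem_filter.2 ⟨Finset.mem_univ _, not_le.1 hlow⟩, fun hcB => ?_⟩⟩
      have hcB' := (Finset.mem_filter.1 hcB).2
      refine absurd (hy a c st.cur (hsep c (lt_of_le_of_lt ?_ hcB')) (hcurle.trans hcB'.le))
        (not_lt.2 hlt.le)
      refine mul_le_mul_of_nonneg_left ?_ hα0.le
      calc Z = Z ^ 1 := (pow_one Z).symm
        _ ≤ Z ^ (s + 2) := pow_le_pow_right₀ hZ (by omega)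
  have h4 : (insert w H2)ᶜ.card ≤
      (Finset.univ.filter fun a => st.Resets y w (fun c => D c ≤ α) a).card := by
    refine Finset.card_le_card fun a ha => ?_
    rw [Finset.mem_compl, Finset.mem_insert, not_or] at ha
    refine Finset.mem_filter.2 ⟨Finset.mem_univ _, ha.1, ?_⟩
    cases hc : st.hus a with
    | none => exact .inl rfl
    | some c =>
      have hcα : D c ≤ α := by
        by_contra hn
        refine ha.2 ((hH2 a).2 ⟨c, Finset.mem_erase.2
          ⟨fun h => hst.cur_free a (h ▸ hc), ?_⟩, hc⟩)
        exact Finset.mem_filter.2 ⟨Finset.mem_univ _, not_le.1 hn⟩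
      refine .inr ⟨c, rfl, hy a st.cur c (hsep _ hact) ?_, hcα⟩
      nlinarith
  have h5 := Finset.card_insert_le w H1
  have h6 := Finset.card_insert_le w H2
  have h7 : 0 < A.card := Finset.card_pos.2 ⟨_, hcurA⟩
  rw [Finset.card_compl] at h4
  omega

omit [Fintype Women] in
-- A displaced man is at most `Z` times as popular as his successor, or below the claimed bound
-- anyway. The exponent is `count + 2` because of the returns to `0`: there either the displaced man
-- is at most `α`, or the current one is at most `α * Z` and the displaced one at most `α * Z ^ 2`.
theorem step_le_of_respects {D : Men → ℝ} {Z α : ℝ}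
    (hZ : 1 ≤ Z) (hα0 : 0 < α) {N : ℕ}
    (hsep : ∀ c, α * Z < D c → Separated D Z N c)
    (hy : Respects D Z N y)
    {st st' : ChainState Men Women} {a : Women}
    (hJ : D st.cur ≤ α * Z ^ (st.count + 2))
    (hstp : st.step y w (fun c => D c ≤ α) (fun c => α * Z < D c) a = some st') :
    D st'.cur ≤ α * Z ^ (st'.count + 2) := by
  have hZ0 : 0 < Z := by linarith
  have hmono : ∀ j k : ℕ, j ≤ k → α * Z ^ j ≤ α * Z ^ k := fun j k h =>
    mul_le_mul_of_nonneg_left (pow_le_pow_right₀ hZ h) hα0.le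
  have hclimb : ∀ (c : Men) (k : ℕ), (y a).symm st.cur < (y a).symm c →
      D st.cur ≤ α * Z ^ (k + 1) → D c ≤ α * Z ^ (k + 2) := by
    intro c k hlt hk
    by_contra hn
    push Not at hn
    have h1 : Z * D st.cur ≤ D c := by
      calc Z * D st.cur ≤ Z * (α * Z ^ (k + 1)) := mul_le_mul_of_nonneg_left hk hZ0.le
        _ = α * Z ^ (k + 2) := by ring
        _ ≤ _ := hn.le
    have h2 : α * Z < D c := by
      have := hmono 1 (k + 2) (by omega)
      rw [pow_one] at this
      linarith
    exact absurd (hy a c st.cur (hsep c h2) h1) (not_lt.2 hlt.le)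
  rcases ChainState.step_eq_some hstp with ⟨_, rfl⟩ | ⟨_, c, hc, hlt, rfl⟩ | ⟨_, _, _, _, rfl⟩
  · refine hJ.trans (hmono _ _ ?_)
    simp only
    split_ifs <;> omega
  · simp only
    split_ifs with h
    · exact hclimb c (st.count + 1) hlt hJ
    · by_cases hlow : D c ≤ α
      · have := hmono 0 2 (by omega)
        rw [pow_zero, mul_one] at this
        exact hlow.trans this
      · have : ¬ α * Z < D st.cur := fun h' => h ⟨h', hlow⟩
        refine hclimb c 0 hlt ?_
        rw [zero_add, pow_one]
        exact not_lt.1 this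
  · exact hJ

open scoped Classical in
/-- After `m` has proposed to `w`, it is unlikely that a much more popular man does so for the first
time. -/
theorem sum_climb_le {popM : Men → Women → ℝ} (hM : ∀ m a, 0 < popM m a) {q : ℝ}
    (hq0 : 0 ≤ q) (hq1 : q ≤ 1) (hq : ∀ m a b, popM m a ≤ q * (popM m a + popM m b))
    {D : Men → ℝ} (hD : ∀ c, 0 < D c) {Z : ℝ} (hZ : 1 ≤ Z)
    (hy : Respects D Z (min (Fintype.card Men) (Fintype.card Women)) y) (s I : ℕ)
    (hI : Fintype.card Women < 2 ^ I) :
    (∑ x : Men → PrefList Women, if Proposed (x, y) w ∅ m w ∧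
        (∃ m', Proposed (x, y) w ∅ m' w ∧ ¬ Proposed (x, y) w {m} m' w ∧
          (D m + ∑ c ∈ Finset.univ.filter (fun c => Unmatched (x, y) w {m} c), D c) *
            Z ^ ((s + 2) * I) < D m')
      then menProb popM x else 0) ≤
      q ^ s + ((min (Fintype.card Men) (Fintype.card Women) * Fintype.card Women : ℕ) : ℝ) *
        q ^ s := by
  set N := min (Fintype.card Men) (Fintype.card Women) with hN
  set n := N * Fintype.card Women with hn
  -- The base of a window above the popularity `θ` of `m` and the unmatched men. It depends on the
  -- start state only.
  set α : ChainState Men Women → ℝ := fun st =>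
    windowBase D Z (s + 2) I (Fintype.card Women) (st.freeMass D) with hα
  have hspec : ∀ x, Proposed (x, y) w {m} m w →
      ∃ i < I, α (startState y w m x) =
        (D m + ∑ c ∈ Finset.univ.filter (fun c => Unmatched (x, y) w {m} c), D c) *
          Z ^ ((s + 2) * i) ∧
        2 * cardAbove D (α (startState y w m x)) ≤
          Fintype.card Women + cardAbove D (α (startState y w m x) * Z ^ (s + 2)) := by
    intro x hx
    have hθ := startState_freeMass D hx
    -- Men above `θ` are matched, hence at most `W`. The inequality is strict because `m`, matched
    -- with `w`, is not above `θ`.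
    have hcard : cardAbove D ((startState y w m x).freeMass D) < Fintype.card Women := by
      have h1 := (card_not_unmatched_le (x, y) w (Set.subsingleton_singleton (a := m))).trans
        (min_le_right _ _)
      refine lt_of_lt_of_le (Finset.card_lt_card ⟨fun c hc => ?_, fun hsub => ?_⟩) h1
      · rw [Finset.mem_filter] at hc ⊢
        refine ⟨Finset.mem_univ _, fun hU => ?_⟩
        have h2 : D c ≤ ∑ c ∈ Finset.univ.filter (fun c => Unmatched (x, y) w {m} c), D c :=
          Finset.single_le_sum (f := D) (fun c _ => (hD c).le) (by simpa using hU)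
        rw [hθ] at hc
        linarith [hD m, hc.2]
      · have h2 : m ∈ Finset.univ.filter fun c => ¬ Unmatched (x, y) w {m} c := by
          rw [Finset.mem_filter]
          exact ⟨Finset.mem_univ _, not_unmatched_iff.2 ⟨w, Holds.of_proposed hx rfl⟩⟩
        have h3 := (Finset.mem_filter.1 (hsub h2)).2
        rw [hθ] at h3
        have : 0 ≤ ∑ c ∈ Finset.univ.filter (fun c => Unmatched (x, y) w {m} c), D c :=
          Finset.sum_nonneg fun c _ => (hD c).le
        linarith
    obtain ⟨i, hi, h1, h2⟩ := windowBase_spec (Z := Z) (r := s + 2) hcard hI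
    refine ⟨i, hi, by rw [← hθ]; exact h1, ?_⟩
    simp only [hα]
    rw [h1, mul_assoc _ (Z ^ ((s + 2) * i)), ← pow_add, ← Nat.mul_succ]
    exact h2
  have hθ0 : ∀ x : Men → PrefList Women,
      0 < D m + ∑ c ∈ Finset.univ.filter (fun c => Unmatched (x, y) w {m} c), D c := fun x =>
    add_pos_of_pos_of_nonneg (hD m) (Finset.sum_nonneg fun c _ => (hD c).le)
  have hαge : ∀ x, Proposed (x, y) w {m} m w →
      D m + ∑ c ∈ Finset.univ.filter (fun c => Unmatched (x, y) w {m} c), D c ≤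
        α (startState y w m x) := by
    intro x hx
    obtain ⟨i, _, h, _⟩ := hspec x hx
    rw [h]
    exact le_mul_of_one_le_right (hθ0 x).le (one_le_pow₀ hZ)
  have hsep : ∀ x, Proposed (x, y) w {m} m w → ∀ c, α (startState y w m x) * Z < D c →
      Separated D Z N c := fun x hx c hc =>
    separated_of_lt hD hZ (by linarith [hD m, hαge x hx]) hc
  have h := sum_startState_reaches_le (y := y) (w := w) (m := m) hM hq0 hq1 hq (s := s)
    (δ := q ^ s) (by positivity)
    (low := fun st c => D c ≤ α st) (act := fun st c => α st * Z < D c) (.inr le_rfl)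
    (fun st0 st => D st.cur ≤ α st0 * Z ^ (st.count + 2))
    (fun x hx => by
      have h1 : 0 ≤ ∑ c ∈ Finset.univ.filter (fun c => Unmatched (x, y) w {m} c), D c :=
        Finset.sum_nonneg fun c _ => (hD c).le
      have h2 := hαge x hx
      have h3 := hθ0 x
      refine le_trans ?_ (le_mul_of_one_le_right (by linarith) (one_le_pow₀ hZ))
      change D m ≤ _
      linarith)
    (fun x hx st a st' _ hJ _ hstp => step_le_of_respects hZ
      ((hθ0 x).trans_le (hαge x hx)) (hsep x hx) hy hJ hstp)
    (fun x hx st hst hJ hs hact => by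
      obtain ⟨_, _, _, hcard⟩ := hspec x hx
      exact card_advances_le_card_resets hZ ((hθ0 x).trans_le (hαge x hx)) (hsep x hx) hy hcard
        hst hJ hs hact) n
  refine le_trans (Finset.sum_le_sum fun x _ => ?_) h
  have hx0 := menProb_nonneg hM x
  split_ifs with h1 h2 h2
  · exact le_rfl
  · exfalso
    obtain ⟨hm, m', hm', hm'n, hlt⟩ := h1
    have hx := hm.self
    refine h2 ⟨hx, ?_⟩
    by_contra hR
    have hhit := (hits_of_proposed (low := fun c => D c ≤ α (startState y w m x))
      (act := fun c => α (startState y w m x) * Z < D c) n _ (startState_inv hx)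
      extends_startState (sum_remaining_startState_le x) m' hm').resolve_left
        fun h => hm'n (mem_startState_seen.1 h)
    obtain ⟨st, hJ, hs, rfl⟩ := exists_state_of_hits
      (J := fun st => D st.cur ≤ α (startState y w m x) * Z ^ (st.count + 2))
      (fun st a st' _ hJ _ hstp => step_le_of_respects hZ
        ((hθ0 x).trans_le (hαge x hx)) (hsep x hx) hy hJ hstp) n _ (startState_inv hx) (by
        have h1 : 0 ≤ ∑ c ∈ Finset.univ.filter (fun c => Unmatched (x, y) w {m} c), D c :=
          Finset.sum_nonneg fun c _ => (hD c).le
        have h2 := hαge x hx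
        have h3 := hθ0 x
        refine le_trans ?_ (le_mul_of_one_le_right (by linarith) (one_le_pow₀ hZ))
        change D m ≤ _
        linarith) hR hhit
    -- With the counter below `s`, the proposer has popularity at most `α * Z ^ (s + 1)`, and `α = θ
    -- * Z ^ ((s + 2) * i)` with `i + 1 ≤ I`.
    obtain ⟨i, hi, h4, _⟩ := hspec x hx
    rw [h4, mul_assoc, ← pow_add] at hJ
    refine absurd (hJ.trans (mul_le_mul_of_nonneg_left (pow_le_pow_right₀ hZ ?_) (hθ0 x).le))
      (not_le.2 hlt)
    have : (s + 2) * (i + 1) ≤ (s + 2) * I := Nat.mul_le_mul_left _ hi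
    rw [Nat.mul_add, Nat.mul_one] at this
    omega
  · exact hx0
  · exact le_rfl

end Cases

end StableMarket

namespace StableMarket

/-! ### Deterministic bounds for the sum of the shares -/

section Shares

variable {Men Women : Type*} [Fintype Men] [Fintype Women]

open scoped Classical in
/-- The men who propose to `w` when she accepts nobody. -/
noncomputable def proposers (p : Profile Men Women) (w : Women) : Finset Men :=
  Finset.univ.filter fun m => Proposed p w ∅ m w

open scoped Classical in
/-- The other men who propose to `w` when she accepts only `m`. -/
noncomputable def rivals (p : Profile Men Women) (w : Women) (m : Men) : Finset Men :=
  Finset.univ.filter fun a => a ≠ m ∧ Proposed p w {m} a w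

/-- The total popularity of `m` and his rivals. -/
noncomputable def rivalMass (D : Men → ℝ) (p : Profile Men Women) (w : Women) (m : Men) : ℝ :=
  D m + ∑ a ∈ rivals p w m, D a

/-- The sum, over the men who propose to `w` when she accepts nobody, of their shares of the
popularity among their rivals. -/
noncomputable def shareSum (D : Men → ℝ) (p : Profile Men Women) (w : Women) : ℝ :=
  ∑ m ∈ proposers p w, D m / rivalMass D p w m

section
variable {p p' : Profile Men Women} {w : Women} {D : Men → ℝ}

theorem mem_proposers {m : Men} : m ∈ proposers p w ↔ Proposed p w ∅ m w := by
  simp [proposers]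

theorem mem_rivals {m a : Men} : a ∈ rivals p w m ↔ a ≠ m ∧ Proposed p w {m} a w := by
  simp [rivals]

theorem rivals_congr (h1 : p.1 = p'.1) (h2 : ∀ a, a ≠ w → p.2 a = p'.2 a) (m : Men) :
    rivals p w m = rivals p' w m := by
  ext a
  rw [mem_rivals, mem_rivals, proposed_congr h1 h2]

theorem le_rivalMass (hD : ∀ c, 0 < D c) (m : Men) : D m ≤ rivalMass D p w m :=
  le_add_of_nonneg_right (Finset.sum_nonneg fun c _ => (hD c).le)

theorem rivalMass_pos (hD : ∀ c, 0 < D c) (m : Men) : 0 < rivalMass D p w m :=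
  (hD m).trans_le (le_rivalMass hD m)

theorem share_le_one (hD : ∀ c, 0 < D c) (m : Men) : D m / rivalMass D p w m ≤ 1 :=
  div_le_one_of_le₀ (le_rivalMass hD m) (rivalMass_pos hD m).le

theorem sum_le_rivalMass (hD : ∀ c, 0 < D c) {m : Men} {T : Finset Men}
    (hT : ∀ c ∈ T, c = m ∨ c ∈ rivals p w m) : ∑ c ∈ T, D c ≤ rivalMass D p w m := by
  classical
  have hm : m ∉ rivals p w m := fun h => (mem_rivals.1 h).1 rfl
  unfold rivalMass
  rw [← Finset.sum_insert hm]
  refine Finset.sum_le_sum_of_subset_of_nonneg (fun c hc => ?_) fun c _ _ => (hD c).le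
  exact Finset.mem_insert.2 (hT c hc)

theorem rivals_total {m m' : Men} (hm : m ∈ proposers p w) (hne : m ≠ m') :
    m ∈ rivals p w m' ∨ m' ∈ rivals p w m := by
  rw [mem_rivals, mem_rivals]
  rcases (mem_proposers.1 hm).total (m := m') with h | h
  · exact .inl ⟨hne, h⟩
  · exact .inr ⟨hne.symm, h⟩

open scoped Classical in
-- By `Unmatched.proposed` these men are pairwise rivals, so each rival mass is at least their
-- total. Cardinality would not help, as their number is not controlled by `N`.
theorem sum_share_unmatched_le (hD : ∀ c, 0 < D c) :
    ∑ m ∈ (proposers p w).filter (fun m => Unmatched p w ∅ m), D m / rivalMass D p w m ≤ 1 := by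
  set T := (proposers p w).filter (fun m => Unmatched p w ∅ m) with hT
  have h : ∀ m ∈ T, D m / rivalMass D p w m ≤ D m / ∑ c ∈ T, D c := by
    intro m hm
    refine div_le_div_of_nonneg_left (hD m).le (Finset.sum_pos (fun c _ => hD c) ⟨m, hm⟩) ?_
    rw [hT, Finset.mem_filter, mem_proposers] at hm
    refine sum_le_rivalMass hD fun c hc => ?_
    by_cases hcm : c = m
    · exact .inl hcm
    · exact .inr (mem_rivals.2 ⟨hcm, hm.2.proposed hm.1 (Finset.mem_filter.1 hc).2 hcm⟩)
  refine (Finset.sum_le_sum h).trans ?_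
  rw [← Finset.sum_div]
  exact div_self_le_one _

open scoped Classical in
theorem card_proposers_not_unmatched_le :
    ((proposers p w).filter fun m => ¬ Unmatched p w ∅ m).card ≤
      min (Fintype.card Men) (Fintype.card Women) := by
  refine (Finset.card_le_card ?_).trans (card_not_unmatched_le p w Set.subsingleton_empty)
  exact Finset.filter_subset_filter _ (Finset.subset_univ _)

/-- The crude bound, for use on the unlikely events. -/
theorem shareSum_le (hD : ∀ c, 0 < D c) :
    shareSum D p w ≤ min (Fintype.card Men) (Fintype.card Women) + 1 := by
  classical
  unfold shareSum
  rw [← Finset.sum_filter_add_sum_filter_not _ (fun m => Unmatched p w ∅ m), add_comm]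
  refine add_le_add ?_ (sum_share_unmatched_le hD)
  refine (Finset.sum_le_card_nsmul _ _ 1 fun m _ => share_le_one hD m).trans ?_
  rw [nsmul_eq_mul, mul_one]
  exact_mod_cast card_proposers_not_unmatched_le

open scoped Classical in
/-- A subset of `F` with at most `n` elements and of the largest total popularity. -/
theorem exists_top_finset {α : Type*} (D : α → ℝ) (F : Finset α) (n : ℕ) :
    ∃ T ⊆ F, T.card ≤ n ∧ ∀ T' ⊆ F, T'.card ≤ n → ∑ c ∈ T', D c ≤ ∑ c ∈ T, D c := by
  obtain ⟨T, hT, hmax⟩ := Finset.exists_max_image (F.powerset.filter fun T => T.card ≤ n)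
    (fun T => ∑ c ∈ T, D c) ⟨∅, by simp⟩
  rw [Finset.mem_filter, Finset.mem_powerset] at hT
  refine ⟨T, hT.1, hT.2, fun T' h1 h2 => hmax T' ?_⟩
  rw [Finset.mem_filter, Finset.mem_powerset]
  exact ⟨h1, h2⟩

/-- If every man has almost all the others as rivals, the sum of the shares is small. -/
theorem shareSum_le_of_few (hD : ∀ c, 0 < D c) {s : ℕ}
    (h : ∀ m, Proposed p w ∅ m w →
      {m' | Proposed p w ∅ m' w ∧ ¬ Proposed p w {m} m' w}.ncard < s) :
    shareSum D p w ≤ s + 1 := by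
  classical
  -- Fewer than `s` proposers are missing from the rivals of `m`, and they weigh no more than `T`.
  -- So `m` and his rivals weigh at least as much as all proposers outside `T`, whose shares then
  -- sum to at most `1`.
  obtain ⟨T, hTP, hTs, hmax⟩ := exists_top_finset D (proposers p w) s
  unfold shareSum
  rw [← Finset.sum_filter_add_sum_filter_not _ (fun m => m ∈ T)]
  refine add_le_add ?_ ?_
  · refine (Finset.sum_le_card_nsmul _ _ 1 fun m _ => share_le_one hD m).trans ?_
    rw [nsmul_eq_mul, mul_one]
    refine Nat.cast_le.2 ((Finset.card_le_card fun m hm => ?_).trans hTs)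
    exact (Finset.mem_filter.1 hm).2
  · set R := (proposers p w).filter (fun m => m ∉ T) with hR
    have h1 : ∀ m ∈ R, D m / rivalMass D p w m ≤ D m / ∑ c ∈ R, D c := by
      intro m hm
      refine div_le_div_of_nonneg_left (hD m).le (Finset.sum_pos (fun c _ => hD c) ⟨m, hm⟩) ?_
      have hmP := (Finset.mem_filter.1 hm).1
      set O := (proposers p w).filter (fun m' => ¬ Proposed p w {m} m' w) with hO
      have hOs : O.card ≤ s := by
        have h2 := h m (mem_proposers.1 hmP)
        have h3 : {m' | Proposed p w ∅ m' w ∧ ¬ Proposed p w {m} m' w} = ↑O := by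
          ext m'
          simp [hO, mem_proposers]
        rw [h3, Set.ncard_coe_finset] at h2
        exact h2.le
      have h4 := hmax O (Finset.filter_subset _ _) hOs
      have h5 := Finset.sum_filter_add_sum_filter_not (proposers p w)
        (fun m' => Proposed p w {m} m' w) D
      have h6 := Finset.sum_filter_add_sum_filter_not (proposers p w) (fun m => m ∈ T) D
      have h7 : (proposers p w).filter (fun m => m ∈ T) = T := by
        ext c
        simp only [Finset.mem_filter, and_iff_right_iff_imp]
        exact fun hc => hTP hc
      rw [h7] at h6
      have h8 : ∑ c ∈ (proposers p w).filter (fun m' => Proposed p w {m} m' w), D c ≤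
          rivalMass D p w m := by
        refine sum_le_rivalMass hD fun c hc => ?_
        by_cases hcm : c = m
        · exact .inl hcm
        · exact .inr (mem_rivals.2 ⟨hcm, (Finset.mem_filter.1 hc).2⟩)
      linarith
    refine (Finset.sum_le_sum h1).trans ?_
    rw [← Finset.sum_div]
    exact div_self_le_one _

end

/-- A weighted tournament inequality. -/
theorem sum_div_le_log {α : Type*} {D v : α → ℝ} {v₀ : ℝ} (hv₀ : 0 < v₀)
    (hD : ∀ c, 0 < D c) (A : α → Finset α) [DecidableEq α] (F : Finset α) :
    (∀ m ∈ F, v₀ ≤ v m) → (∀ m ∈ F, ∀ T ⊆ F, (∀ c ∈ T, c = m ∨ c ∈ A m) → ∑ c ∈ T, D c ≤ v m) →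
    (∀ m ∈ F, ∀ m' ∈ F, m ≠ m' → m ∈ A m' ∨ m' ∈ A m) →
    ∑ m ∈ F, D m / v m ≤ 4 * Real.log (1 + (∑ m ∈ F, D m) / v₀) := by
  induction F using Finset.strongInduction with
  | H F ih =>
    intro h1 h2 h3
    rcases F.eq_empty_or_nonempty with rfl | hF
    · simp
    obtain ⟨m, hm, hmax⟩ := Finset.exists_max_image F v hF
    have hih := ih (F.erase m) (Finset.erase_ssubset hm)
      (fun c hc => h1 c (Finset.mem_of_mem_erase hc))
      (fun c hc T hT => h2 c (Finset.mem_of_mem_erase hc) T (hT.trans (Finset.erase_subset _ _)))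
      (fun c hc c' hc' => h3 c (Finset.mem_of_mem_erase hc) c' (Finset.mem_of_mem_erase hc'))
    rw [← Finset.add_sum_erase F _ hm, ← Finset.add_sum_erase F _ hm]
    set S := ∑ c ∈ F.erase m, D c with hS
    have hS0 : 0 ≤ S := Finset.sum_nonneg fun c _ => (hD c).le
    have hDm := hD m
    have hvm : 0 < v m := hv₀.trans_le (h1 m hm)
    -- the total popularity is at most twice the largest weight
    have htot : D m + S ≤ 2 * v m := by
      set T := D m + S with hT
      have hTF : T = ∑ c ∈ F, D c := by rw [hT, hS, Finset.add_sum_erase F _ hm]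
      have hT0 : 0 < T := by linarith
      -- Every pair of men is counted in `v` for at least one of the two, and every man in his own.
      -- So the mean of `v` with weights `D` is at least half of the total, and the maximum is too.
      have e1 : T * T + ∑ c ∈ F, D c * D c ≤ 2 * ∑ c ∈ F, D c * v c := by
        have e2 : ∀ c ∈ F, ∑ b ∈ F, (if b = c ∨ b ∈ A c then D b else 0) ≤ v c := by
          intro c hc
          rw [← Finset.sum_filter]
          exact h2 c hc _ (Finset.filter_subset _ _) fun b hb => (Finset.mem_filter.1 hb).2
        have e3 : ∑ c ∈ F, ∑ b ∈ F, D c * (if b = c ∨ b ∈ A c then D b else 0) ≤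
            ∑ c ∈ F, D c * v c := by
          refine Finset.sum_le_sum fun c hc => ?_
          rw [← Finset.mul_sum]
          exact mul_le_mul_of_nonneg_left (e2 c hc) (hD c).le
        have e4 : ∑ c ∈ F, ∑ b ∈ F, D c * (if b = c ∨ b ∈ A c then D b else 0) =
            ∑ c ∈ F, ∑ b ∈ F, D b * (if c = b ∨ c ∈ A b then D c else 0) := Finset.sum_comm
        have e5 : T * T + ∑ c ∈ F, D c * D c ≤
            ∑ c ∈ F, ∑ b ∈ F, D c * (if b = c ∨ b ∈ A c then D b else 0) +
            ∑ c ∈ F, ∑ b ∈ F, D b * (if c = b ∨ c ∈ A b then D c else 0) := by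
          have e6 : ∑ c ∈ F, D c * D c = ∑ c ∈ F, ∑ b ∈ F, if b = c then D c * D b else 0 := by
            refine Finset.sum_congr rfl fun c hc => ?_
            rw [Finset.sum_ite_eq' F c, if_pos hc]
          rw [e6, hTF, Finset.sum_mul_sum, ← Finset.sum_add_distrib, ← Finset.sum_add_distrib]
          refine Finset.sum_le_sum fun c hc => ?_
          rw [← Finset.sum_add_distrib, ← Finset.sum_add_distrib]
          refine Finset.sum_le_sum fun b hb => ?_
          have hbc := mul_pos (hD b) (hD c)
          by_cases hcb : b = c
          · subst hcb
            simp
          · rcases h3 b hb c hc hcb with h | h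
            · simp only [hcb, h, or_true, if_true, if_false, add_zero]
              have : 0 ≤ D b * (if c = b ∨ c ∈ A b then D c else 0) := by
                split_ifs
                · exact hbc.le
                · simp
              linarith
            · simp only [hcb, h, or_true, if_true, if_false, add_zero]
              have : 0 ≤ D c * (if False ∨ b ∈ A c then D b else 0) := by
                split_ifs
                · linarith [mul_comm (D b) (D c)]
                · simp
              linarith [mul_comm (D b) (D c)]
        linarith
      have e7 : ∑ c ∈ F, D c * v c ≤ T * v m := by
        rw [hTF, Finset.sum_mul]
        exact Finset.sum_le_sum fun c hc => mul_le_mul_of_nonneg_left (hmax c hc) (hD c).le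
      have e8 : 0 ≤ ∑ c ∈ F, D c * D c := Finset.sum_nonneg fun c _ => mul_self_nonneg _
      have e9 : T * T ≤ T * (2 * v m) := by linarith
      exact le_of_mul_le_mul_left e9 hT0
    have hstep : D m / v m ≤
        4 * (Real.log (1 + (D m + S) / v₀) - Real.log (1 + S / v₀)) := by
      have f1 : (0:ℝ) < 1 + (D m + S) / v₀ := by positivity
      have f2 : (0:ℝ) < 1 + S / v₀ := by positivity
      have f3 := Real.one_sub_inv_le_log_of_pos (div_pos f1 f2)
      rw [Real.log_div f1.ne' f2.ne', inv_div] at f3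
      have f4 : 1 - (1 + S / v₀) / (1 + (D m + S) / v₀) = D m / (v₀ + (D m + S)) := by
        have : v₀ + (D m + S) ≠ 0 := by positivity
        field_simp
        ring
      rw [f4] at f3
      -- Here `v₀ + (D m + S) ≤ 3 * v m`.
      have f5 : D m / v m ≤ 4 * (D m / (v₀ + (D m + S))) := by
        rw [mul_div_assoc', div_le_div_iff₀ hvm (by positivity)]
        have := h1 m hm
        nlinarith
      linarith
    linarith

section Climb
variable {p : Profile Men Women} {w : Women} {D : Men → ℝ}

open scoped Classical in
-- Three groups of proposers. Those unmatched in the market `∅` contribute at most `1`. Of the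
-- others, at most `N`, those with `N * D m < D0` have shares at most `1 / N`, because the men
-- unmatched in the market `{m}` are rivals of total popularity at least `D0`. For the rest, `h`
-- bounds each popularity by `X` times the smallest rival mass, and the tournament inequality
-- applies. Only this last group needs `h`, so that the union bound over `m` runs over few men.
theorem shareSum_le_of_climb (hD : ∀ c, 0 < D c) {N : ℕ}
    (hN : N = min (Fintype.card Men) (Fintype.card Women)) {X : ℝ} (hX : 1 ≤ X)
    {T : Finset Men}
    (hmax : ∀ T' : Finset Men, T'.card ≤ N → ∑ c ∈ T', D c ≤ ∑ c ∈ T, D c)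
    (h : ∀ m, Proposed p w ∅ m w → ∑ c ∈ Finset.univ.filter (fun c => c ∉ T), D c ≤ N * D m →
      ∀ m', Proposed p w ∅ m' w → ¬ Proposed p w {m} m' w →
        D m' ≤ (D m + ∑ c ∈ Finset.univ.filter (fun c => Unmatched p w {m} c), D c) * X) :
    shareSum D p w ≤ 2 + 4 * Real.log (1 + N * X) := by
  set D0 := ∑ c ∈ Finset.univ.filter (fun c => c ∉ T), D c with hD0
  have hcard : ((proposers p w).filter fun m => ¬ Unmatched p w ∅ m).card ≤ N := by
    rw [hN]
    exact card_proposers_not_unmatched_le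
  set P := (proposers p w).filter (fun m => ¬ Unmatched p w ∅ m) with hP
  have hUle : ∀ m ∈ proposers p w,
      D m + ∑ c ∈ Finset.univ.filter (fun c => Unmatched p w {m} c), D c ≤ rivalMass D p w m := by
    intro m hm
    have hmU : m ∉ Finset.univ.filter (fun c => Unmatched p w {m} c) := by
      rw [Finset.mem_filter]
      exact fun h => (Holds.of_proposed (mem_proposers.1 hm).self rfl).2 (h.2 w)
    rw [← Finset.sum_insert hmU]
    refine sum_le_rivalMass hD fun c hc => ?_
    rcases Finset.mem_insert.1 hc with hc | hc
    · exact .inl hc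
    · refine .inr (mem_rivals.2 ⟨fun h => hmU (h ▸ hc), ?_⟩)
      exact fun b _ => (Finset.mem_filter.1 hc).2 b
  have hD0le : ∀ m, D0 ≤ ∑ c ∈ Finset.univ.filter (fun c => Unmatched p w {m} c), D c := by
    intro m
    have h1 := card_not_unmatched_le p w (Set.subsingleton_singleton (a := m))
    rw [← hN] at h1
    have h2 := hmax _ h1
    have h3 := Finset.sum_filter_add_sum_filter_not Finset.univ
      (fun c => Unmatched p w {m} c) D
    have h4 := Finset.sum_filter_add_sum_filter_not Finset.univ (fun c => c ∈ T) D
    have h5 : Finset.univ.filter (fun c => c ∈ T) = T := by ext; simp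
    rw [h5] at h4
    linarith
  have hsplit : shareSum D p w ≤ 1 + ∑ m ∈ P, D m / rivalMass D p w m := by
    unfold shareSum
    rw [← Finset.sum_filter_add_sum_filter_not _ (fun m => Unmatched p w ∅ m)]
    exact add_le_add (sum_share_unmatched_le hD) le_rfl
  have hlow : ∑ m ∈ P.filter (fun m => ¬ D0 ≤ N * D m), D m / rivalMass D p w m ≤ 1 := by
    rcases Nat.eq_zero_or_pos N with hN0 | hN0
    · rw [hN0] at hcard
      rw [Finset.card_eq_zero.1 (Nat.le_zero.1 hcard)]
      simp
    have hN0' : (0:ℝ) < N := by exact_mod_cast hN0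
    refine (Finset.sum_le_card_nsmul _ _ (1 / (N:ℝ)) fun m hm => ?_).trans ?_
    · rw [Finset.mem_filter, not_le] at hm
      have h1 := hUle m (Finset.mem_filter.1 hm.1).1
      have h2 := hD0le m
      rw [div_le_div_iff₀ (rivalMass_pos hD m) hN0']
      linarith [hm.2, hD m, mul_comm (D m) (N:ℝ)]
    · rw [nsmul_eq_mul, mul_one_div]
      refine div_le_one_of_le₀ ?_ hN0'.le
      exact_mod_cast (Finset.card_le_card (Finset.filter_subset _ _)).trans hcard
  set F := P.filter (fun m => D0 ≤ N * D m) with hF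
  have hFP : ∀ m ∈ F, m ∈ proposers p w := fun m hm =>
    (Finset.mem_filter.1 (Finset.mem_filter.1 hm).1).1
  have hhigh : ∑ m ∈ F, D m / rivalMass D p w m ≤ 4 * Real.log (1 + N * X) := by
    rcases F.eq_empty_or_nonempty with hF0 | hF0
    · rw [hF0, Finset.sum_empty]
      exact mul_nonneg (by norm_num) (Real.log_nonneg (le_add_of_nonneg_right (by positivity)))
    obtain ⟨m₁, hm₁, hmin⟩ := Finset.exists_min_image F (rivalMass D p w) hF0
    have hv₀ := rivalMass_pos (p := p) (w := w) hD m₁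
    refine (sum_div_le_log hv₀ hD (rivals p w) F hmin
      (fun m _ T _ hT => sum_le_rivalMass hD hT)
      fun m hm m' hm' hne => rivals_total (hFP m hm) hne).trans ?_
    refine mul_le_mul_of_nonneg_left (Real.log_le_log ?_ ?_) (by norm_num)
    · have : 0 ≤ ∑ m ∈ F, D m := Finset.sum_nonneg fun c _ => (hD c).le
      positivity
    · refine add_le_add le_rfl ?_
      rw [div_le_iff₀ hv₀]
      refine (Finset.sum_le_card_nsmul F _ (X * rivalMass D p w m₁) fun m hm => ?_).trans ?_
      · have hX1 : rivalMass D p w m₁ ≤ X * rivalMass D p w m₁ :=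
          le_mul_of_one_le_left hv₀.le hX
        by_cases hmm : m = m₁
        · rw [hmm]
          exact (le_rivalMass hD m₁).trans hX1
        by_cases hr : m ∈ rivals p w m₁
        · refine le_trans ?_ hX1
          have := sum_le_rivalMass (p := p) (w := w) (m := m₁) hD (T := {m}) (by simp [hr])
          simpa using this
        · have h1 : ¬ Proposed p w {m₁} m w := fun h => hr (mem_rivals.2 ⟨hmm, h⟩)
          have h2 := h m₁ (mem_proposers.1 (hFP m₁ hm₁)) (Finset.mem_filter.1 hm₁).2 m
            (mem_proposers.1 (hFP m hm)) h1
          refine h2.trans ?_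
          rw [mul_comm]
          exact mul_le_mul_of_nonneg_left (hUle m₁ (hFP m₁ hm₁)) (by linarith)
      · rw [nsmul_eq_mul, mul_assoc]
        refine mul_le_mul_of_nonneg_right ?_ (by positivity)
        exact_mod_cast (Finset.card_le_card (Finset.filter_subset _ _)).trans hcard
  have := Finset.sum_filter_add_sum_filter_not P (fun m => D0 ≤ N * D m)
    (fun m => D m / rivalMass D p w m)
  linarith

end Climb

end Shares

end StableMarket

namespace StableMarket

/-! ### Reduction of the expectation to shares, and lists that respect popularity gaps -/

section Expectation

variable {Men Women : Type*} [Fintype Men] [Fintype Women] [DecidableEq Men] [DecidableEq Women]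

/-- The probability of the lists of the women. -/
noncomputable def womenProb (popW : Women → Men → ℝ) (y : Women → PrefList Men) : ℝ :=
  ∏ a, popularityProb (popW a) (y a)

omit [DecidableEq Men] [DecidableEq Women] in
theorem womenProb_nonneg {popW : Women → Men → ℝ} (hW : ∀ a m, 0 < popW a m)
    (y : Women → PrefList Men) : 0 ≤ womenProb popW y :=
  Finset.prod_nonneg fun a _ => popularityProb_nonneg _ (hW a) _

theorem sum_womenProb {popW : Women → Men → ℝ} (hW : ∀ a m, 0 < popW a m) :
    ∑ y : Women → PrefList Men, womenProb popW y = 1 := by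
  unfold womenProb
  rw [← Fintype.prod_sum]
  exact Finset.prod_eq_one fun a _ => sum_popularityProb (popW a) (hW a)

theorem sum_menProb {popM : Men → Women → ℝ} (hM : ∀ m a, 0 < popM m a) :
    ∑ x : Men → PrefList Women, menProb popM x = 1 := by
  unfold menProb
  rw [← Fintype.prod_sum]
  exact Finset.prod_eq_one fun m _ => sum_popularityProb (popM m) (hM m)

/-- The list of one woman may be drawn again. -/
theorem sum_womenProb_mul_eq {popW : Women → Men → ℝ} (hW : ∀ a m, 0 < popW a m) (w : Women)
    (F : (Women → PrefList Men) → ℝ) :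
    ∑ y, womenProb popW y * F y = ∑ y, womenProb popW y *
      ∑ τ, popularityProb (popW w) τ * F (Function.update y w τ) := by
  -- Exchanging the list of `w` with an independent copy preserves the joint law.
  have hinv : Function.Involutive (fun z : (Women → PrefList Men) × PrefList Men =>
      (Function.update z.1 w z.2, z.1 w)) := by
    rintro ⟨y, τ⟩
    simp
  have h1 : ∀ y, womenProb popW y * F y =
      ∑ τ, womenProb popW y * popularityProb (popW w) τ * F y := by
    intro y
    rw [← Finset.sum_mul, ← Finset.mul_sum, sum_popularityProb (popW w) (hW w), mul_one]
  simp_rw [h1, Finset.mul_sum]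
  rw [← Fintype.sum_prod_type', ← Fintype.sum_prod_type']
  refine Fintype.sum_equiv hinv.toPerm _ _ ?_
  rintro ⟨y, τ⟩
  have h2 : womenProb popW (Function.update y w τ) * popularityProb (popW w) (y w) =
      womenProb popW y * popularityProb (popW w) τ := by
    unfold womenProb
    rw [← Finset.mul_prod_erase _ _ (Finset.mem_univ w),
      ← Finset.mul_prod_erase (f := fun a => popularityProb (popW a) (y a)) _ (Finset.mem_univ w),
      Function.update_self]
    have : ∀ a ∈ Finset.univ.erase w, popularityProb (popW a) (Function.update y w τ a) =
        popularityProb (popW a) (y a) := by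
      intro a ha
      rw [Function.update_of_ne (Finset.ne_of_mem_erase ha)]
    rw [Finset.prod_congr rfl this]
    ring
  simp only [Function.Involutive.coe_toPerm, Function.update_idem, Function.update_eq_self]
  rw [← h2]
  ring

theorem sum_womenProb_ite_eq {popW : Women → Men → ℝ} (hW : ∀ a m, 0 < popW a m) (w : Women)
    (P : PrefList Men → Prop) [DecidablePred P] :
    (∑ y : Women → PrefList Men, if P (y w) then womenProb popW y else 0) =
      ∑ τ, if P τ then popularityProb (popW w) τ else 0 := by
  have h := sum_womenProb_mul_eq hW w (fun y => if P (y w) then 1 else 0)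
  simp only [mul_ite, mul_one, mul_zero, Function.update_self] at h
  rw [h, ← Finset.sum_mul, sum_womenProb hW, one_mul]

/-- Proposers and rivals do not depend on the list of `w`. Once it is drawn again, `sum_first_le`
bounds the probability that a given proposer precedes all his rivals. -/
theorem expectedStableHusbands_le {popM : Men → Women → ℝ} {popW : Women → Men → ℝ}
    (hM : ∀ m a, 0 < popM m a) (hW : ∀ a m, 0 < popW a m) (w : Women) :
    expectedStableHusbands popM popW w ≤
      ∑ x, menProb popM x * ∑ y, womenProb popW y * shareSum (popW w) (x, y) w := by
  classical
  unfold expectedStableHusbands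
  rw [Fintype.sum_prod_type]
  refine Finset.sum_le_sum fun x _ => ?_
  have h0 : ∀ y, profileProb popM popW (x, y) = menProb popM x * womenProb popW y := fun _ => rfl
  simp_rw [h0, mul_assoc, ← Finset.mul_sum]
  refine mul_le_mul_of_nonneg_left ?_ (menProb_nonneg hM x)
  have hcount : ∀ y, ((stableHusbands (x, y) w).ncard : ℝ) ≤
      ∑ m ∈ proposers (x, y) w,
        if ∀ a ∈ rivals (x, y) w m, (y w).symm m < (y w).symm a then (1:ℝ) else 0 := by
    intro y
    rw [← Finset.sum_filter, Finset.sum_const, nsmul_eq_mul, mul_one]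
    refine Nat.cast_le.2 ?_
    rw [← Set.ncard_coe_finset]
    refine Set.ncard_le_ncard ?_
    rintro m ⟨μ, hμ, hm⟩
    rw [Finset.coe_filter]
    refine ⟨mem_proposers.2 (hμ.proposed hm), fun a ha => ?_⟩
    exact hμ.prefers hm (mem_rivals.1 ha).2 (mem_rivals.1 ha).1
  refine (Finset.sum_le_sum fun y _ =>
    mul_le_mul_of_nonneg_left (hcount y) (womenProb_nonneg hW y)).trans ?_
  rw [sum_womenProb_mul_eq hW w]
  refine Finset.sum_le_sum fun y _ => mul_le_mul_of_nonneg_left ?_ (womenProb_nonneg hW y)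
  have hP : ∀ τ, proposers (x, Function.update y w τ) w = proposers (x, y) w := by
    intro τ
    ext m
    rw [mem_proposers, mem_proposers]
    exact proposed_congr (p := (x, Function.update y w τ)) (p' := (x, y)) rfl (fun a ha => Function.update_of_ne ha _ _) _ _
  have hA : ∀ τ m, rivals (x, Function.update y w τ) w m = rivals (x, y) w m := fun τ m =>
    rivals_congr (p := (x, Function.update y w τ)) (p' := (x, y)) rfl (fun a ha => Function.update_of_ne ha _ _) m
  simp_rw [hP, hA, Function.update_self, Finset.mul_sum, mul_ite, mul_one, mul_zero]
  rw [Finset.sum_comm]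
  refine Finset.sum_le_sum fun m _ => ?_
  refine le_trans (le_of_eq ?_) (sum_first_le (popW w) (hW w) (rivals (x, y) w m) m
    fun h => (mem_rivals.1 h).1 rfl)
  congr!

open scoped Classical in
/-- Most lists of the women respect large differences in popularity. -/
theorem sum_not_respects_le {popW : Women → Men → ℝ} (hW : ∀ a m, 0 < popW a m) (w : Women)
    {Q : ℝ} (hQ0 : 0 ≤ Q)
    (hQ : ∀ a m m', popW a m / popW a m' ≤ Q * (popW w m / popW w m')) {Z : ℝ} (hZ : 1 < Z)
    (N : ℕ) :
    (∑ y : Women → PrefList Men,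
      if ¬ Respects (popW w) Z N y then womenProb popW y else 0) ≤
      Fintype.card Women * (N * (Q * ((N + 1) / Z))) := by
  set D := popW w with hDdef
  have hD : ∀ c, 0 < D c := hW w
  set T := Finset.univ.filter fun c => Separated D Z N c with hT
  have hZ0 : 0 < Z := by linarith
  -- All separated men are among the at most `N` men who are not `Z` times less popular than the
  -- least popular separated man.
  have hTcard : T.card ≤ N := by
    rcases T.eq_empty_or_nonempty with h | h
    · simp [h]
    · obtain ⟨c, hc, hmin⟩ := Finset.exists_min_image T D h
      refine (Finset.card_le_card fun b hb => ?_).trans (Finset.mem_filter.1 hc).2.1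
      refine Finset.mem_filter.2 ⟨Finset.mem_univ _, ?_⟩
      have := hmin b hb
      have := hD b
      nlinarith
  have h1 : ∀ y, (if ¬ Respects D Z N y then womenProb popW y else 0) ≤
      ∑ a, ∑ c ∈ T, ∑ c' ∈ Finset.univ.filter (fun b => Z * D b ≤ D c),
        if (y a).symm c' < (y a).symm c then womenProb popW y else 0 := by
    intro y
    have hnn : ∀ a c c', (0:ℝ) ≤ if (y a).symm c' < (y a).symm c then womenProb popW y else 0 := by
      intro a c c'
      split_ifs
      · exact womenProb_nonneg hW y
      · exact le_rfl
    by_cases h : Respects D Z N y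
    swap
    · rw [if_pos h]
      unfold Respects at h
      push Not at h
      obtain ⟨a, c, c', hc, hcc', hle⟩ := h
      have hne : c' ≠ c := by
        rintro rfl
        have := hD c'
        nlinarith
      have hlt : (y a).symm c' < (y a).symm c :=
        lt_of_le_of_ne hle fun h => hne ((y a).symm.injective h)
      calc womenProb popW y = if (y a).symm c' < (y a).symm c then womenProb popW y else 0 := by
            rw [if_pos hlt]
        _ ≤ ∑ c' ∈ Finset.univ.filter (fun b => Z * D b ≤ D c),
            if (y a).symm c' < (y a).symm c then womenProb popW y else 0 :=
          Finset.single_le_sum (f := fun c' => if (y a).symm c' < (y a).symm c then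
            womenProb popW y else 0) (fun c' _ => hnn a c c') (by simpa using hcc')
        _ ≤ ∑ c ∈ T, ∑ c' ∈ Finset.univ.filter (fun b => Z * D b ≤ D c),
            if (y a).symm c' < (y a).symm c then womenProb popW y else 0 :=
          Finset.single_le_sum (f := fun c => ∑ c' ∈ Finset.univ.filter (fun b => Z * D b ≤ D c),
            if (y a).symm c' < (y a).symm c then womenProb popW y else 0)
            (fun c _ => Finset.sum_nonneg fun c' _ => hnn a c c') (by simpa [hT] using hc)
        _ ≤ _ := Finset.single_le_sum (f := fun a => ∑ c ∈ T,
            ∑ c' ∈ Finset.univ.filter (fun b => Z * D b ≤ D c),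
            if (y a).symm c' < (y a).symm c then womenProb popW y else 0)
            (fun a _ => Finset.sum_nonneg fun c _ => Finset.sum_nonneg fun c' _ => hnn a c c')
            (Finset.mem_univ a)
    · rw [if_neg (not_not.2 h)]
      exact Finset.sum_nonneg fun a _ => Finset.sum_nonneg fun c _ =>
        Finset.sum_nonneg fun c' _ => hnn a c c'
  refine (Finset.sum_le_sum fun y _ => h1 y).trans ?_
  rw [Finset.sum_comm]
  refine (Finset.sum_le_card_nsmul _ _ (N * (Q * ((N + 1) / Z))) fun a _ => ?_).trans (by simp)
  rw [Finset.sum_comm]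
  -- The constant `Q` transfers popularity ratios from `w` to any other woman `a`. The second
  -- condition in `Separated` then makes the sum over `c'` small even when there are very many men.
  have hpair : ∀ c ∈ T, ∀ c' ∈ Finset.univ.filter (fun b => Z * D b ≤ D c),
      (∑ y : Women → PrefList Men,
        if (y a).symm c' < (y a).symm c then womenProb popW y else 0) ≤ Q * (D c' / D c) := by
    intro c _ c' hc'
    have hne : c' ≠ c := by
      rintro rfl
      have := hD c'
      have := (Finset.mem_filter.1 hc').2
      nlinarith
    have h2 := sum_womenProb_ite_eq hW a (fun τ => τ.symm c' < τ.symm c)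
    have h3 := sum_first_le (popW a) (hW a) {c} c' (by simpa using hne)
    simp only [Finset.mem_singleton, forall_eq, Finset.sum_singleton] at h3
    rw [h2]
    refine le_trans ?_ (hQ a c' c)
    refine le_trans ?_ (h3.trans ?_)
    · exact le_of_eq (by congr!)
    · exact div_le_div_of_nonneg_left (hW a c').le (hW a c)
        (le_add_of_nonneg_left (hW a c').le)
  refine (Finset.sum_le_card_nsmul T _ (Q * ((N + 1) / Z)) fun c hc => ?_).trans ?_
  · rw [Finset.sum_comm]
    refine (Finset.sum_le_sum fun c' hc' => hpair c hc c' hc').trans ?_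
    rw [← Finset.mul_sum, ← Finset.sum_div]
    refine mul_le_mul_of_nonneg_left ?_ hQ0
    rw [div_le_div_iff₀ (hD c) hZ0, mul_comm]
    exact (Finset.mem_filter.1 hc).2.2
  · rw [nsmul_eq_mul]
    refine mul_le_mul_of_nonneg_right (Nat.cast_le.2 hTcard) ?_
    positivity

end Expectation

end StableMarket

namespace StableMarket

/-! ### Averaging over the lists in the two regimes -/

section Bounds

variable {Men Women : Type*} [Fintype Men] [Fintype Women] [DecidableEq Men] [DecidableEq Women]
variable {popM : Men → Women → ℝ} {popW : Women → Men → ℝ}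

theorem expectedStableHusbands_le_swap (hM : ∀ m a, 0 < popM m a) (hW : ∀ a m, 0 < popW a m)
    (w : Women) : expectedStableHusbands popM popW w ≤
      ∑ y, womenProb popW y * ∑ x, menProb popM x * shareSum (popW w) (x, y) w := by
  refine (expectedStableHusbands_le hM hW w).trans (le_of_eq ?_)
  simp_rw [Finset.mul_sum]
  rw [Finset.sum_comm]
  exact Finset.sum_congr rfl fun y _ => Finset.sum_congr rfl fun x _ => by ring

open scoped Classical in
/-- A bound that holds for the sum of the shares outside of some unlikely events. -/
theorem sum_menProb_mul_shareSum_le (hM : ∀ m a, 0 < popM m a) {D : Men → ℝ} (hD : ∀ c, 0 < D c)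
    (y : Women → PrefList Men) (w : Women) {L ε : ℝ} (hL : 0 ≤ L) (T : Finset Men)
    (E : Men → (Men → PrefList Women) → Prop)
    (hE : ∀ m ∈ T, (∑ x, if E m x then menProb popM x else 0) ≤ ε)
    (h : ∀ x, (∀ m ∈ T, ¬ E m x) → shareSum D (x, y) w ≤ L) :
    ∑ x, menProb popM x * shareSum D (x, y) w ≤
      L + (min (Fintype.card Men) (Fintype.card Women) + 1) * (T.card * ε) := by
  set K : ℝ := min (Fintype.card Men) (Fintype.card Women) + 1 with hK
  have hK0 : 0 ≤ K := by positivity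
  have h1 : ∀ x, menProb popM x * shareSum D (x, y) w ≤
      L * menProb popM x + K * ∑ m ∈ T, if E m x then menProb popM x else 0 := by
    intro x
    have hx := menProb_nonneg hM x
    have hnn : ∀ m ∈ T, (0:ℝ) ≤ if E m x then menProb popM x else 0 := by
      intro m _
      split_ifs
      · exact hx
      · exact le_rfl
    by_cases hgood : ∀ m ∈ T, ¬ E m x
    · have := mul_le_mul_of_nonneg_left (h x hgood) hx
      have := mul_nonneg hK0 (Finset.sum_nonneg hnn)
      linarith
    · push Not at hgood
      obtain ⟨m, hm, hmE⟩ := hgood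
      have h2 := Finset.single_le_sum hnn hm
      rw [if_pos hmE] at h2
      have h3 : shareSum D (x, y) w ≤ K := shareSum_le (p := (x, y)) (w := w) hD
      have h4 := mul_le_mul_of_nonneg_left h3 hx
      have h5 := mul_le_mul_of_nonneg_left h2 hK0
      have := mul_nonneg hL hx
      linarith
  refine (Finset.sum_le_sum fun x _ => h1 x).trans ?_
  rw [Finset.sum_add_distrib, ← Finset.mul_sum, ← Finset.mul_sum, sum_menProb hM, mul_one,
    Finset.sum_comm]
  refine add_le_add le_rfl (mul_le_mul_of_nonneg_left ?_ hK0)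
  refine (Finset.sum_le_card_nsmul _ _ ε hE).trans ?_
  rw [nsmul_eq_mul]

/-- The bound for markets with many more women than men. -/
theorem expectedStableHusbands_le_of_two_mul_le (hM : ∀ m a, 0 < popM m a)
    (hW : ∀ a m, 0 < popW a m) {q : ℝ} (hq0 : 0 ≤ q) (hq1 : q ≤ 1)
    (hq : ∀ m a b, popM m a ≤ q * (popM m a + popM m b))
    (hMW : 2 * Fintype.card Men ≤ Fintype.card Women) (s : ℕ) (w : Women) :
    expectedStableHusbands popM popW w ≤
      s + 1 + (Fintype.card Men + 1) * (Fintype.card Men * q ^ s) := by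
  classical
  refine (expectedStableHusbands_le_swap hM hW w).trans ?_
  have h : ∀ y, ∑ x, menProb popM x * shareSum (popW w) (x, y) w ≤
      s + 1 + (Fintype.card Men + 1) * (Fintype.card Men * q ^ s) := by
    intro y
    refine (sum_menProb_mul_shareSum_le hM (hW w) y w (L := s + 1) (by positivity) Finset.univ
      (fun m x => Proposed (x, y) w ∅ m w ∧
        s ≤ {m' | Proposed (x, y) w ∅ m' w ∧ ¬ Proposed (x, y) w {m} m' w}.ncard)
      (ε := q ^ s) (fun m _ => ?_) fun x hx => ?_).trans ?_
    · refine le_trans (le_of_eq ?_) (sum_many_proposals_le (y := y) (w := w) (m := m) hM hq0 hq1 hq hMW s)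
      congr!
    · refine shareSum_le_of_few (hW w) fun m hm => ?_
      have := hx m (Finset.mem_univ _)
      simp only [not_and, not_le] at this
      exact this hm
    · rw [min_eq_left (by omega : Fintype.card Men ≤ Fintype.card Women),
        Finset.card_univ]
  refine (Finset.sum_le_sum fun y _ =>
    mul_le_mul_of_nonneg_left (h y) (womenProb_nonneg hW y)).trans (le_of_eq ?_)
  rw [← Finset.sum_mul, sum_womenProb hW, one_mul]

open scoped Classical in
/-- There are few men of popularity at least `1 / N` of the total popularity of all but the top `N`
men. -/
theorem card_relevant_le {D : Men → ℝ} (hD : ∀ c, 0 < D c) {N : ℕ} {T : Finset Men}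
    (hT : T.card ≤ N) :
    (Finset.univ.filter fun m =>
      ∑ c ∈ Finset.univ.filter (fun c => c ∉ T), D c ≤ N * D m).card ≤ 2 * N := by
  set D0 := ∑ c ∈ Finset.univ.filter (fun c => c ∉ T), D c with hD0
  set F := Finset.univ.filter fun m => D0 ≤ N * D m with hF
  have h1 := Finset.card_filter_add_card_filter_not (s := F) (fun m => m ∈ T)
  have h2 : (F.filter fun m => m ∈ T).card ≤ N :=
    (Finset.card_le_card fun m hm => (Finset.mem_filter.1 hm).2).trans hT
  set G := F.filter fun m => ¬ m ∈ T with hG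
  -- Each man of `G` carries at least `1 / N` of the total `D0`, to which they all contribute.
  have h3 : G.card ≤ N := by
    rcases G.eq_empty_or_nonempty with h | ⟨m, hm⟩
    · simp [h]
    have hsub : G ⊆ Finset.univ.filter (fun c => c ∉ T) := by
      intro c hc
      exact Finset.mem_filter.2 ⟨Finset.mem_univ _, (Finset.mem_filter.1 hc).2⟩
    have hpos : 0 < D0 := Finset.sum_pos (fun c _ => hD c) ⟨m, hsub hm⟩
    have h4 : G.card • D0 ≤ ∑ c ∈ G, N * D c := Finset.card_nsmul_le_sum _ _ _ fun c hc =>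
      (Finset.mem_filter.1 (Finset.mem_filter.1 hc).1).2
    have h5 : ∑ c ∈ G, D c ≤ D0 :=
      Finset.sum_le_sum_of_subset_of_nonneg hsub fun c _ _ => (hD c).le
    rw [← Finset.mul_sum, nsmul_eq_mul] at h4
    have h6 := mul_le_mul_of_nonneg_left h5 (Nat.cast_nonneg (α := ℝ) N)
    exact_mod_cast le_of_mul_le_mul_right (h4.trans h6) hpos
  omega

/-- The bound for markets with not many more women than men. -/
theorem expectedStableHusbands_le_log (hM : ∀ m a, 0 < popM m a)
    (hW : ∀ a m, 0 < popW a m) {q : ℝ} (hq0 : 0 ≤ q) (hq1 : q ≤ 1)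
    (hq : ∀ m a b, popM m a ≤ q * (popM m a + popM m b)) (w : Women) {Q : ℝ} (hQ0 : 0 ≤ Q)
    (hQ : ∀ a m m', popW a m / popW a m' ≤ Q * (popW w m / popW w m')) {Z : ℝ} (hZ : 1 < Z)
    (s I : ℕ) (hI : Fintype.card Women < 2 ^ I) {N : ℕ}
    (hN : N = min (Fintype.card Men) (Fintype.card Women)) :
    expectedStableHusbands popM popW w ≤
      2 + 4 * Real.log (1 + N * Z ^ ((s + 2) * I)) +
      (N + 1) * (2 * N * ((1 + N * Fintype.card Women) * q ^ s)) +
      (N + 1) * (Fintype.card Women * (N * (Q * ((N + 1) / Z)))) := by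
  classical
  refine (expectedStableHusbands_le_swap hM hW w).trans ?_
  set D := popW w with hDdef
  have hD : ∀ c, 0 < D c := hW w
  obtain ⟨T, _, hTN, hmax⟩ := exists_top_finset D Finset.univ N
  have hX : 1 ≤ Z ^ ((s + 2) * I) := one_le_pow₀ hZ.le
  set L := 2 + 4 * Real.log (1 + N * Z ^ ((s + 2) * I)) with hL
  have hL0 : 0 ≤ L := by
    have : 0 ≤ Real.log (1 + N * Z ^ ((s + 2) * I)) :=
      Real.log_nonneg (le_add_of_nonneg_right (by positivity))
    positivity
  set ε := (N + 1) * (2 * N * ((1 + N * Fintype.card Women) * q ^ s)) with hε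
  have hε0 : 0 ≤ ε := by positivity
  have hgood : ∀ y, Respects D Z N y →
      ∑ x, menProb popM x * shareSum D (x, y) w ≤ L + ε := by
    intro y hy
    rw [hN] at hy
    -- The union bound is taken over these men only, at most `2 * N` however large `M` is.
    set F := Finset.univ.filter fun m =>
      ∑ c ∈ Finset.univ.filter (fun c => c ∉ T), D c ≤ N * D m with hF
    have hFcard : F.card ≤ 2 * N := card_relevant_le hD hTN
    refine (sum_menProb_mul_shareSum_le hM hD y w hL0 F
      (fun m x => Proposed (x, y) w ∅ m w ∧
        (∃ m', Proposed (x, y) w ∅ m' w ∧ ¬ Proposed (x, y) w {m} m' w ∧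
          (D m + ∑ c ∈ Finset.univ.filter (fun c => Unmatched (x, y) w {m} c), D c) *
            Z ^ ((s + 2) * I) < D m'))
      (ε := (1 + N * Fintype.card Women) * q ^ s) (fun m _ => ?_) fun x hx => ?_).trans ?_
    · refine le_trans (le_of_eq ?_)
        ((sum_climb_le (y := y) (w := w) (m := m) hM hq0 hq1 hq hD hZ.le hy s I hI).trans (le_of_eq ?_))
      · congr!
      · rw [← hN]
        push_cast
        ring
    · refine shareSum_le_of_climb hD hN hX (T := T)
        (fun T' hT' => hmax T' (Finset.subset_univ _) hT') ?_
      intro m hm hmF m' hm' hnot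
      by_contra hlt
      refine hx m ?_ ⟨hm, m', hm', hnot, not_le.1 hlt⟩
      rw [hF, Finset.mem_filter]
      exact ⟨Finset.mem_univ _, by convert hmF⟩
    · rw [← hN]
      refine add_le_add le_rfl (mul_le_mul_of_nonneg_left ?_ (by positivity))
      refine mul_le_mul_of_nonneg_right ?_ (by positivity)
      exact_mod_cast hFcard
  have hbad : ∀ y, ∑ x, menProb popM x * shareSum D (x, y) w ≤ N + 1 := by
    intro y
    refine (Finset.sum_le_sum fun x _ => mul_le_mul_of_nonneg_left
      (shareSum_le (p := (x, y)) (w := w) hD) (menProb_nonneg hM x)).trans (le_of_eq ?_)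
    rw [← Finset.sum_mul, sum_menProb hM, one_mul]
    rw [← hN]
  have h : ∀ y, womenProb popW y * ∑ x, menProb popM x * shareSum D (x, y) w ≤
      (L + ε) * womenProb popW y +
        (N + 1) * (if ¬ Respects D Z N y then womenProb popW y else 0) := by
    intro y
    have hy0 := womenProb_nonneg hW y
    by_cases hy : Respects D Z N y
    · rw [if_neg (not_not.2 hy), mul_zero, add_zero, mul_comm]
      exact mul_le_mul_of_nonneg_right (hgood y hy) hy0
    · rw [if_pos hy]
      have h1 := mul_le_mul_of_nonneg_left (hbad y) hy0
      have h2 : 0 ≤ (L + ε) * womenProb popW y := mul_nonneg (by linarith) hy0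
      linarith
  refine (Finset.sum_le_sum fun y _ => h y).trans ?_
  rw [Finset.sum_add_distrib, ← Finset.mul_sum, ← Finset.mul_sum, sum_womenProb hW, mul_one]
  refine add_le_add le_rfl (mul_le_mul_of_nonneg_left ?_ (by positivity))
  refine le_trans (le_of_eq ?_) (sum_not_respects_le hW w hQ0 hQ hZ N)
  congr!

end Bounds

/-! ### Choice of the parameters and numerical estimates -/

section Numerics

theorem le_ratioR {Men Women : Type*} [Fintype Men] [Fintype Women] (popM : Men → Women → ℝ)
    (m : Men) (a b : Women) : popM m a / popM m b ≤ ratioR popM :=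
  le_ciSup (f := fun x : Men × Women × Women => popM x.1 x.2.1 / popM x.1 x.2.2)
    (Set.finite_range _).bddAbove (m, a, b)

theorem le_ratioQ {Men Women : Type*} [Fintype Men] [Fintype Women] (popW : Women → Men → ℝ)
    (a b : Women) (m m' : Men) :
    popW a m / popW a m' * (popW b m' / popW b m) ≤ ratioQ popW :=
  le_ciSup (f := fun x : (Women × Women) × (Men × Men) =>
    popW x.1.1 x.2.1 / popW x.1.1 x.2.2 * (popW x.1.2 x.2.2 / popW x.1.2 x.2.1))
    (Set.finite_range _).bddAbove ((a, b), (m, m'))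

/-- The length of the runs that are unlikely in the chains. -/
theorem exists_run_length {R : ℝ} (hR : 1 ≤ R) {N : ℕ} (hN : 2 ≤ N) :
    ∃ s : ℕ, (R / (1 + R)) ^ s * (N : ℝ) ^ 10 ≤ 1 ∧
      (s : ℝ) + 2 ≤ 13 * (Real.log N / Real.log (1 + 1 / R)) := by
  have hR0 : 0 < R := by linarith
  set lam := Real.log (1 + 1 / R) with hlam
  set ell := Real.log N with hell
  have hlam0 : 0 < lam := Real.log_pos (lt_add_of_pos_right _ (by positivity))
  have hN0 : (0:ℝ) < N := by positivity
  have hle : lam ≤ ell := by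
    refine Real.log_le_log (by positivity) ?_
    have h1 : 1 / R ≤ 1 := by rw [div_le_one hR0]; exact hR
    have h2 : (2:ℝ) ≤ N := by exact_mod_cast hN
    linarith
  have hell0 : 0 < ell := hlam0.trans_le hle
  -- The factor `10` makes `q ^ s ≤ N ^ (-10)`, which beats all polynomial factors. As `lam ≤ ell`,
  -- rounding up and adding `2` cost at most `3 * (ell / lam)`, whence `13`.
  refine ⟨⌈10 * ell / lam⌉₊, ?_, ?_⟩
  · set s := ⌈10 * ell / lam⌉₊ with hs
    have h1 : 10 * ell / lam ≤ s := Nat.le_ceil _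
    rw [div_le_iff₀ hlam0] at h1
    have h2 : R / (1 + R) = (1 + 1 / R)⁻¹ := by field_simp; ring
    have h3 : (N:ℝ) ^ 10 ≤ (1 + 1 / R) ^ s := by
      rw [← Real.log_le_log_iff (by positivity) (by positivity), Real.log_pow, Real.log_pow]
      push_cast
      exact h1
    rw [h2, inv_pow, inv_mul_le_iff₀ (by positivity), mul_one]
    exact h3
  · have h1 := Nat.ceil_lt_add_one (show 0 ≤ 10 * ell / lam by positivity)
    have h2 : 1 ≤ ell / lam := by rwa [le_div_iff₀ hlam0, one_mul]
    rw [mul_div_assoc] at h1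
    rw [mul_div_assoc]
    linarith

/-- The main term is `(s + 2) * I * log Z ≤ 13 K * 5 log N * 7 log N * (1 + log Q)`, with constant
`455`. The remaining `log (2 N)` costs at most `4` more units, within `460`. -/
theorem log_bound {N I s : ℕ} {K Q : ℝ} (hN : 2 ≤ N) (hI : 2 ^ I ≤ 4 * N) (hQ : 1 ≤ Q)
    (hK : 1 ≤ K) (hs : (s : ℝ) + 2 ≤ 13 * K) :
    Real.log (1 + N * (8 * (N : ℝ) ^ 4 * Q) ^ ((s + 2) * I)) ≤
      460 * (K * (1 + Real.log Q) * Real.log N ^ 2) ∧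
    1 ≤ 3 * ((1 + Real.log Q) * Real.log N ^ 2) := by
  have hln2 := Real.log_two_gt_d9
  set ell := Real.log N with hell
  have hN2 : (2:ℝ) ≤ N := by exact_mod_cast hN
  have hell2 : Real.log 2 ≤ ell := Real.log_le_log (by norm_num) hN2
  have hell69 : 0.69 ≤ ell := by linarith
  set g := 1 + Real.log Q with hg
  have hQ0 : 0 ≤ Real.log Q := Real.log_nonneg hQ
  have hg1 : 1 ≤ g := by linarith
  set Z := 8 * (N : ℝ) ^ 4 * Q with hZ
  have hZ0 : 0 < Z := by positivity
  have hZ1 : 1 ≤ Z := by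
    have h1 : 1 ≤ (N:ℝ) ^ 4 := one_le_pow₀ (by linarith)
    nlinarith
  have hlogZ : Real.log Z ≤ 7 * ell * g := by
    have h1 : Real.log Z = 3 * Real.log 2 + 4 * ell + Real.log Q := by
      rw [hZ, Real.log_mul (by positivity) (by positivity), Real.log_mul (by norm_num)
        (by positivity), Real.log_pow, show (8:ℝ) = 2 ^ 3 by norm_num, Real.log_pow]
      push_cast
      ring
    rw [h1, hg]
    nlinarith
  have hlogZ0 : 0 ≤ Real.log Z := Real.log_nonneg hZ1
  have hIell : (I:ℝ) ≤ 5 * ell := by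
    have h1 : (2:ℝ) ^ I ≤ 4 * N := by exact_mod_cast hI
    have h2 := Real.log_le_log (by positivity) h1
    rw [Real.log_pow, Real.log_mul (by norm_num) (by positivity),
      show (4:ℝ) = 2 ^ 2 by norm_num, Real.log_pow] at h2
    push_cast at h2
    have h3 : (0:ℝ) ≤ I := Nat.cast_nonneg I
    nlinarith
  have hΛ : 1 ≤ 3 * (g * ell ^ 2) := by nlinarith
  have hellΛ : ell ≤ 2 * (g * ell ^ 2) := by
    have : ell ≤ 2 * ell ^ 2 := by nlinarith
    nlinarith [sq_nonneg ell]
  refine ⟨?_, hΛ⟩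
  have hX : 1 ≤ Z ^ ((s + 2) * I) := one_le_pow₀ hZ1
  have h1 : Real.log (1 + N * Z ^ ((s + 2) * I)) ≤
      Real.log 2 + ell + ((s + 2 : ℕ) : ℝ) * I * Real.log Z := by
    have h2 : 1 + N * Z ^ ((s + 2) * I) ≤ 2 * N * Z ^ ((s + 2) * I) := by nlinarith
    refine (Real.log_le_log (by positivity) h2).trans (le_of_eq ?_)
    rw [Real.log_mul (by positivity) (by positivity), Real.log_mul (by norm_num) (by positivity),
      Real.log_pow]
    push_cast
    ring
  have h3 : ((s + 2 : ℕ) : ℝ) * I * Real.log Z ≤ 13 * K * (5 * ell) * (7 * ell * g) := by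
    push_cast
    refine mul_le_mul (mul_le_mul hs hIell (Nat.cast_nonneg _) (by positivity)) hlogZ hlogZ0
      (by positivity)
  have h4 : 0 ≤ g * ell ^ 2 := by positivity
  have h5 : g * ell ^ 2 ≤ K * g * ell ^ 2 := by
    rw [mul_assoc]
    exact le_mul_of_one_le_left h4 hK
  nlinarith

/-- The loss from long climbs: the crude bound `N + 1`, times `2 * N` relevant men, times the
probability for one man. -/
theorem few_runs_bound {N W x : ℝ} (hN : 2 ≤ N) (hW0 : 0 ≤ W) (hW : W ≤ 2 * N) (hx : 0 ≤ x)
    (hs : x * N ^ 10 ≤ 1) : (N + 1) * (2 * N * ((1 + N * W) * x)) ≤ 1 := by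
  refine le_trans ?_ hs
  have h2 : (N + 1) * (2 * N * (1 + N * W)) ≤ N ^ 10 := by
    have h3 : (1:ℝ) + N * W ≤ 3 * N ^ 2 := by nlinarith
    have h4 : (N + 1) * (2 * N * (1 + N * W)) ≤ (2 * N) * (2 * N * (3 * N ^ 2)) := by
      gcongr
      linarith
    have h5 : (2:ℝ) ^ 6 ≤ N ^ 6 := pow_le_pow_left₀ (by norm_num) hN 6
    have h6 : 0 ≤ N ^ 4 := by positivity
    calc _ ≤ (2 * N) * (2 * N * (3 * N ^ 2)) := h4
      _ = 12 * N ^ 4 := by ring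
      _ ≤ N ^ 6 * N ^ 4 := by nlinarith
      _ = N ^ 10 := by ring
  calc (N + 1) * (2 * N * ((1 + N * W) * x))
      = x * ((N + 1) * (2 * N * (1 + N * W))) := by ring
    _ ≤ x * N ^ 10 := mul_le_mul_of_nonneg_left h2 hx

/-- The loss from lists that violate `Respects`; this is what dictates `Z = 8 N ^ 4 Q`. -/
theorem respects_bound {N W Q : ℝ} (hN : 2 ≤ N) (hW0 : 0 ≤ W) (hW : W ≤ 2 * N) (hQ : 0 < Q) :
    (N + 1) * (W * (N * (Q * ((N + 1) / (8 * N ^ 4 * Q))))) ≤ 1 := by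
  have hN0 : 0 < N := by linarith
  have e : (N + 1) * (W * (N * (Q * ((N + 1) / (8 * N ^ 4 * Q))))) =
      ((N + 1) * (N + 1) * W) / (8 * N ^ 3) := by
    field_simp
  rw [e, div_le_one (by positivity)]
  calc (N + 1) * (N + 1) * W ≤ (2 * N) * (2 * N) * (2 * N) := by
        gcongr <;> linarith
    _ = 8 * N ^ 3 := by ring

end Numerics

end StableMarket

/-! ### The main theorem -/

theorem mainTheorem8 :
    ∃ C : ℝ, 0 < C ∧
      ∀ (M W : ℕ), 2 ≤ min M W →
      ∀ (popM : Fin M → Fin W → ℝ) (popW : Fin W → Fin M → ℝ),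
        (∀ m w, 0 < popM m w) → (∀ w m, 0 < popW w m) →
      ∀ w : Fin W,
        StableMarket.expectedStableHusbands popM popW w ≤
          C * ((1 + Real.log (StableMarket.ratioQ popW)) /
              Real.log (1 + 1 / StableMarket.ratioR popM) *
            Real.log ((min M W : ℕ) : ℝ) ^ 3) := by
  -- The logarithm contributes `4 * 460` units of `K * Λ`, and the additive terms `2 + 1 + 1` at
  -- most `12` more, since `1 ≤ K ≤ 3 * (K * Λ)`.
  refine ⟨2000, by norm_num, fun M W hMW popM popW hM hW w => ?_⟩
  set N := min M W with hN
  have hM2 : 2 ≤ M := hMW.trans (min_le_left _ _)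
  let m₀ : Fin M := ⟨0, by omega⟩
  set R := StableMarket.ratioR popM with hR
  set Q := StableMarket.ratioQ popW with hQ
  have hR1 : 1 ≤ R := by
    have := StableMarket.le_ratioR popM m₀ w w
    rwa [div_self (hM m₀ w).ne'] at this
  have hQ1 : 1 ≤ Q := by
    have := StableMarket.le_ratioQ popW w w m₀ m₀
    rwa [div_self (hW w m₀).ne', mul_one] at this
  have hR0 : 0 < R := by linarith
  obtain ⟨s, hs, hsK⟩ := StableMarket.exists_run_length hR1 hMW
  set q := R / (1 + R) with hq
  have hq0 : 0 ≤ q := by positivity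
  have hq1 : q ≤ 1 := div_le_one_of_le₀ (by linarith) (by positivity)
  have hqM : ∀ m a b, popM m a ≤ q * (popM m a + popM m b) := by
    intro m a b
    have h1 := StableMarket.le_ratioR popM m a b
    rw [div_le_iff₀ (hM m b)] at h1
    rw [hq, div_mul_eq_mul_div, le_div_iff₀ (by linarith)]
    linarith
  set K := Real.log N / Real.log (1 + 1 / R) with hK
  have hlam0 : 0 < Real.log (1 + 1 / R) :=
    Real.log_pos (lt_add_of_pos_right _ (by positivity))
  have hN2 : (2:ℝ) ≤ N := by exact_mod_cast hMW
  have hK1 : 1 ≤ K := by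
    rw [hK, le_div_iff₀ hlam0, one_mul]
    refine Real.log_le_log (by positivity) ?_
    have h1 : 1 / R ≤ 1 := by rw [div_le_one hR0]; exact hR1
    linarith
  have hrhs : 2000 * ((1 + Real.log Q) / Real.log (1 + 1 / R) * Real.log N ^ 3) =
      2000 * (K * (1 + Real.log Q) * Real.log N ^ 2) := by
    rw [hK]
    ring
  rw [hrhs]
  -- Enough doublings to exceed `2 * N`, which bounds the number of women in the second case.
  set I := Nat.log 2 (2 * N) + 1 with hI
  have hI1 : 2 * N < 2 ^ I := Nat.lt_pow_succ_log_self (by norm_num) _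
  have hI2 : 2 ^ I ≤ 4 * N := by
    have := Nat.pow_log_le_self 2 (x := 2 * N) (by omega)
    rw [hI, pow_succ]
    omega
  obtain ⟨hlog, hΛ⟩ := StableMarket.log_bound hMW hI2 hQ1 hK1 hsK
  set Λ := (1 + Real.log Q) * Real.log N ^ 2 with hΛdef
  have hKΛ : K * (1 + Real.log Q) * Real.log N ^ 2 = K * Λ := by rw [hΛdef]; ring
  rw [hKΛ] at hlog ⊢
  have hKK : K ≤ 3 * (K * Λ) := by nlinarith
  have hqs : 0 ≤ q ^ s := by positivity
  -- In the first case `W` is not bounded in terms of `N`, and the union bounds over women would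
  -- fail; in the second, `W ≤ 2 * N`.
  by_cases hcase : 2 * M ≤ W
  · have hNM : N = M := by omega
    have h := StableMarket.expectedStableHusbands_le_of_two_mul_le hM hW hq0 hq1 hqM
      (by simpa using hcase) s w
    rw [Fintype.card_fin] at h
    have hNM' : (M:ℝ) = N := by rw [hNM]
    have h1 : ((M:ℝ) + 1) * (M * q ^ s) ≤ 1 := by
      rw [hNM']
      refine le_trans ?_ hs
      have h2 : ((N:ℝ) + 1) * N ≤ N ^ 10 := by
        have h3 : (N:ℝ) ^ 3 ≤ N ^ 10 := pow_le_pow_right₀ (by linarith) (by norm_num)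
        have h4 : ((N:ℝ) + 1) * N ≤ N ^ 3 := by
          rw [pow_succ]
          exact mul_le_mul_of_nonneg_right (by nlinarith) (by linarith)
        linarith
      nlinarith
    linarith
  · have hWN : W ≤ 2 * N := by omega
    have h := StableMarket.expectedStableHusbands_le_log hM hW hq0 hq1 hqM w
      (Q := Q) (by linarith) (fun a m m' => by
        have h1 := StableMarket.le_ratioQ popW a w m m'
        have h2 := hW w m
        have h3 := hW w m'
        rw [← div_le_iff₀ (by positivity), div_div_eq_mul_div, mul_div_assoc]
        exact h1) (Z := 8 * (N:ℝ) ^ 4 * Q) (by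
        have h1 : 1 ≤ (N:ℝ) ^ 4 := one_le_pow₀ (by linarith)
        nlinarith) s I (by rw [Fintype.card_fin]; omega) (N := N) (by simp [hN])
    rw [Fintype.card_fin] at h
    have hWN' : (W:ℝ) ≤ 2 * N := by exact_mod_cast hWN
    have h1 := StableMarket.few_runs_bound hN2 (Nat.cast_nonneg W) hWN' hqs hs
    have h2 := StableMarket.respects_bound hN2 (Nat.cast_nonneg W) hWN' (by linarith : 0 < Q)
    linarith only [h, h1, h2, hlog, hKK, hsK, hK1]
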